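/- Throughout, $p$ and $q$ denote primes. **Sieving system.** For each prime $p$ let $I_p$ be a set of residue classes modulo $p$, and for an integer $v\ne 0$ put $N(v)=\#\{p: v \bmod p\in I_p-I_p\}$. Assume: (a) $|I_p|\le p-1$ for all $p$; (b) $|I_p|\le B$ for all $p$, for some $B\in\mathbb N$; (c) $\prod_{p\le x}(1-|I_p|/p)\sim C_1/\log x$ as $x\to\infty$, for some constant $C_1>0$; (e) for each $\nu\in\{1,\dots,B\}$ the limit $\rho_\nu=\lim_{x\to\infty}\#\{p\le x:|I_p|=\nu\}/(x/\log x)$ exists; (f) $N(v)\ll v^{0.49}$ for all $v\ge 1$; (g) there are constants $c_1,c_2>0$ such that, for all $u\ge 10$, all integers $w$ with $|w|\le u$, all integers $k\ge 1$ and every choice of nonzero integers $m_q$ with $m_q\bmod q\in I_q-I_q$ (one for each prime $q$ with $|I_q|\ge1$), $$\#\{q: |I_q|\ge 1,\ 0<|m_q|\le u,\ m_q+w\ne 0,\ N(m_q+w)\ge k\}\ll u(\log u)^{c_1}e^{-c_2k}.$$ **Notation.** Let $\mathcal N=\{1\le\nu\le B:\rho_\nu>0\}$. Let $$C(1)=\sup\{\delta\in(0,1/2):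 6\cdot 10^{2\delta}/\log(1/(2\delta))<1\},$$ and fix $\delta\in(10^{-3},C(1))$. For large $x$ put $y=\lceil x(\log x)^\delta\rceil$ and $z=y\,(\log\log x)(\log x)^{-1/2}$. For $t>0$ let $P(t)=\prod_{p\le t}p$ and $\sigma(t)=\prod_{p\le t}(1-|I_p|/p)$, and put $\sigma=\sigma(z)$. For $0\le s<t$ let $S_{s,t}$ be the set of integers $n$ with $n\bmod p\notin I_p$ for all primes $s<p\le t$. Given real numbers $M>2$, $K>0$, $\xi>1$, let $$\mathfrak H=\{H\in\{1,\xi,\xi^2,\dots\}: 2y/x\le H\le y/(\xi z)\}.$$ For $H\in\mathfrak H$ and $\nu\in\mathcal N$ let $\mathcal Q_{H,\nu}$ be the set of primes $q\in(y/(\xi H),\,y/H]$ with $|I_q|=\nu$. Let $\mathbf b$ be uniformly distributed on $\mathbb Z/P(z)\mathbb Z$, and put $$\mathbf S=S_{0,z}+\mathbf b,\quad \mathbf S_1=S_{0,H^M}+\mathbf b,\quad \mathbf S_2=S_{H^M,z}+\mathbf b,\quad \sigma_2=\sigma(z)/\sigma(H^M).$$ For each prime $q$ let $a_{1,q},\dots,a_{\nu_q,q}\in[1,q]$,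 with $\nu_q=|I_q|$, be representatives of the distinct classes in $I_q$, in any order. For an integer $n$ and a real number $J$ put $$\mathbf{AP}(J;q,n)=\{n+a_{i,q}+hq: 1\le i\le\nu_q,\ 1\le h\le J\}\cap\mathbf S_1,$$ $$\boldsymbol\lambda(H;q,n)=\begin{cases}\sigma_2^{-|\mathbf{AP}(KH;q,n)|} & \text{if }\mathbf{AP}(KH;q,n)\subset\mathbf S_2,\\ 0&\text{otherwise.}\end{cases}$$ **Theorem.** Let $M>2$, $K>0$, $\xi>1$. Then for all sufficiently large $x$: (i) $\mathbb E|\mathbf S\cap[1,y]|=\sigma y$ and $\mathbb E|\mathbf S\cap[1,y]|^2=\left(1+O\left(\frac1{\log y}\right)\right)(\sigma y)^2$; (ii) for every $H\in\mathfrak H$, $\nu\in\mathcal N$ and $j\in\{0,1,2\}$, $$\mathbb E\sum_{q\in\mathcal Q_{H,\nu}}\Bigl(\sum_{-(K+1)y<n\le y}\boldsymbol\lambda(H;q,n)\Bigr)^j=\left(1+O\left(\frac{\log H}{H^{M-2}}\right)\right)\bigl((K+2)y\bigr)^j|\mathcal Q_{H,\nu}|;$$ (iii) for every $H\in\mathfrak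 H$, $\nu\in\mathcal N$, $i\in\{1,\dots,\nu\}$ and $j\in\{0,1,2\}$, $$\mathbb E\sum_{n\in\mathbf S\cap[1,y]}\Bigl(\sum_{q\in\mathcal Q_{H,\nu}}\ \sum_{1\le h\le KH}\boldsymbol\lambda(H;q,n-a_{i,q}-qh)\Bigr)^j=\left(1+O\left(\frac{\log H}{H^{M-2}}\right)\right)\left(\frac{|\mathcal Q_{H,\nu}|\lfloor KH\rfloor}{\sigma_2}\right)^j\sigma y.$$ Here $0^0=1$. The implied constants and the meaning of "sufficiently large" depend only on the sieving system, $\delta$, $M$, $K$ and $\xi$. -/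

import Mathlib

open Filter Asymptotics

noncomputable section

/-- The finite set of primes `p ≤ t`. -/
def primesUpTo (t : ℝ) : Finset ℕ := (Finset.range (⌊t⌋₊ + 1)).filter Nat.Prime

/-- The primes `p` for which `v mod p` lies in the difference set `I_p - I_p`. -/
def diffPrimes (I : (p : ℕ) → Finset (ZMod p)) (v : ℤ) : Set ℕ :=
  {p | p.Prime ∧ ∃ a ∈ I p, ∃ b ∈ I p, (v : ZMod p) = a - b}

/-- The hypotheses on a sieving system: `I p` is a set of residue classes modulo each prime `p`
(the values of `I` at non-primes are never used), `B` bounds the sizes of the sets `I p`, and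
`ρ ν` is the density of the primes with `|I_p| = ν`, for `1 ≤ ν ≤ B`. -/
structure IsRegularSievingSystem (I : (p : ℕ) → Finset (ZMod p)) (B : ℕ) (ρ : ℕ → ℝ) :
    Prop where
  /-- No `I_p` contains all residue classes. -/
  card_le_pred : ∀ p : ℕ, p.Prime → (I p).card ≤ p - 1
  /-- The sizes are bounded. -/
  card_le : ∀ p : ℕ, p.Prime → (I p).card ≤ B
  /-- The sizes have average value one, in the sense of Mertens. -/
  mertens : ∃ C₁ : ℝ, 0 < C₁ ∧
    (fun x : ℝ => ∏ p ∈ primesUpTo x, (1 - ((I p).card : ℝ) / p))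
      ~[atTop] (fun x : ℝ => C₁ / Real.log x)
  /-- The primes with `|I_p| = ν` have a density. -/
  density : ∀ ν : ℕ, 1 ≤ ν → ν ≤ B →
    Tendsto (fun x : ℝ =>
      (((primesUpTo x).filter (fun p => (I p).card = ν)).card : ℝ) / (x / Real.log x))
      atTop (nhds (ρ ν))
  /-- `N(v) ≪ v ^ 0.49`, where `N(v)` is the number of primes in `diffPrimes I v`. -/
  diff_bound : ∃ C : ℝ, ∀ v : ℤ, 1 ≤ v →
    (diffPrimes I v).Finite ∧ ((diffPrimes I v).ncard : ℝ) ≤ C * (v : ℝ) ^ (0.49 : ℝ)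
  /-- Large values of `N` are rare along shifts of elements of the difference sets. -/
  diff_overlap : ∃ c₁ c₂ C : ℝ, 0 < c₁ ∧ 0 < c₂ ∧
    ∀ (u : ℝ) (m : ℕ → ℤ) (w : ℤ) (k : ℕ), 10 ≤ u →
      (∀ q : ℕ, q.Prime → 1 ≤ (I q).card → m q ≠ 0 ∧ q ∈ diffPrimes I (m q)) →
      |(w : ℝ)| ≤ u → 1 ≤ k →
      {q : ℕ | q.Prime ∧ 1 ≤ (I q).card ∧ 0 < |m q| ∧ |(m q : ℝ)| ≤ u ∧ m q + w ≠ 0 ∧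
        k ≤ (diffPrimes I (m q + w)).ncard}.Finite ∧
      (({q : ℕ | q.Prime ∧ 1 ≤ (I q).card ∧ 0 < |m q| ∧ |(m q : ℝ)| ≤ u ∧ m q + w ≠ 0 ∧
        k ≤ (diffPrimes I (m q + w)).ncard}.ncard : ℕ) : ℝ) ≤
          C * u * Real.log u ^ c₁ * Real.exp (-c₂ * k)

/-- The exponent `C(ρ)`. Only `δ < 1/2` is meant, where the logarithm is positive. -/
def gapExponent (ρ : ℝ) : ℝ :=
  sSup {δ : ℝ | 0 < δ ∧ δ < 1 / 2 ∧ 6 * (10 : ℝ) ^ (2 * δ) / Real.log (1 / (2 * δ)) < ρ}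

/-- `y = ⌈x (log x)^δ⌉`. -/
def yParam (δ x : ℝ) : ℕ := ⌈x * Real.log x ^ δ⌉₊

/-- `z = y (log log x) / (log x)^(1/2)`. -/
def zParam (δ x : ℝ) : ℝ :=
  yParam δ x * Real.log (Real.log x) / Real.log x ^ (1 / 2 : ℝ)

/-- The set of scales: powers `H = ξ ^ k`, `k ≥ 0`, with `2y/x ≤ H ≤ y/(ξ z)`. -/
def scales (ξ δ x : ℝ) : Set ℝ :=
  {H | (∃ k : ℕ, H = ξ ^ k) ∧ 2 * yParam δ x / x ≤ H ∧ H ≤ yParam δ x / (ξ * zParam δ x)}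

/-- The sizes `1 ≤ ν ≤ B` that occur with positive density. -/
def frequentSizes (B : ℕ) (ρ : ℕ → ℝ) : Set ℕ := {ν | 1 ≤ ν ∧ ν ≤ B ∧ 0 < ρ ν}

/-- The set `Q_{H,ν}` of the primes `q ∈ (y/(ξH), y/H]` with `|I_q| = ν`. -/
def scalePrimes (I : (p : ℕ) → Finset (ZMod p)) (ξ δ x H : ℝ) (ν : ℕ) : Finset ℕ :=
  (primesUpTo (yParam δ x / H)).filter
    (fun q => yParam δ x / (ξ * H) < (q : ℝ) ∧ (I q).card = ν)

/-- `P(t)`, the product of the primes `p ≤ t`. -/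
def primeProd (t : ℝ) : ℕ := ∏ p ∈ primesUpTo t, p

/-- `σ(t) = ∏_{p ≤ t} (1 - |I_p|/p)`. -/
def sieveDensity (I : (p : ℕ) → Finset (ZMod p)) (t : ℝ) : ℝ :=
  ∏ p ∈ primesUpTo t, (1 - ((I p).card : ℝ) / p)

/-- `σ₂ = σ(z) / σ(H^M)`. -/
def sieveDensity₂ (I : (p : ℕ) → Finset (ZMod p)) (M z H : ℝ) : ℝ :=
  sieveDensity I z / sieveDensity I (H ^ M)

/-- The integers lying in no class of `I_p` for the primes `s < p ≤ t`. -/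
def siftedSet (I : (p : ℕ) → Finset (ZMod p)) (s t : ℝ) : Set ℤ :=
  {n | ∀ p : ℕ, p.Prime → s < p → (p : ℝ) ≤ t → (n : ZMod p) ∉ I p}

/-- The shift by `b` of the set of integers lying in no class of `I_p` for `s < p ≤ t`. It
depends only on `b` modulo the product of these primes. With `(s, t)` equal to `(0, z)`,
`(0, H^M)` and `(H^M, z)` it is `S`, `S₁` and `S₂`. -/
def shiftedSet (I : (p : ℕ) → Finset (ZMod p)) (s t : ℝ) (b : ℤ) : Set ℤ :=
  {n | n - b ∈ siftedSet I s t}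

/-- The expectation of `f b` for `b` uniformly distributed over the residue classes modulo `P`,
represented by `0, 1, ..., P - 1`. -/
def residueExpectation (P : ℕ) (f : ℤ → ℝ) : ℝ := (∑ b ∈ Finset.range P, f b) / P

/-- The representatives in `[1, q]` of the classes in `I_q`. -/
def residueReps (I : (p : ℕ) → Finset (ZMod p)) (q : ℕ) : Finset ℤ :=
  (Finset.Icc (1 : ℤ) q).filter (fun a => (a : ZMod q) ∈ I q)

open Classical in
/-- `S ∩ [1, y]`. -/
def sievedInterval (I : (p : ℕ) → Finset (ZMod p)) (z : ℝ) (y : ℕ) (b : ℤ) : Finset ℤ :=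
  (Finset.Icc (1 : ℤ) y).filter (fun n => n ∈ shiftedSet I 0 z b)

open Classical in
/-- `AP(J; q, n)`: the elements `n + a + h q` of `S₁`, where `a` runs through the representatives
in `[1, q]` of the classes in `I_q` and `1 ≤ h ≤ J`. -/
def apSet (I : (p : ℕ) → Finset (ZMod p)) (M H : ℝ) (b : ℤ) (J : ℝ) (q : ℕ) (n : ℤ) :
    Finset ℤ :=
  ((residueReps I q ×ˢ Finset.Icc 1 ⌊J⌋₊).image
    (fun ah : ℤ × ℕ => n + ah.1 + (ah.2 : ℤ) * q)).filter
      (fun m => m ∈ shiftedSet I 0 (H ^ M) b)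

open Classical in
/-- The weight `λ(H; q, n)`: it is `σ₂ ^ (-|AP(KH; q, n)|)` if `AP(KH; q, n) ⊆ S₂`, and `0`
otherwise. -/
def sieveWeight (I : (p : ℕ) → Finset (ZMod p)) (M K z : ℝ) (b : ℤ) (H : ℝ) (q : ℕ) (n : ℤ) :
    ℝ :=
  if (apSet I M H b (K * H) q n : Set ℤ) ⊆ shiftedSet I (H ^ M) z b then
    1 / sieveDensity₂ I M z H ^ (apSet I M H b (K * H) q n).card
  else 0

/-- `a 1 q, ..., a ν q` lists, for every prime `q`, the representatives in `[1, q]` of the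
`ν = |I_q|` classes in `I_q`, without repetition and in any order. -/
def IsEnumeration (I : (p : ℕ) → Finset (ZMod p)) (a : ℕ → ℕ → ℤ) : Prop :=
  ∀ q : ℕ, q.Prime →
    Set.BijOn (fun i => a i q) (Set.Icc 1 (I q).card) (residueReps I q : Set ℤ)

end

/-! Everything rests on one local computation. For a finite set `V` of integers, the shift by `b` of
the set sifted by the primes `s < p ≤ t` contains `V` exactly when, for each such `p`, the class of
`b` avoids `U_p`, the union of the translates `v - I_p` over `v ∈ V`. By the Chinese remainder
theorem these conditions are independent, so the probability is the product of `1 - |U_p|/p`. The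
translates are disjoint unless some difference `v - v'` lies in `I_p - I_p`, and `|U_p|` falls short
of `|V| |I_p|` by at most `|I_p|` times the number of colliding ordered pairs
(`le_card_shiftClasses`). Hence the probability is `σ^|V|`, with `σ` the sieve density of the range,
up to a factor whose logarithm is `O(|V|² / s * (1 + max N(v - v')))` (`abs_containDensity_sub_le`,
`densityError_le`).

For (ii) and (iii), fix `b` modulo the primes up to `H^M`. This fixes `S₁`, hence the set that the
weight tests against `S₂`, and the weight is normalised to have conditional mean close to 1
(`abs_residueExpectation_containWeight_sub_le`). With `s = H^M` and `|V| ≪ H` the relative error is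
about `exp(θ (1 + N)) - 1`, where `θ ≍ H^(2-M)` and `N` is the largest `N(v - v')`. When `j = 2`,
the product of two weights is the weight of the union if the progressions are disjoint. In (iii)
both progressions pass through `n`; if they meet nowhere else, the doubly counted point contributes
one extra factor `1/σ₂`. The remaining pairs are at most a proportion `y^(-1/10)` of all (for two
primes in (iii) this is where `N(v) ≪ v^0.49` enters), and there the expectation exceeds the main
value by a factor of at most `y^(1/20)`, because `H` is at most the square root of `log y`.

It remains to average `exp(θ (1 + N)) - 1`. Every difference that occurs is, apart from `n - n'`, an
element of `I_q - I_q` plus a shift, so the last hypothesis on the system bounds the proportion of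
`q` with `N ≥ k` by a power of `log y` times `exp(-c k)`. Thus `N` is effectively at most a constant
times `log log y`, which is `O(log H)` because `H ≥ (log y)^δ`. This is the source of the factor
`log H` (`abs_sum_sub_le_of_tail`, `eventually_abs_sum_sub_le`).

In (i), the mean is immediate and the lower bound for the second moment is Cauchy–Schwarz. For the
upper bound, the pair probabilities are summed with the primes split at `T = log y / 20` and
`T^(4B+6)`: up to `T` the sieve is periodic with period below `y` and is treated exactly; in the
middle range the correlation factor is bounded and its excess is averaged over sifted `n`; beyond
it, the correlation may be a power of `log y`, but its average is smaller still
(`second_moment_le`). -/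

/-! ### Expectations over residue classes. -/

/-- The Chinese remainder theorem as independence: the residues of one uniform `b` modulo `m` and
modulo `n` behave like two independent variables. The two arguments of `g` separate the two
dependences. -/
theorem residueExpectation_mul {m n : ℕ} (hmn : m.Coprime n) (hm : 0 < m) (hn : 0 < n)
    (g : ℤ → ℤ → ℝ) (h₁ : ∀ b b' c, (m : ℤ) ∣ b - b' → g b c = g b' c)
    (h₂ : ∀ b c c', (n : ℤ) ∣ c - c' → g b c = g b c') :
    residueExpectation (m * n) (fun b => g b b) =
      residueExpectation m (fun b => residueExpectation n (fun c => g b c)) := by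
  have key : ∑ b ∈ Finset.range (m * n), g b b =
      ∑ b ∈ Finset.range m, ∑ c ∈ Finset.range n, g b c := by
    rw [← Finset.sum_product']
    refine Finset.sum_nbij' (fun b => (b % m, b % n))
      (fun bc => (Nat.chineseRemainder hmn bc.1 bc.2 : ℕ)) ?_ ?_ ?_ ?_ ?_
    · intro b _
      simp [Nat.mod_lt, hm, hn]
    · rintro ⟨b, c⟩ _
      simpa using Nat.chineseRemainder_lt_mul hmn b c hm.ne' hn.ne'
    · intro b hb
      have hb' : b < m * n := by simpa using hb
      have := Nat.chineseRemainder_modEq_unique hmn (a := b % m) (b := b % n) (z := b)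
        (Nat.mod_modEq b m).symm (Nat.mod_modEq b n).symm
      have h := Nat.chineseRemainder_lt_mul hmn (b % m) (b % n) hm.ne' hn.ne'
      exact (Nat.ModEq.eq_of_lt_of_lt this hb' h).symm
    · rintro ⟨b, c⟩ hbc
      simp only [Finset.mem_product, Finset.mem_range] at hbc
      have h := (Nat.chineseRemainder hmn b c).2
      ext
      · exact Nat.mod_eq_of_modEq h.1 hbc.1
      · exact Nat.mod_eq_of_modEq h.2 hbc.2
    · intro b _
      have e₁ : (m : ℤ) ∣ (b : ℤ) - ((b % m : ℕ) : ℤ) := by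
        push_cast; exact Int.dvd_self_sub_emod
      have e₂ : (n : ℤ) ∣ (b : ℤ) - ((b % n : ℕ) : ℤ) := by
        push_cast; exact Int.dvd_self_sub_emod
      simp only
      rw [h₁ _ _ _ e₁, h₂ _ _ _ e₂]
  unfold residueExpectation
  rw [key]
  push_cast
  rw [mul_comm, ← div_div, Finset.sum_div]

theorem residueExpectation_sum {ι : Type*} (P : ℕ) (s : Finset ι) (f : ι → ℤ → ℝ) :
    residueExpectation P (fun b => ∑ i ∈ s, f i b) =
      ∑ i ∈ s, residueExpectation P (f i) := by
  unfold residueExpectation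
  rw [Finset.sum_comm, Finset.sum_div]

theorem residueExpectation_const_mul (P : ℕ) (c : ℝ) (f : ℤ → ℝ) :
    residueExpectation P (fun b => c * f b) = c * residueExpectation P f := by
  unfold residueExpectation
  rw [← Finset.mul_sum, mul_div_assoc]

theorem residueExpectation_mul_const (P : ℕ) (c : ℝ) (f : ℤ → ℝ) :
    residueExpectation P (fun b => f b * c) = residueExpectation P f * c := by
  simp only [mul_comm _ c, residueExpectation_const_mul]

theorem residueExpectation_const {P : ℕ} (hP : 0 < P) (c : ℝ) :
    residueExpectation P (fun _ => c) = c := by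
  unfold residueExpectation
  have : (P : ℝ) ≠ 0 := by positivity
  simp; field_simp

theorem residueExpectation_mono (P : ℕ) {f g : ℤ → ℝ} (h : ∀ b, f b ≤ g b) :
    residueExpectation P f ≤ residueExpectation P g := by
  unfold residueExpectation
  gcongr
  exact h _

theorem residueExpectation_nonneg (P : ℕ) {f : ℤ → ℝ} (h : ∀ b, 0 ≤ f b) :
    0 ≤ residueExpectation P f :=
  div_nonneg (Finset.sum_nonneg fun _ _ => h _) (Nat.cast_nonneg _)

theorem residueExpectation_abs_sub_le (P : ℕ) {f g h : ℤ → ℝ} (H : ∀ b, |f b - g b| ≤ h b) :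
    |residueExpectation P f - residueExpectation P g| ≤ residueExpectation P h := by
  unfold residueExpectation
  rw [← sub_div, ← Finset.sum_sub_distrib, abs_div, Nat.abs_cast]
  gcongr
  exact (Finset.abs_sum_le_sum_abs _ _).trans (Finset.sum_le_sum fun _ _ => H _)

/-- Cauchy–Schwarz. It supplies the lower bound for the second moment in (i), so that only an upper
bound needs sieve estimates. -/
theorem residueExpectation_sq_le {P : ℕ} (hP : 0 < P) (f : ℤ → ℝ) :
    residueExpectation P f ^ 2 ≤ residueExpectation P (fun b => f b ^ 2) := by
  unfold residueExpectation
  have h := sq_sum_le_card_mul_sum_sq (s := Finset.range P) (f := fun b => f (b : ℤ))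
  rw [Finset.card_range] at h
  have hP' : (0 : ℝ) < P := by exact_mod_cast hP
  rw [div_pow, div_le_div_iff₀ (by positivity) hP']
  nlinarith

theorem sum_range_natCast_zmod {p : ℕ} [NeZero p] (f : ZMod p → ℝ) :
    ∑ b ∈ Finset.range p, f (b : ZMod p) = ∑ x : ZMod p, f x := by
  refine Finset.sum_nbij' (fun b => (b : ZMod p)) ZMod.val ?_ ?_ ?_ ?_ ?_
  · simp
  · intro x _; simpa using ZMod.val_lt x
  · intro b hb; exact ZMod.val_cast_of_lt (by simpa using hb)
  · intro x _; simp
  · simp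

theorem residueExpectation_notMem {p : ℕ} (hp : 0 < p) (U : Finset (ZMod p)) :
    residueExpectation p (Set.indicator {b : ℤ | (b : ZMod p) ∉ U} 1) = 1 - (U.card : ℝ) / p := by
  classical
  have : NeZero p := ⟨hp.ne'⟩
  have hp' : (p : ℝ) ≠ 0 := by positivity
  unfold residueExpectation
  have h : ∑ b ∈ Finset.range p, (Set.indicator {b : ℤ | (b : ZMod p) ∉ U} 1 (b : ℤ) : ℝ) =
      ∑ x : ZMod p, (if x ∉ U then (1 : ℝ) else 0) := by
    rw [← sum_range_natCast_zmod]
    refine Finset.sum_congr rfl fun b _ => ?_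
    simp [Set.indicator_apply]
  rw [h, Finset.sum_boole]
  have : (Finset.univ.filter (fun x => x ∉ U)) = Uᶜ := by ext; simp
  rw [this, Finset.card_compl, ZMod.card, Nat.cast_sub (by
    simpa [ZMod.card] using Finset.card_le_univ U)]
  field_simp

/-! ### Independence of the sieve conditions at distinct primes. -/

/-- The integers avoiding the classes in `U p` for every `p ∈ S`. -/
def avoidSet (S : Finset ℕ) (U : (p : ℕ) → Finset (ZMod p)) : Set ℤ :=
  {b | ∀ p ∈ S, (b : ZMod p) ∉ U p}

theorem mem_avoidSet_congr {S : Finset ℕ} {U : (p : ℕ) → Finset (ZMod p)} {b b' : ℤ}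
    (h : ((∏ p ∈ S, p : ℕ) : ℤ) ∣ b - b') : b ∈ avoidSet S U ↔ b' ∈ avoidSet S U := by
  refine forall₂_congr fun p hp => ?_
  have : (p : ℤ) ∣ b - b' := (Int.natCast_dvd_natCast.2 (Finset.dvd_prod_of_mem _ hp)).trans h
  rw [(ZMod.intCast_eq_intCast_iff_dvd_sub b' b p).2 this]

/-- Conditions at different primes are independent; one prime at a time is split off with
`residueExpectation_mul`. -/
theorem residueExpectation_avoidSet {S : Finset ℕ} (hS : ∀ p ∈ S, p.Prime)
    (U : (p : ℕ) → Finset (ZMod p)) :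
    residueExpectation (∏ p ∈ S, p) (Set.indicator (avoidSet S U) 1) =
      ∏ p ∈ S, (1 - ((U p).card : ℝ) / p) := by
  classical
  induction S using Finset.induction_on with
  | empty => simp [residueExpectation, avoidSet]
  | insert q S hq ih =>
    have hqp : q.Prime := hS q (Finset.mem_insert_self _ _)
    have hS' : ∀ p ∈ S, p.Prime := fun p hp => hS p (Finset.mem_insert_of_mem hp)
    rw [Finset.prod_insert hq, Finset.prod_insert hq]
    have hcop : q.Coprime (∏ p ∈ S, p) := Nat.Coprime.prod_right fun p hp =>
      (Nat.coprime_primes hqp (hS' p hp)).2 (fun h => hq (h ▸ hp))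
    have e : (Set.indicator (avoidSet (insert q S) U) 1 : ℤ → ℝ) = fun b =>
        (fun b c => Set.indicator {b : ℤ | (b : ZMod q) ∉ U q} (1 : ℤ → ℝ) b *
          Set.indicator (avoidSet S U) (1 : ℤ → ℝ) c) b b := by
      funext b
      simp only
      rw [← Pi.mul_apply, ← Set.inter_indicator_one]
      congr 1
      ext b
      simp [avoidSet]
    rw [e, residueExpectation_mul hcop hqp.pos (Finset.prod_pos fun p hp => (hS' p hp).pos)
      (fun b c => Set.indicator {b : ℤ | (b : ZMod q) ∉ U q} (1 : ℤ → ℝ) b *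
          Set.indicator (avoidSet S U) (1 : ℤ → ℝ) c)]
    · simp_rw [residueExpectation_const_mul, residueExpectation_mul_const]
      rw [ih hS', ← residueExpectation_notMem hqp.pos]
    · intro b b' c h
      have := (ZMod.intCast_eq_intCast_iff_dvd_sub b' b q).2 h
      simp only [Set.indicator_apply, Set.mem_ofPred_eq, this, Pi.one_apply]
    · intro b c c' h
      simp only [Set.indicator_apply, mem_avoidSet_congr (U := U) h, Pi.one_apply]

/-- The primes `p` with `s < p ≤ t`. -/
noncomputable def primesBetween (s t : ℝ) : Finset ℕ := open Classical in
  (primesUpTo t).filter (fun p => s < (p : ℝ))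

theorem mem_primesUpTo {t : ℝ} {p : ℕ} : p ∈ primesUpTo t ↔ p.Prime ∧ (p : ℝ) ≤ t := by
  simp only [primesUpTo, Finset.mem_filter, Finset.mem_range, Nat.lt_succ_iff]
  constructor
  · rintro ⟨h, hp⟩
    exact ⟨hp, (Nat.le_floor_iff' hp.ne_zero).1 h⟩
  · rintro ⟨hp, h⟩
    exact ⟨(Nat.le_floor_iff' hp.ne_zero).2 h, hp⟩

theorem mem_primesBetween {s t : ℝ} {p : ℕ} :
    p ∈ primesBetween s t ↔ p.Prime ∧ s < p ∧ (p : ℝ) ≤ t := by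
  simp only [primesBetween, Finset.mem_filter, mem_primesUpTo]
  tauto

theorem primesBetween_zero (t : ℝ) : primesBetween 0 t = primesUpTo t := by
  ext p
  rw [mem_primesBetween, mem_primesUpTo]
  exact ⟨fun h => ⟨h.1, h.2.2⟩, fun h => ⟨h.1, by exact_mod_cast h.1.pos, h.2⟩⟩

theorem prod_primesUpTo_split {α : Type*} [CommMonoid α] {s t : ℝ} (hst : s ≤ t) (f : ℕ → α) :
    ∏ p ∈ primesUpTo t, f p =
      (∏ p ∈ primesUpTo s, f p) * ∏ p ∈ primesBetween s t, f p := by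
  classical
  rw [← Finset.prod_union]
  · congr 1
    ext p
    simp only [Finset.mem_union, mem_primesBetween, mem_primesUpTo]
    constructor
    · rintro ⟨h, h'⟩
      rcases le_or_gt (p : ℝ) s with h'' | h''
      · exact Or.inl ⟨h, h''⟩
      · exact Or.inr ⟨h, h'', h'⟩
    · rintro (⟨h, h'⟩ | ⟨h, h', h''⟩)
      · exact ⟨h, h'.trans hst⟩
      · exact ⟨h, h''⟩
  · rw [Finset.disjoint_left]
    intro p h h'
    rw [mem_primesUpTo] at h
    rw [mem_primesBetween] at h'
    linarith [h.2, h'.2.1]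

/-! ### The probability that a random shift contains a given finite set. -/

/-- The classes of `b` modulo `p` for which some `v ∈ V` has `v - b ∈ I_p`. -/
def shiftClasses (I : (p : ℕ) → Finset (ZMod p)) (V : Finset ℤ) (p : ℕ) : Finset (ZMod p) :=
  open Classical in V.biUnion (fun v => (I p).image (fun a => (v : ZMod p) - a))

theorem mem_shiftClasses {I : (p : ℕ) → Finset (ZMod p)} {V : Finset ℤ} {p : ℕ} {c : ZMod p} :
    c ∈ shiftClasses I V p ↔ ∃ v ∈ V, (v : ZMod p) - c ∈ I p := by
  simp only [shiftClasses, Finset.mem_biUnion, Finset.mem_image]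
  refine exists_congr fun v => and_congr_right fun _ => ⟨?_, fun h => ⟨_, h, by ring⟩⟩
  rintro ⟨a, ha, rfl⟩
  simpa using ha

/-- Change of viewpoint: a condition on the elements of `V` becomes, prime by prime, a condition on
the residue of the random shift `b`. -/
theorem subset_shiftedSet_iff {I : (p : ℕ) → Finset (ZMod p)} {s t : ℝ} {V : Finset ℤ} {b : ℤ} :
    (V : Set ℤ) ⊆ shiftedSet I s t b ↔ b ∈ avoidSet (primesBetween s t) (shiftClasses I V) := by
  simp only [Set.subset_def, shiftedSet, siftedSet, avoidSet, Set.mem_ofPred_eq, mem_primesBetween,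
    mem_shiftClasses, Finset.mem_coe, Int.cast_sub]
  constructor
  · rintro h p ⟨hp, h₁, h₂⟩ ⟨v, hv, hv'⟩
    exact h v hv p hp h₁ h₂ hv'
  · intro h v hv p hp h₁ h₂ hv'
    exact h p ⟨hp, h₁, h₂⟩ ⟨v, hv, hv'⟩

theorem mem_shiftedSet_iff {I : (p : ℕ) → Finset (ZMod p)} {s t : ℝ} {n b : ℤ} :
    n ∈ shiftedSet I s t b ↔ b ∈ avoidSet (primesBetween s t) (shiftClasses I {n}) := by
  rw [← subset_shiftedSet_iff]; simp

/-- The product of the primes `s < p ≤ t`. -/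
noncomputable def primeProdBetween (s t : ℝ) : ℕ := ∏ p ∈ primesBetween s t, p

theorem primeProd_eq_mul {s t : ℝ} (hst : s ≤ t) :
    primeProd t = primeProd s * primeProdBetween s t :=
  prod_primesUpTo_split hst _

theorem primeProdBetween_zero (t : ℝ) : primeProdBetween 0 t = primeProd t := by
  rw [primeProdBetween, primesBetween_zero, primeProd]

theorem primeProdBetween_pos (s t : ℝ) : 0 < primeProdBetween s t :=
  Finset.prod_pos fun _ hp => (mem_primesBetween.1 hp).1.pos

theorem primeProd_pos (t : ℝ) : 0 < primeProd t :=
  Finset.prod_pos fun _ hp => (mem_primesUpTo.1 hp).1.pos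

theorem coprime_primeProd (s t : ℝ) : (primeProd s).Coprime (primeProdBetween s t) := by
  refine Nat.Coprime.prod_left fun p hp => Nat.Coprime.prod_right fun q hq => ?_
  rw [mem_primesUpTo] at hp
  rw [mem_primesBetween] at hq
  rw [Nat.coprime_primes hp.1 hq.1]
  rintro rfl
  linarith [hp.2, hq.2.1]

theorem coprime_prime_primeProd {s : ℝ} {p : ℕ} (hp : p.Prime) (hs : s < p) :
    p.Coprime (primeProd s) := by
  refine Nat.Coprime.prod_right fun q hq => ?_
  rw [mem_primesUpTo] at hq
  rw [Nat.coprime_primes hp hq.1]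
  rintro rfl
  linarith [hq.2]

theorem mem_shiftedSet_congr {I : (p : ℕ) → Finset (ZMod p)} {s t : ℝ} {n b b' : ℤ}
    (h : (primeProdBetween s t : ℤ) ∣ b - b') :
    n ∈ shiftedSet I s t b ↔ n ∈ shiftedSet I s t b' := by
  rw [mem_shiftedSet_iff, mem_shiftedSet_iff]
  exact mem_avoidSet_congr h

theorem shiftedSet_congr {I : (p : ℕ) → Finset (ZMod p)} {s t : ℝ} {b b' : ℤ}
    (h : (primeProdBetween s t : ℤ) ∣ b - b') : shiftedSet I s t b = shiftedSet I s t b' :=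
  Set.ext fun _ => mem_shiftedSet_congr h

theorem mem_shiftedSet_split {I : (p : ℕ) → Finset (ZMod p)} {s t : ℝ} (hs : 0 ≤ s) (hst : s ≤ t)
    {n b : ℤ} : n ∈ shiftedSet I 0 t b ↔ n ∈ shiftedSet I 0 s b ∧ n ∈ shiftedSet I s t b := by
  simp only [shiftedSet, siftedSet, Set.mem_ofPred_eq]
  constructor
  · exact fun h => ⟨fun p hp h₁ h₂ => h p hp h₁ (h₂.trans hst),
      fun p hp h₁ h₂ => h p hp (hs.trans_lt h₁) h₂⟩
  · rintro ⟨h, h'⟩ p hp h₁ h₂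
    rcases le_or_gt (p : ℝ) s with h₃ | h₃
    · exact h p hp h₁ h₃
    · exact h' p hp h₃ h₂

/-- The density of the integers `b` for which the shift by `b` contains `V`. -/
noncomputable def containDensity (I : (p : ℕ) → Finset (ZMod p)) (s t : ℝ) (V : Finset ℤ) : ℝ :=
  ∏ p ∈ primesBetween s t, (1 - ((shiftClasses I V p).card : ℝ) / p)

theorem residueExpectation_subset_shiftedSet (I : (p : ℕ) → Finset (ZMod p)) (s t : ℝ)
    (V : Finset ℤ) :
    residueExpectation (primeProdBetween s t)
      (fun b => Set.indicator {b : ℤ | (V : Set ℤ) ⊆ shiftedSet I s t b} 1 b) =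
      containDensity I s t V := by
  rw [containDensity, ← residueExpectation_avoidSet fun p hp => (mem_primesBetween.1 hp).1]
  have : {b : ℤ | (V : Set ℤ) ⊆ shiftedSet I s t b} =
      avoidSet (primesBetween s t) (shiftClasses I V) := Set.ext fun _ => subset_shiftedSet_iff
  rw [this]
  rfl

theorem card_shiftClasses_singleton (I : (p : ℕ) → Finset (ZMod p)) (n : ℤ) (p : ℕ) :
    (shiftClasses I {n} p).card = (I p).card := by
  classical
  rw [shiftClasses, Finset.singleton_biUnion]
  exact Finset.card_image_of_injective _ sub_right_injective

theorem containDensity_singleton (I : (p : ℕ) → Finset (ZMod p)) (t : ℝ) (n : ℤ) :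
    containDensity I 0 t {n} = sieveDensity I t := by
  simp only [containDensity, card_shiftClasses_singleton, primesBetween_zero, sieveDensity]

theorem residueExpectation_mem_shiftedSet (I : (p : ℕ) → Finset (ZMod p)) (t : ℝ) (n : ℤ) :
    residueExpectation (primeProd t)
      (fun b => Set.indicator {b : ℤ | n ∈ shiftedSet I 0 t b} 1 b) = sieveDensity I t := by
  rw [← containDensity_singleton I t n, ← residueExpectation_subset_shiftedSet,
    primeProdBetween_zero]
  simp

/-! ### Collisions and the comparison with independent elements. -/

/-- The number of ordered pairs of distinct elements of `V` whose difference lies in `I_p - I_p`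
modulo `p`. -/
noncomputable def collisions (I : (p : ℕ) → Finset (ZMod p)) (V : Finset ℤ) (p : ℕ) : ℕ :=
  open Classical in (V.offDiag.filter (fun v => p ∈ diffPrimes I (v.1 - v.2))).card

theorem card_shiftClasses_le (I : (p : ℕ) → Finset (ZMod p)) (V : Finset ℤ) (p : ℕ) :
    (shiftClasses I V p).card ≤ V.card * (I p).card := by
  classical
  exact Finset.card_biUnion_le_card_mul _ _ _ fun v _ => Finset.card_image_le

/-- The elements involved in no collision have pairwise disjoint translates `v - I_p`, each of full
size. Every other element is the first entry of some colliding pair, so there are at most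
`collisions I V p` of them. -/
theorem le_card_shiftClasses (I : (p : ℕ) → Finset (ZMod p)) (V : Finset ℤ) {p : ℕ}
    (hp : p.Prime) :
    V.card * (I p).card ≤ (shiftClasses I V p).card + (I p).card * collisions I V p := by
  classical
  set W := V.filter (fun v => ∀ v' ∈ V, v' ≠ v → p ∉ diffPrimes I (v - v')) with hW
  have h₁ : W.card * (I p).card ≤ (shiftClasses I V p).card := by
    have : (W.biUnion (fun v => (I p).image (fun a => (v : ZMod p) - a))).card =
        W.card * (I p).card := by
      rw [Finset.card_biUnion]
      · refine (Finset.sum_congr rfl (g := fun _ => (I p).card) fun v _ =>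
          Finset.card_image_of_injective (I p) sub_right_injective).trans ?_
        simp
      · intro v hv v' hv' hne
        rw [Function.onFun, Finset.disjoint_left]
        intro c hc hc'
        rw [Finset.mem_image] at hc hc'
        obtain ⟨a, ha, rfl⟩ := hc
        obtain ⟨a', ha', h⟩ := hc'
        refine (Finset.mem_filter.1 hv).2 v' (Finset.mem_filter.1 hv').1 hne.symm
          ⟨hp, a, ha, a', ha', ?_⟩
        push_cast
        linear_combination -h
    rw [← this]
    exact Finset.card_le_card (Finset.biUnion_subset_biUnion_of_subset_left _
      (Finset.filter_subset _ _))
  have h₂ : (V \ W).card ≤ collisions I V p := by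
    have hsub : V \ W ⊆ (V.offDiag.filter (fun v => p ∈ diffPrimes I (v.1 - v.2))).image
        Prod.fst := by
      intro v hv
      simp only [hW, Finset.mem_sdiff, Finset.mem_filter, not_and, not_forall, not_not] at hv
      obtain ⟨hv, h⟩ := hv
      obtain ⟨v', hv', hne, h⟩ := h hv
      rw [Finset.mem_image]
      exact ⟨(v, v'), by simp [hv, hv', hne.symm, h], rfl⟩
    exact (Finset.card_le_card hsub).trans Finset.card_image_le
  have h₃ : V.card = (V \ W).card + W.card :=
    (Finset.card_sdiff_add_card_eq_card (Finset.filter_subset _ _)).symm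
  rw [h₃]
  nlinarith

theorem exp_neg_le_one_sub {x : ℝ} (h₀ : 0 ≤ x) (h₁ : x ≤ 1 / 2) :
    Real.exp (-(x + 2 * x ^ 2)) ≤ 1 - x := by
  rw [← Real.le_log_iff_exp_le (by linarith)]
  have h := Real.abs_log_sub_add_sum_range_le (x := x) (by rw [abs_of_nonneg h₀]; linarith) 1
  simp only [Finset.range_one, Finset.sum_singleton, abs_of_nonneg h₀] at h
  norm_num at h
  have h2 : x ^ 2 / (1 - x) ≤ 2 * x ^ 2 := by
    rw [div_le_iff₀ (by linarith)]
    nlinarith [sq_nonneg x]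
  have := (abs_le.1 h).1
  linarith

/-- `∏_{s < p ≤ t} (1 - |I_p|/p)`. -/
noncomputable def sieveDensityBetween (I : (p : ℕ) → Finset (ZMod p)) (s t : ℝ) : ℝ :=
  ∏ p ∈ primesBetween s t, (1 - ((I p).card : ℝ) / p)

theorem sieveDensity_eq_mul (I : (p : ℕ) → Finset (ZMod p)) {s t : ℝ} (hst : s ≤ t) :
    sieveDensity I t = sieveDensity I s * sieveDensityBetween I s t :=
  prod_primesUpTo_split hst _

/-- Bound for the logarithm of `containDensity` divided by its expected value. -/
noncomputable def densityError (I : (p : ℕ) → Finset (ZMod p)) (B : ℕ) (s t : ℝ)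
    (V : Finset ℤ) : ℝ :=
  ∑ p ∈ primesBetween s t,
    (2 * ((V.card : ℝ) * B) ^ 2 / (p : ℝ) ^ 2 + B * collisions I V p / p)

/-- Both sides are compared with exponentials through `exp (-(x + 2 * x ^ 2)) ≤ 1 - x ≤ exp (-x)`.
Collisions only shrink the set of forbidden classes, so they are needed for the upper bound alone;
the term with `p ^ 2` accounts for the quadratic errors. -/
theorem containDensity_factor_bounds {I : (p : ℕ) → Finset (ZMod p)} {B : ℕ} {V : Finset ℤ}
    {p : ℕ} (hp : p.Prime) (hB : (I p).card ≤ B) (h₁ : 2 * (B : ℝ) ≤ p)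
    (h₂ : 2 * ((V.card : ℝ) * B) ≤ p) :
    let e : ℝ := 2 * ((V.card : ℝ) * B) ^ 2 / (p : ℝ) ^ 2 + B * collisions I V p / p
    Real.exp (-e) * (1 - ((I p).card : ℝ) / p) ^ V.card ≤
        1 - ((shiftClasses I V p).card : ℝ) / p ∧
      1 - ((shiftClasses I V p).card : ℝ) / p ≤
        Real.exp e * (1 - ((I p).card : ℝ) / p) ^ V.card := by
  intro e
  have hp0 : (0 : ℝ) < p := by exact_mod_cast hp.pos
  set k : ℝ := (V.card : ℝ) with hk
  have hk0 : 0 ≤ k := Nat.cast_nonneg _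
  set a : ℝ := ((I p).card : ℝ) with ha
  have ha0 : 0 ≤ a := Nat.cast_nonneg _
  have haB : a ≤ B := by rw [ha]; exact_mod_cast hB
  have hB0 : (0 : ℝ) ≤ B := Nat.cast_nonneg _
  set u : ℝ := ((shiftClasses I V p).card : ℝ) with hu
  set r : ℝ := (collisions I V p : ℝ) with hr
  have hr0 : 0 ≤ r := Nat.cast_nonneg _
  have hu₁ : u ≤ k * a := by
    rw [hu, hk, ha]; exact_mod_cast card_shiftClasses_le I V p
  have hu₂ : k * a ≤ u + a * r := by
    rw [hu, hk, ha, hr]; exact_mod_cast le_card_shiftClasses I V hp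
  have hka : k * a ≤ k * B := by gcongr
  have hx : a / p ≤ 1 / 2 := by rw [div_le_iff₀ hp0]; linarith
  have hkx : k * a / p ≤ 1 / 2 := by rw [div_le_iff₀ hp0]; linarith
  have hx0 : 0 ≤ a / p := by positivity
  have hpos : 0 ≤ 1 - a / p := by linarith
  have hup : (1 - a / p) ^ V.card ≤ Real.exp (-(k * a / p)) := by
    calc (1 - a / p) ^ V.card ≤ (Real.exp (-(a / p))) ^ V.card := by
          gcongr; exact Real.one_sub_le_exp_neg _
      _ = _ := by rw [← Real.exp_nat_mul]; congr 1; rw [← hk]; ring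
  have hlow : Real.exp (-(k * (a / p + 2 * (a / p) ^ 2))) ≤ (1 - a / p) ^ V.card := by
    calc _ = (Real.exp (-(a / p + 2 * (a / p) ^ 2))) ^ V.card := by
          rw [← Real.exp_nat_mul]; congr 1; rw [← hk]; ring
      _ ≤ _ := by gcongr; exact exp_neg_le_one_sub hx0 hx
  have hsq : 2 * (k * a / p) ^ 2 ≤ 2 * (k * B) ^ 2 / (p : ℝ) ^ 2 := by
    rw [div_pow, mul_div_assoc]; gcongr
  have hr' : 0 ≤ B * r / p := by positivity
  -- This absorbs the `k` separate quadratic errors of the factors `1 - a / p` into the single term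
  -- `2 * (k * a / p) ^ 2`.
  have hksq : k ≤ k ^ 2 := by
    rw [hk]; exact_mod_cast Nat.le_self_pow two_ne_zero _
  constructor
  · calc Real.exp (-e) * (1 - a / p) ^ V.card
        ≤ Real.exp (-(2 * (k * a / p) ^ 2)) * Real.exp (-(k * a / p)) := by
          gcongr
          simp only [e]
          linarith
      _ = Real.exp (-(k * a / p + 2 * (k * a / p) ^ 2)) := by rw [← Real.exp_add]; congr 1; ring
      _ ≤ 1 - k * a / p := exp_neg_le_one_sub (by positivity) hkx
      _ ≤ _ := by gcongr
  · calc 1 - u / p ≤ Real.exp (-(u / p)) := Real.one_sub_le_exp_neg _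
      _ ≤ Real.exp (e + -(k * (a / p + 2 * (a / p) ^ 2))) := by
          gcongr
          have h₃ : k * a / p ≤ u / p + B * r / p := by
            rw [← add_div]; gcongr
            exact hu₂.trans (by gcongr)
          have h₄ : 2 * k * (a / p) ^ 2 ≤ 2 * (k * a / p) ^ 2 := by
            rw [mul_div_assoc, mul_pow]
            nlinarith [sq_nonneg (a / p)]
          simp only [e]
          have : k * (a / p + 2 * (a / p) ^ 2) = k * a / p + 2 * k * (a / p) ^ 2 := by ring
          linarith
      _ = Real.exp e * Real.exp (-(k * (a / p + 2 * (a / p) ^ 2))) := Real.exp_add _ _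
      _ ≤ _ := by gcongr

theorem abs_containDensity_sub_le {I : (p : ℕ) → Finset (ZMod p)} {B : ℕ} {s t : ℝ}
    {V : Finset ℤ} (hB : ∀ p : ℕ, p.Prime → (I p).card ≤ B) (h₁ : 2 * (B : ℝ) ≤ s)
    (h₂ : 2 * ((V.card : ℝ) * B) ≤ s) :
    |containDensity I s t V - sieveDensityBetween I s t ^ V.card| ≤
      (Real.exp (densityError I B s t V) - 1) * sieveDensityBetween I s t ^ V.card := by
  have hmem : ∀ p ∈ primesBetween s t, p.Prime ∧ s < p := fun p hp =>
    ⟨(mem_primesBetween.1 hp).1, (mem_primesBetween.1 hp).2.1⟩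
  have hfac : ∀ p ∈ primesBetween s t, 0 ≤ 1 - ((I p).card : ℝ) / p := by
    intro p hp
    obtain ⟨hpp, hsp⟩ := hmem p hp
    have hp0 : (0 : ℝ) < p := by exact_mod_cast hpp.pos
    have : ((I p).card : ℝ) ≤ B := by exact_mod_cast hB p hpp
    have hB0 : (0 : ℝ) ≤ B := Nat.cast_nonneg _
    rw [sub_nonneg, div_le_one hp0]
    linarith
  have hσ : 0 ≤ sieveDensityBetween I s t := Finset.prod_nonneg hfac
  have hlow : Real.exp (-densityError I B s t V) * sieveDensityBetween I s t ^ V.card ≤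
      containDensity I s t V := by
    rw [densityError, sieveDensityBetween, containDensity, ← Finset.sum_neg_distrib, Real.exp_sum,
      ← Finset.prod_pow, ← Finset.prod_mul_distrib]
    refine Finset.prod_le_prod (fun p hp => mul_nonneg (Real.exp_nonneg _)
      (pow_nonneg (hfac p hp) _)) fun p hp => ?_
    obtain ⟨hpp, hsp⟩ := hmem p hp
    exact (containDensity_factor_bounds hpp (hB p hpp) (by linarith) (by linarith)).1
  have hup : containDensity I s t V ≤
      Real.exp (densityError I B s t V) * sieveDensityBetween I s t ^ V.card := by
    rw [densityError, sieveDensityBetween, containDensity, Real.exp_sum,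
      ← Finset.prod_pow, ← Finset.prod_mul_distrib]
    refine Finset.prod_le_prod (fun p hp => ?_) fun p hp => ?_
    · obtain ⟨hpp, hsp⟩ := hmem p hp
      exact (mul_nonneg (Real.exp_nonneg _) (pow_nonneg (hfac p hp) _)).trans
        (containDensity_factor_bounds hpp (hB p hpp) (by linarith) (by linarith)).1
    · obtain ⟨hpp, hsp⟩ := hmem p hp
      exact (containDensity_factor_bounds hpp (hB p hpp) (by linarith) (by linarith)).2
  -- By `exp x + exp (-x) ≥ 2`, the lower bound holds with the same relative error `exp x - 1` as
  -- the upper one.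
  have hexp : 2 - Real.exp (densityError I B s t V) ≤ Real.exp (-densityError I B s t V) := by
    have h₃ := Real.add_one_le_exp (densityError I B s t V)
    have h₄ := Real.add_one_le_exp (-densityError I B s t V)
    linarith
  have hpow : 0 ≤ sieveDensityBetween I s t ^ V.card := pow_nonneg hσ _
  rw [abs_le]
  constructor <;> nlinarith

/-- The largest number of primes in `diffPrimes`, over the differences of distinct elements. -/
noncomputable def maxDiffCount (I : (p : ℕ) → Finset (ZMod p)) (V : Finset ℤ) : ℕ :=
  V.offDiag.sup (fun v => (diffPrimes I (v.1 - v.2)).ncard)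

theorem sum_primesBetween_inv_sq_le {s : ℝ} (hs : 0 < s) (t : ℝ) :
    ∑ p ∈ primesBetween s t, 1 / (p : ℝ) ^ 2 ≤ 2 / s := by
  have hsub : primesBetween s t ⊆ Finset.Ioo ⌊s⌋₊ (⌊t⌋₊ + 1) := by
    intro p hp
    obtain ⟨hpp, h₁, h₂⟩ := mem_primesBetween.1 hp
    rw [Finset.mem_Ioo]
    exact ⟨(Nat.floor_lt hs.le).2 h₁, Nat.lt_succ_of_le ((Nat.le_floor_iff' hpp.ne_zero).2 h₂)⟩
  calc ∑ p ∈ primesBetween s t, 1 / (p : ℝ) ^ 2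
      ≤ ∑ p ∈ Finset.Ioo ⌊s⌋₊ (⌊t⌋₊ + 1), 1 / (p : ℝ) ^ 2 :=
        Finset.sum_le_sum_of_subset_of_nonneg hsub fun _ _ _ => by positivity
    _ = ∑ p ∈ Finset.Ioo ⌊s⌋₊ (⌊t⌋₊ + 1), ((p : ℝ) ^ 2)⁻¹ := by simp only [one_div]
    _ ≤ 2 / ((⌊s⌋₊ : ℝ) + 1) := sum_Ioo_inv_sq_le _ _
    _ ≤ 2 / s := by
        have := Nat.lt_floor_add_one s
        gcongr

theorem collisions_mono {I : (p : ℕ) → Finset (ZMod p)} {V W : Finset ℤ} (h : V ⊆ W) (p : ℕ) :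
    collisions I V p ≤ collisions I W p := by
  classical
  exact Finset.card_le_card (Finset.filter_subset_filter _ (Finset.offDiag_mono h))

/-- The weights involve a random subset of a fixed progression; this bounds its error by that of the
whole progression, which does not depend on `b`. -/
theorem densityError_mono {I : (p : ℕ) → Finset (ZMod p)} {B : ℕ} {s t : ℝ} {V W : Finset ℤ}
    (h : V ⊆ W) : densityError I B s t V ≤ densityError I B s t W := by
  refine Finset.sum_le_sum fun p _ => ?_
  have h₁ : (V.card : ℝ) ≤ W.card := by exact_mod_cast Finset.card_le_card h
  have h₂ : (collisions I V p : ℝ) ≤ collisions I W p := by exact_mod_cast collisions_mono h p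
  gcongr

theorem sum_collisions_eq (I : (p : ℕ) → Finset (ZMod p)) (V : Finset ℤ) (S : Finset ℕ)
    (f : ℕ → ℝ) :
    ∑ p ∈ S, f p * collisions I V p =
      ∑ v ∈ V.offDiag, ∑ p ∈ S, f p * (diffPrimes I (v.1 - v.2)).indicator 1 p := by
  classical
  rw [Finset.sum_comm]
  refine Finset.sum_congr rfl fun p _ => ?_
  rw [← Finset.mul_sum, collisions, Finset.card_filter]
  push_cast
  congr 1

/-- Collisions are counted pair by pair: an ordered pair collides at no more than `maxDiffCount I V`
primes, and each of these exceeds `s`, so costs at most `B / s`. The quadratic part is a tail of the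
sum of `1 / p ^ 2`. -/
theorem densityError_le {I : (p : ℕ) → Finset (ZMod p)} {B : ℕ} {s t : ℝ} {V : Finset ℤ}
    (hs : 0 < s) (hfin : ∀ v : ℤ, v ≠ 0 → (diffPrimes I v).Finite) :
    densityError I B s t V ≤
      (V.card : ℝ) ^ 2 / s * (4 * (B : ℝ) ^ 2 + B * maxDiffCount I V) := by
  classical
  have h₁ : ∑ p ∈ primesBetween s t, 2 * ((V.card : ℝ) * B) ^ 2 / (p : ℝ) ^ 2 ≤
      2 * ((V.card : ℝ) * B) ^ 2 * (2 / s) := by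
    simp_rw [div_eq_mul_one_div (2 * ((V.card : ℝ) * B) ^ 2)]
    rw [← Finset.mul_sum]
    gcongr
    exact sum_primesBetween_inv_sq_le hs t
  have h₂ : ∑ p ∈ primesBetween s t, (B : ℝ) * collisions I V p / p ≤
      B / s * ((V.card : ℝ) ^ 2 * maxDiffCount I V) := by
    calc ∑ p ∈ primesBetween s t, (B : ℝ) * collisions I V p / p
        ≤ ∑ p ∈ primesBetween s t, (B : ℝ) / s * collisions I V p := by
          refine Finset.sum_le_sum fun p hp => ?_
          have := (mem_primesBetween.1 hp).2.1
          rw [div_mul_eq_mul_div]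
          gcongr
      _ = ∑ v ∈ V.offDiag, ∑ p ∈ primesBetween s t,
            (B : ℝ) / s * (diffPrimes I (v.1 - v.2)).indicator 1 p := sum_collisions_eq _ _ _ _
      _ ≤ ∑ v ∈ V.offDiag, (B : ℝ) / s * maxDiffCount I V := by
          refine Finset.sum_le_sum fun v hv => ?_
          rw [← Finset.mul_sum]
          gcongr
          have hne : v.1 - v.2 ≠ 0 := sub_ne_zero.2 (Finset.mem_offDiag.1 hv).2.2
          have e : ∑ p ∈ primesBetween s t, (diffPrimes I (v.1 - v.2)).indicator (1 : ℕ → ℝ) p =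
              ((primesBetween s t).filter (fun p => p ∈ diffPrimes I (v.1 - v.2))).card := by
            rw [Finset.card_filter]; push_cast
            exact Finset.sum_congr rfl fun p _ => by simp [Set.indicator_apply]
          rw [e]
          have h₃ : ((primesBetween s t).filter (fun p => p ∈ diffPrimes I (v.1 - v.2))).card ≤
              (diffPrimes I (v.1 - v.2)).ncard := by
            rw [← Set.ncard_coe_finset]
            exact Set.ncard_le_ncard (fun p hp => (Finset.mem_filter.1 hp).2) (hfin _ hne)
          have h₄ : (diffPrimes I (v.1 - v.2)).ncard ≤ maxDiffCount I V :=
            Finset.le_sup (f := fun v : ℤ × ℤ => (diffPrimes I (v.1 - v.2)).ncard) hv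
          exact_mod_cast h₃.trans h₄
      _ = (V.offDiag.card : ℝ) * ((B : ℝ) / s * maxDiffCount I V) := by simp
      _ ≤ (V.card : ℝ) ^ 2 * ((B : ℝ) / s * maxDiffCount I V) := by
          gcongr
          rw [Finset.offDiag_card, sq]
          exact_mod_cast Nat.sub_le _ _
      _ = _ := by ring
  calc densityError I B s t V = _ := Finset.sum_add_distrib
    _ ≤ _ := add_le_add h₁ h₂
    _ = _ := by ring

/-! ### The normalised weight of a set and its conditional expectation. -/

/-- The elements of `A` that lie in the shift by `b` of the set sifted by the primes `≤ s`. -/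
noncomputable def siftedPart (I : (p : ℕ) → Finset (ZMod p)) (s : ℝ) (A : Finset ℤ) (b : ℤ) :
    Finset ℤ :=
  open Classical in A.filter (fun n => n ∈ shiftedSet I 0 s b)

theorem siftedPart_congr {I : (p : ℕ) → Finset (ZMod p)} {s : ℝ} {A : Finset ℤ} {b b' : ℤ}
    (h : (primeProd s : ℤ) ∣ b - b') : siftedPart I s A b = siftedPart I s A b' := by
  rw [← primeProdBetween_zero] at h
  simp only [siftedPart]
  rw [shiftedSet_congr h]

theorem indicator_one_congr {s t : Set ℤ} {b b' : ℤ} (h : b ∈ s ↔ b' ∈ t) :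
    s.indicator (1 : ℤ → ℝ) b = t.indicator 1 b' := by
  by_cases hb : b ∈ s
  · rw [Set.indicator_of_mem hb, Set.indicator_of_mem (h.1 hb)]; rfl
  · rw [Set.indicator_of_notMem hb, Set.indicator_of_notMem (fun h' => hb (h.2 h'))]

theorem siftedPart_subset (I : (p : ℕ) → Finset (ZMod p)) (s : ℝ) (A : Finset ℤ) (b : ℤ) :
    siftedPart I s A b ⊆ A := by
  classical
  exact Finset.filter_subset _ _

/-- The indicator of `A ∩ S₁ ⊆ S₂`, divided by its conditional density. -/
noncomputable def containWeight (I : (p : ℕ) → Finset (ZMod p)) (s t : ℝ) (A : Finset ℤ)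
    (b c : ℤ) : ℝ :=
  {c : ℤ | (siftedPart I s A b : Set ℤ) ⊆ shiftedSet I s t c}.indicator 1 c /
    sieveDensityBetween I s t ^ (siftedPart I s A b).card

/-- Once `b` is fixed modulo the primes up to `s`, the sifted part `W` of `A` is fixed, while `b`
modulo the larger primes is still uniform. The conditional mean of the weight is therefore the
containment density of `W` divided by its expected value. The factor `R` carries anything else that
depends on the small primes only. -/
theorem abs_residueExpectation_containWeight_sub_le {I : (p : ℕ) → Finset (ZMod p)} {B : ℕ}
    {s t : ℝ} {A : Finset ℤ} (hB : ∀ p : ℕ, p.Prime → (I p).card ≤ B)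
    (hσ : 0 < sieveDensityBetween I s t) (hst : s ≤ t)
    (h₁ : 2 * (B : ℝ) ≤ s) (h₂ : 2 * ((A.card : ℝ) * B) ≤ s) {R : ℤ → ℝ} (hR : ∀ b, 0 ≤ R b)
    (hRp : ∀ b b' : ℤ, (primeProd s : ℤ) ∣ b - b' → R b = R b') :
    |residueExpectation (primeProd t) (fun b => R b * containWeight I s t A b b) -
        residueExpectation (primeProd s) R| ≤
      (Real.exp (densityError I B s t A) - 1) * residueExpectation (primeProd s) R := by
  -- The two arguments of `containWeight` are used here: `b` determines the sifted part and `c`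
  -- decides the containment.
  have e := residueExpectation_mul (coprime_primeProd s t) (primeProd_pos s)
    (primeProdBetween_pos s t) (fun b c => R b * containWeight I s t A b c) (fun b b' c h => by
      simp only [containWeight]
      rw [hRp b b' h, siftedPart_congr h]) (fun b c c' h => by
      simp only [containWeight]
      rw [indicator_one_congr (b' := c')
        (t := {c : ℤ | (siftedPart I s A b : Set ℤ) ⊆ shiftedSet I s t c})]
      simp only [Set.mem_ofPred_eq]
      rw [shiftedSet_congr h])
  rw [primeProd_eq_mul hst, e, ← residueExpectation_const_mul]
  refine residueExpectation_abs_sub_le _ fun b => ?_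
  rw [residueExpectation_const_mul]
  set W := siftedPart I s A b with hW
  have hWA : W ⊆ A := siftedPart_subset _ _ _ _
  have hWc : (W.card : ℝ) ≤ A.card := by exact_mod_cast Finset.card_le_card hWA
  have h₃ : residueExpectation (primeProdBetween s t) (fun c => containWeight I s t A b c) =
      containDensity I s t W / sieveDensityBetween I s t ^ W.card := by
    simp only [containWeight, div_eq_mul_inv]
    rw [residueExpectation_mul_const, residueExpectation_subset_shiftedSet]
  have h₄ : 2 * ((W.card : ℝ) * B) ≤ s := le_trans (by gcongr) h₂
  have h₅ := abs_containDensity_sub_le (t := t) hB h₁ h₄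
  have hpow : 0 < sieveDensityBetween I s t ^ W.card := pow_pos hσ _
  rw [h₃]
  calc |R b * (containDensity I s t W / sieveDensityBetween I s t ^ W.card) - R b|
      = R b * (|containDensity I s t W - sieveDensityBetween I s t ^ W.card| /
          sieveDensityBetween I s t ^ W.card) := by
        rw [← abs_of_nonneg (hR b), ← abs_of_pos hpow, ← abs_div, abs_of_nonneg (hR b),
          abs_of_pos hpow, ← abs_of_nonneg (hR b), ← abs_mul, abs_of_nonneg (hR b)]
        congr 1
        field_simp
    _ ≤ R b * (Real.exp (densityError I B s t W) - 1) := by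
        gcongr
        · exact hR b
        · rw [div_le_iff₀ hpow]; exact h₅
    _ ≤ R b * (Real.exp (densityError I B s t A) - 1) := by
        gcongr
        · exact hR b
        · exact densityError_mono hWA
    _ = _ := mul_comm _ _

/-! ### Sums of periodic functions over `[1, y]`. -/

theorem sum_range_mul_of_periodic {h : ℤ → ℝ} {D : ℕ} (hper : ∀ n, h (n + D) = h n) (m : ℕ) :
    ∑ n ∈ Finset.range (m * D), h n = m * ∑ n ∈ Finset.range D, h n := by
  have hper' : ∀ (m : ℕ) (n : ℤ), h (m * D + n) = h n := by
    intro m n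
    induction m with
    | zero => simp
    | succ m ih =>
      rw [← ih, ← hper (m * D + n)]
      congr 1
      push_cast
      ring
  induction m with
  | zero => simp
  | succ m ih =>
    rw [add_mul, one_mul, Finset.sum_range_add, ih]
    push_cast
    simp_rw [hper']
    ring

theorem sum_Icc_le_of_periodic {h : ℤ → ℝ} {D : ℕ} (hD : 0 < D) (h0 : ∀ n, 0 ≤ h n)
    (hper : ∀ n, h (n + D) = h n) (y : ℕ) :
    ∑ n ∈ Finset.Icc (1 : ℤ) y, h n ≤ ((y : ℝ) / D + 1) * ∑ n ∈ Finset.range D, h n := by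
  -- One more period than `y / D` ensures that the range, which starts at 0, reaches `y`.
  have h₁ : ∑ n ∈ Finset.Icc (1 : ℤ) y, h n ≤ ∑ n ∈ Finset.range ((y / D + 1) * D), h n := by
    have hinj : Set.InjOn (fun n : ℕ => (n : ℤ)) (Finset.range ((y / D + 1) * D)) :=
      fun a _ b _ hab => by simpa using hab
    rw [← Finset.sum_image (f := h) hinj]
    refine Finset.sum_le_sum_of_subset_of_nonneg ?_ fun _ _ _ => h0 _
    intro n hn
    rw [Finset.mem_Icc] at hn
    have hlt : y < (y / D + 1) * D := by
      rw [add_mul, one_mul]; exact Nat.lt_div_mul_add hD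
    rw [Finset.mem_image]
    refine ⟨n.toNat, ?_, by simp; omega⟩
    rw [Finset.mem_range]
    omega
  refine h₁.trans ?_
  rw [sum_range_mul_of_periodic hper]
  gcongr
  · exact Finset.sum_nonneg fun _ _ => h0 _
  · push_cast
    gcongr
    exact Nat.cast_div_le

/-- Here the integer `n` is averaged and the shift `b` is fixed; translating `I_p` by `b` does not
change its size, so the density is the same. -/
theorem residueExpectation_mem_shiftedSet_left (I : (p : ℕ) → Finset (ZMod p)) (s : ℝ) (b : ℤ) :
    residueExpectation (primeProd s) ((shiftedSet I 0 s b).indicator 1) = sieveDensity I s := by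
  classical
  have e : shiftedSet I 0 s b =
      avoidSet (primesUpTo s) (fun p => (I p).image (fun a => a + (b : ZMod p))) := by
    ext n
    simp only [shiftedSet, siftedSet, avoidSet, Set.mem_ofPred_eq, ← primesBetween_zero,
      mem_primesBetween, and_imp, Finset.mem_image, not_exists, not_and, Int.cast_sub,
      Nat.cast_pos]
    refine forall_congr' fun p => forall_congr' fun hp => forall_congr' fun _ =>
      forall_congr' fun _ => ⟨fun h a ha hab => h ?_, fun h h' => h _ h' (by ring)⟩
    rw [← hab]; simpa using ha
  rw [e, primeProd, residueExpectation_avoidSet fun p hp => (mem_primesUpTo.1 hp).1, sieveDensity]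
  refine Finset.prod_congr rfl fun p _ => ?_
  rw [Finset.card_image_of_injective _ (add_left_injective _)]

theorem residueExpectation_dvd_sub {d : ℕ} (hd : 0 < d) (r : ℤ) :
    residueExpectation d ({n : ℤ | (d : ℤ) ∣ n - r}.indicator 1) = 1 / d := by
  have h := residueExpectation_notMem hd {(r : ZMod d)}
  have e : ({n : ℤ | (d : ℤ) ∣ n - r}.indicator 1 : ℤ → ℝ) =
      fun n => 1 - {b : ℤ | (b : ZMod d) ∉ ({(r : ZMod d)} : Finset (ZMod d))}.indicator 1 n := by
    funext n
    have := ZMod.intCast_eq_intCast_iff_dvd_sub r n d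
    by_cases hn : (d : ℤ) ∣ n - r
    · have h' := (this.2 hn).symm
      simp [hn, h']
    · have h' : ¬ (n : ZMod d) = r := fun h' => hn (this.1 h'.symm)
      simp [hn, h']
  rw [e]
  unfold residueExpectation at h ⊢
  rw [Finset.sum_sub_distrib, sub_div, h]
  have : (d : ℝ) ≠ 0 := by positivity
  simp; field_simp; ring

theorem shiftedSet_add_mem_iff (I : (p : ℕ) → Finset (ZMod p)) {s : ℝ} {b n m : ℤ}
    (h : (primeProd s : ℤ) ∣ m - n) : n ∈ shiftedSet I 0 s b ↔ m ∈ shiftedSet I 0 s b := by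
  have e : m ∈ shiftedSet I 0 s b ↔ n ∈ shiftedSet I 0 s (b - (m - n)) := by
    simp only [shiftedSet, Set.mem_ofPred_eq]
    rw [show n - (b - (m - n)) = m - b by ring]
  rw [e]
  refine mem_shiftedSet_congr ?_
  rw [primeProdBetween_zero]
  simpa using h

/-- The summand has period `d * primeProd s`, and by independence its sum over a period is
`primeProd s * sieveDensity I s`. It is nonnegative, so the last incomplete period may be completed.
-/
theorem sum_indicator_class_le (I : (p : ℕ) → Finset (ZMod p)) {s : ℝ} {d : ℕ} (hd : 0 < d)
    (hcop : d.Coprime (primeProd s)) (r b : ℤ) (y : ℕ) :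
    ∑ n ∈ Finset.Icc (1 : ℤ) y, ({n : ℤ | (d : ℤ) ∣ n - r}.indicator (1 : ℤ → ℝ) n *
        (shiftedSet I 0 s b).indicator 1 n) ≤
      ((y : ℝ) / (d * primeProd s) + 1) * (primeProd s * sieveDensity I s) := by
  have hP := primeProd_pos s
  have hper₁ : ∀ n m : ℤ, (d : ℤ) ∣ n - m → {n : ℤ | (d : ℤ) ∣ n - r}.indicator (1 : ℤ → ℝ) n =
      {n : ℤ | (d : ℤ) ∣ n - r}.indicator 1 m := fun n m h => by
    refine indicator_one_congr ?_
    simp only [Set.mem_ofPred_eq]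
    rw [show m - r = (n - r) - (n - m) by ring, dvd_sub_left h]
  have hper₂ : ∀ n m : ℤ, (primeProd s : ℤ) ∣ n - m →
      (shiftedSet I 0 s b).indicator (1 : ℤ → ℝ) n = (shiftedSet I 0 s b).indicator 1 m :=
    fun n m h => indicator_one_congr (shiftedSet_add_mem_iff I h).symm
  have h := sum_Icc_le_of_periodic (D := d * primeProd s) (Nat.mul_pos hd hP)
    (h := fun n => {n : ℤ | (d : ℤ) ∣ n - r}.indicator (1 : ℤ → ℝ) n *
        (shiftedSet I 0 s b).indicator 1 n)
    (fun n => mul_nonneg (Set.indicator_nonneg (fun _ _ => zero_le_one) _)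
      (Set.indicator_nonneg (fun _ _ => zero_le_one) _)) (fun n => by
      rw [hper₁ _ n, hper₂ _ n] <;> simp) y
  refine h.trans (le_of_eq ?_)
  push_cast
  congr 1
  have e := residueExpectation_mul hcop hd hP
    (fun n m => {n : ℤ | (d : ℤ) ∣ n - r}.indicator (1 : ℤ → ℝ) n *
        (shiftedSet I 0 s b).indicator 1 m) (fun n n' m h => by rw [hper₁ _ _ h])
        (fun n m m' h => by rw [hper₂ _ _ h])
  simp_rw [residueExpectation_const_mul, residueExpectation_mul_const] at e
  have e₁ := residueExpectation_dvd_sub hd r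
  have e₂ := residueExpectation_mem_shiftedSet_left I s b
  rw [e₁, e₂, residueExpectation] at e
  have hd' : (d : ℝ) ≠ 0 := by positivity
  have hP' : (primeProd s : ℝ) ≠ 0 := by positivity
  push_cast at e
  field_simp at e
  exact e

/-- The condition that `n - m` lies in `I_p - I_p` puts `n` in at most `B ^ 2` classes modulo `p`;
each is handled by `sum_indicator_class_le`. -/
theorem sum_indicator_diffPrimes_le {I : (p : ℕ) → Finset (ZMod p)} {B : ℕ}
    (hB : ∀ p : ℕ, p.Prime → (I p).card ≤ B) {s : ℝ} {p : ℕ} (hp : p.Prime)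
    (hcop : p.Coprime (primeProd s)) (hσ : 0 ≤ sieveDensity I s) (m b : ℤ) (y : ℕ) :
    ∑ n ∈ Finset.Icc (1 : ℤ) y, ((diffPrimes I (n - m)).indicator (1 : ℕ → ℝ) p *
        (shiftedSet I 0 s b).indicator 1 n) ≤
      (B : ℝ) ^ 2 * (((y : ℝ) / (p * primeProd s) + 1) * (primeProd s * sieveDensity I s)) := by
  classical
  have : NeZero p := ⟨hp.ne_zero⟩
  calc ∑ n ∈ Finset.Icc (1 : ℤ) y, ((diffPrimes I (n - m)).indicator (1 : ℕ → ℝ) p *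
        (shiftedSet I 0 s b).indicator 1 n)
      ≤ ∑ n ∈ Finset.Icc (1 : ℤ) y, ∑ c ∈ I p ×ˢ I p,
          ({n : ℤ | (p : ℤ) ∣ n - (m + (c.1 - c.2).val)}.indicator (1 : ℤ → ℝ) n *
        (shiftedSet I 0 s b).indicator 1 n) := by
        refine Finset.sum_le_sum fun n _ => ?_
        rw [← Finset.sum_mul]
        refine mul_le_mul_of_nonneg_right ?_ (Set.indicator_nonneg (fun _ _ => zero_le_one) _)
        by_cases h : p ∈ diffPrimes I (n - m)
        · obtain ⟨_, a, ha, a', ha', h'⟩ := h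
          rw [Set.indicator_of_mem (by exact ⟨hp, a, ha, a', ha', h'⟩)]
          have hmem : n ∈ {n : ℤ | (p : ℤ) ∣ n - (m + ((a - a').val : ℤ))} := by
            rw [Set.mem_ofPred_eq, ← ZMod.intCast_eq_intCast_iff_dvd_sub]
            push_cast
            rw [ZMod.natCast_zmod_val, ← h']
            push_cast; ring
          have := Finset.single_le_sum (f := fun c : ZMod p × ZMod p =>
            {n : ℤ | (p : ℤ) ∣ n - (m + (c.1 - c.2).val)}.indicator (1 : ℤ → ℝ) n)
            (fun _ _ => Set.indicator_nonneg (fun _ _ => zero_le_one) _)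
            (Finset.mk_mem_product ha ha')
          refine le_trans ?_ this
          simp only
          rw [Set.indicator_of_mem hmem]; simp
        · rw [Set.indicator_of_notMem h]
          exact Finset.sum_nonneg fun _ _ => Set.indicator_nonneg (fun _ _ => zero_le_one) _
    _ = ∑ c ∈ I p ×ˢ I p, ∑ n ∈ Finset.Icc (1 : ℤ) y,
          ({n : ℤ | (p : ℤ) ∣ n - (m + (c.1 - c.2).val)}.indicator (1 : ℤ → ℝ) n *
        (shiftedSet I 0 s b).indicator 1 n) := Finset.sum_comm
    _ ≤ ∑ c ∈ I p ×ˢ I p,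
          ((y : ℝ) / (p * primeProd s) + 1) * (primeProd s * sieveDensity I s) :=
        Finset.sum_le_sum fun c _ => sum_indicator_class_le I hp.pos hcop _ b y
    _ = ((I p).card : ℝ) ^ 2 *
          (((y : ℝ) / (p * primeProd s) + 1) * (primeProd s * sieveDensity I s)) := by
        simp [sq]
    _ ≤ _ := by
        have : ((I p).card : ℝ) ≤ B := by exact_mod_cast hB p hp
        gcongr

/-! ### Pair correlations of the sifted set and its second moment. -/

section
variable {I : (p : ℕ) → Finset (ZMod p)} {B : ℕ}

theorem one_sub_card_div_pos (hI : ∀ p : ℕ, p.Prime → (I p).card ≤ p - 1) {p : ℕ}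
    (hp : p.Prime) : 0 < 1 - ((I p).card : ℝ) / p := by
  have hp0 : (0 : ℝ) < p := by exact_mod_cast hp.pos
  have : (I p).card < p := by have := hI p hp; have := hp.pos; omega
  rw [sub_pos, div_lt_one hp0]
  exact_mod_cast this

theorem one_sub_card_div_le_one {p : ℕ} : 1 - ((I p).card : ℝ) / p ≤ 1 := by
  have : 0 ≤ ((I p).card : ℝ) / p := by positivity
  linarith

theorem sieveDensity_pos (hI : ∀ p : ℕ, p.Prime → (I p).card ≤ p - 1) (t : ℝ) :
    0 < sieveDensity I t :=
  Finset.prod_pos fun _ hp => one_sub_card_div_pos hI (mem_primesUpTo.1 hp).1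

theorem sieveDensity_le_one (hI : ∀ p : ℕ, p.Prime → (I p).card ≤ p - 1) (t : ℝ) :
    sieveDensity I t ≤ 1 :=
  Finset.prod_le_one (fun _ hp => (one_sub_card_div_pos hI (mem_primesUpTo.1 hp).1).le)
    fun _ _ => one_sub_card_div_le_one

theorem sieveDensityBetween_pos (hI : ∀ p : ℕ, p.Prime → (I p).card ≤ p - 1) (s t : ℝ) :
    0 < sieveDensityBetween I s t :=
  Finset.prod_pos fun _ hp => one_sub_card_div_pos hI (mem_primesBetween.1 hp).1

theorem sieveDensityBetween_le_one (hI : ∀ p : ℕ, p.Prime → (I p).card ≤ p - 1) (s t : ℝ) :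
    sieveDensityBetween I s t ≤ 1 :=
  Finset.prod_le_one (fun _ hp => (one_sub_card_div_pos hI (mem_primesBetween.1 hp).1).le)
    fun _ _ => one_sub_card_div_le_one

theorem neg_mem_diffPrimes {v : ℤ} {p : ℕ} (h : p ∈ diffPrimes I v) : p ∈ diffPrimes I (-v) := by
  obtain ⟨hp, a, ha, b, hb, hab⟩ := h
  exact ⟨hp, b, hb, a, ha, by push_cast; rw [hab]; ring⟩

theorem diffPrimes_neg (v : ℤ) : diffPrimes I (-v) = diffPrimes I v :=
  Set.ext fun _ => ⟨fun h => by simpa using neg_mem_diffPrimes h, neg_mem_diffPrimes⟩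

theorem diffPrimes_sub_comm (v w : ℤ) : diffPrimes I (v - w) = diffPrimes I (w - v) := by
  rw [← diffPrimes_neg, neg_sub]

theorem indicator_one_nonneg {α : Type*} (s : Set α) (a : α) : 0 ≤ s.indicator (1 : α → ℝ) a :=
  Set.indicator_nonneg (fun _ _ => zero_le_one) _

/-- A bound uniform in `v`. Only primes with `I_p` nonempty occur, so each term is at most `2 * B *
|I_p| / p`, and the sum of `|I_p| / p` is at most minus the logarithm of the sieve density of the
range. -/
theorem exp_sum_diffPrimes_le (hI : ∀ p : ℕ, p.Prime → (I p).card ≤ p - 1) (s t : ℝ) (v : ℤ) :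
    Real.exp (∑ p ∈ primesBetween s t, 2 * (B : ℝ) / p * (diffPrimes I v).indicator 1 p) ≤
      (1 / sieveDensityBetween I s t) ^ (2 * B) := by
  have hpos := sieveDensityBetween_pos hI s t
  have h₁ : sieveDensityBetween I s t ≤
      Real.exp (-∑ p ∈ primesBetween s t, ((I p).card : ℝ) / p) := by
    rw [← Finset.sum_neg_distrib, Real.exp_sum]
    exact Finset.prod_le_prod
      (fun p hp => (one_sub_card_div_pos hI (mem_primesBetween.1 hp).1).le)
      fun p _ => Real.one_sub_le_exp_neg _
  have h₂ : Real.exp (∑ p ∈ primesBetween s t, ((I p).card : ℝ) / p) ≤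
      1 / sieveDensityBetween I s t := by
    rw [le_div_iff₀ hpos]
    calc _ ≤ Real.exp (∑ p ∈ primesBetween s t, ((I p).card : ℝ) / p) *
          Real.exp (-∑ p ∈ primesBetween s t, ((I p).card : ℝ) / p) := by gcongr
      _ = 1 := by rw [← Real.exp_add]; simp
  calc _ ≤ Real.exp ((2 * B : ℕ) * ∑ p ∈ primesBetween s t, ((I p).card : ℝ) / p) := by
        gcongr
        rw [Finset.mul_sum]
        refine Finset.sum_le_sum fun p hp => ?_
        by_cases h : p ∈ diffPrimes I v
        · rw [Set.indicator_of_mem h]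
          obtain ⟨_, a, ha, _⟩ := h
          have : (1 : ℝ) ≤ (I p).card := by exact_mod_cast Finset.card_pos.2 ⟨a, ha⟩
          push_cast
          simp only [Pi.one_apply, mul_one]
          rw [← mul_div_assoc]
          refine div_le_div_of_nonneg_right ?_ (Nat.cast_nonneg p)
          nlinarith [(Nat.cast_nonneg B : (0 : ℝ) ≤ B)]
        · rw [Set.indicator_of_notMem h, mul_zero]
          positivity
    _ = Real.exp (∑ p ∈ primesBetween s t, ((I p).card : ℝ) / p) ^ (2 * B) := Real.exp_nat_mul _ _
    _ ≤ _ := by gcongr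

theorem containDensity_nonneg (I : (p : ℕ) → Finset (ZMod p)) (s t : ℝ) (V : Finset ℤ) :
    0 ≤ containDensity I s t V := by
  rw [← residueExpectation_subset_shiftedSet]
  exact residueExpectation_nonneg _ fun _ => indicator_one_nonneg _ _

theorem containDensity_le_one (I : (p : ℕ) → Finset (ZMod p)) (s t : ℝ) (V : Finset ℤ) :
    containDensity I s t V ≤ 1 := by
  rw [← residueExpectation_subset_shiftedSet,
    ← residueExpectation_const (primeProdBetween_pos s t) 1]
  refine residueExpectation_mono _ fun b => ?_
  exact Set.indicator_le_self' (by simp) _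

theorem containDensity_zero_eq_mul {s t : ℝ} (hst : s ≤ t) (V : Finset ℤ) :
    containDensity I 0 t V = containDensity I 0 s V * containDensity I s t V := by
  simp only [containDensity, primesBetween_zero]
  exact prod_primesUpTo_split hst _

theorem card_sievedInterval (z : ℝ) (y : ℕ) (b : ℤ) : ((sievedInterval I z y b).card : ℝ) =
    ∑ n ∈ Finset.Icc (1 : ℤ) y, {b : ℤ | n ∈ shiftedSet I 0 z b}.indicator 1 b := by
  classical
  rw [sievedInterval, Finset.card_filter]
  push_cast
  exact Finset.sum_congr rfl fun n _ => by simp [Set.indicator_apply]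

theorem residueExpectation_card_sievedInterval (z : ℝ) (y : ℕ) :
    residueExpectation (primeProd z) (fun b => ((sievedInterval I z y b).card : ℝ)) =
      sieveDensity I z * y := by
  simp_rw [card_sievedInterval]
  rw [residueExpectation_sum]
  have : ∀ n : ℤ, residueExpectation (primeProd z)
      ({b : ℤ | n ∈ shiftedSet I 0 z b}.indicator 1) = sieveDensity I z :=
    fun n => residueExpectation_mem_shiftedSet I z n
  simp_rw [this]
  simp [mul_comm]

theorem containDensity_pair (t : ℝ) (n m : ℤ) : containDensity I 0 t {n, m} =
    residueExpectation (primeProd t) (fun b =>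
      {b : ℤ | n ∈ shiftedSet I 0 t b}.indicator 1 b *
        {b : ℤ | m ∈ shiftedSet I 0 t b}.indicator 1 b) := by
  rw [← residueExpectation_subset_shiftedSet, primeProdBetween_zero]
  congr 1
  funext b
  rw [← Pi.mul_apply, ← Set.inter_indicator_one]
  congr 1
  ext b
  simp [Set.insert_subset_iff]

theorem residueExpectation_card_sievedInterval_sq (z : ℝ) (y : ℕ) :
    residueExpectation (primeProd z) (fun b => ((sievedInterval I z y b).card : ℝ) ^ 2) =
      ∑ m ∈ Finset.Icc (1 : ℤ) y, ∑ n ∈ Finset.Icc (1 : ℤ) y, containDensity I 0 z {n, m} := by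
  simp_rw [card_sievedInterval, sq, Finset.sum_mul_sum, containDensity_pair,
    residueExpectation_sum]
  rw [Finset.sum_comm]

/-- The pair density is opened up as an expectation over `b`. For fixed `b` and `m` the sum over `n`
is bounded by the hypothesis, and what is left is the expected number of `m` in the sifted interval.
-/
theorem sum_containDensity_pair_mul_le (w : ℤ → ℤ → ℝ) (s X : ℝ) (y : ℕ)
    (h : ∀ m b : ℤ, ∑ n ∈ Finset.Icc (1 : ℤ) y, w n m * (shiftedSet I 0 s b).indicator 1 n ≤ X) :
    ∑ m ∈ Finset.Icc (1 : ℤ) y, ∑ n ∈ Finset.Icc (1 : ℤ) y, containDensity I 0 s {n, m} * w n m ≤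
      sieveDensity I s * y * X := by
  have e : ∑ m ∈ Finset.Icc (1 : ℤ) y, ∑ n ∈ Finset.Icc (1 : ℤ) y,
        containDensity I 0 s {n, m} * w n m =
      residueExpectation (primeProd s) (fun b => ∑ m ∈ Finset.Icc (1 : ℤ) y,
        {b : ℤ | m ∈ shiftedSet I 0 s b}.indicator 1 b *
          ∑ n ∈ Finset.Icc (1 : ℤ) y, w n m * (shiftedSet I 0 s b).indicator 1 n) := by
    simp_rw [Finset.mul_sum, residueExpectation_sum, containDensity_pair,
      ← residueExpectation_mul_const]
    refine Finset.sum_congr rfl fun m _ => Finset.sum_congr rfl fun n _ => ?_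
    congr 1
    funext b
    have : (shiftedSet I 0 s b).indicator (1 : ℤ → ℝ) n =
      {b : ℤ | n ∈ shiftedSet I 0 s b}.indicator 1 b := indicator_one_congr Iff.rfl
    rw [this]; ring
  rw [e, ← residueExpectation_card_sievedInterval, ← residueExpectation_mul_const]
  refine residueExpectation_mono _ fun b => ?_
  rw [card_sievedInterval, Finset.sum_mul]
  refine Finset.sum_le_sum fun m _ => ?_
  exact mul_le_mul_of_nonneg_left (h m b) (indicator_one_nonneg _ _)

theorem collisions_pair_le (n m : ℤ) (p : ℕ) :
    (collisions I {n, m} p : ℝ) ≤ 2 * (diffPrimes I (n - m)).indicator 1 p := by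
  classical
  by_cases h : p ∈ diffPrimes I (n - m)
  · rw [Set.indicator_of_mem h]
    have h₁ : collisions I {n, m} p ≤ ({n, m} : Finset ℤ).offDiag.card := Finset.card_filter_le _ _
    have h₂ : ({n, m} : Finset ℤ).card ≤ 2 := Finset.card_le_two
    rw [Finset.offDiag_card] at h₁
    have : collisions I {n, m} p ≤ 2 := by
      interval_cases hc : ({n, m} : Finset ℤ).card <;> omega
    simp only [Pi.one_apply, mul_one]
    exact_mod_cast this
  · have : collisions I {n, m} p = 0 := by
      rw [collisions, Finset.card_eq_zero, Finset.filter_eq_empty_iff]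
      rintro ⟨a, b⟩ hab h'
      simp only [Finset.mem_offDiag, Finset.mem_insert, Finset.mem_singleton] at hab
      obtain ⟨rfl | rfl, rfl | rfl, hne⟩ := hab
      · exact hne rfl
      · exact h h'
      · rw [diffPrimes_sub_comm] at h'; exact h h'
      · exact hne rfl
    rw [this, Set.indicator_of_notMem h]; simp

theorem sum_primesBetween_split {r s t : ℝ} (hrs : r ≤ s) (hst : s ≤ t) (f : ℕ → ℝ) :
    ∑ p ∈ primesBetween r t, f p =
      ∑ p ∈ primesBetween r s, f p + ∑ p ∈ primesBetween s t, f p := by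
  classical
  rw [← Finset.sum_union]
  · congr 1
    ext p
    simp only [Finset.mem_union, mem_primesBetween]
    constructor
    · rintro ⟨h, h₁, h₂⟩
      rcases le_or_gt (p : ℝ) s with h₃ | h₃
      · exact Or.inl ⟨h, h₁, h₃⟩
      · exact Or.inr ⟨h, h₃, h₂⟩
    · rintro (⟨h, h₁, h₂⟩ | ⟨h, h₁, h₂⟩)
      · exact ⟨h, h₁, h₂.trans hst⟩
      · exact ⟨h, hrs.trans_lt h₁, h₂⟩
  · rw [Finset.disjoint_left]
    intro p h h'
    rw [mem_primesBetween] at h h'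
    linarith [h.2.2, h'.2.1]

/-- Applying `exp v ≤ 1 + v * exp v` to the two exponents separately makes the bound linear in `f`
and `g`, so that both can be averaged. Only the `g` term pays the large factor `G`. -/
theorem exp_add_add_le {u f g C G : ℝ} (hf : 0 ≤ u + f) (hg : 0 ≤ g)
    (hC : Real.exp (u + f) ≤ C) (hG : Real.exp g ≤ G) :
    Real.exp (u + f + g) ≤ 1 + C * (u + f) + C * G * g := by
  have key : ∀ v : ℝ, Real.exp v ≤ 1 + Real.exp v * v := by
    intro v
    have h := Real.add_one_le_exp (-v)
    have h' := Real.exp_pos v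
    have : Real.exp v * Real.exp (-v) = 1 := by rw [← Real.exp_add]; simp
    nlinarith
  have h₁ := key (u + f)
  have h₂ := key g
  have hC0 : 0 ≤ C := (Real.exp_pos _).le.trans hC
  calc Real.exp (u + f + g) = Real.exp (u + f) * Real.exp g := Real.exp_add _ _
    _ ≤ Real.exp (u + f) * (1 + G * g) := by gcongr; exact h₂.trans (by gcongr)
    _ = Real.exp (u + f) + Real.exp (u + f) * (G * g) := by ring
    _ ≤ (1 + C * (u + f)) + C * (G * g) := by
        have hG0 : 0 ≤ G := (Real.exp_pos _).le.trans hG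
        gcongr
        exact h₁.trans (by gcongr)
    _ = _ := by ring

theorem densityError_pair_le {s t : ℝ} (hs : 0 < s) (n m : ℤ) :
    densityError I B s t {n, m} ≤ 16 * (B : ℝ) ^ 2 / s +
      ∑ p ∈ primesBetween s t, 2 * (B : ℝ) / p * (diffPrimes I (n - m)).indicator 1 p := by
  have h₁ : ∑ p ∈ primesBetween s t, 2 * ((({n, m} : Finset ℤ).card : ℝ) * B) ^ 2 / (p : ℝ) ^ 2 ≤
      16 * (B : ℝ) ^ 2 / s := by
    have hc : ((({n, m} : Finset ℤ).card : ℝ)) ≤ 2 := by exact_mod_cast Finset.card_le_two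
    calc _ ≤ ∑ p ∈ primesBetween s t, 2 * (2 * (B : ℝ)) ^ 2 * (1 / (p : ℝ) ^ 2) := by
          refine Finset.sum_le_sum fun p _ => ?_
          rw [mul_one_div]
          gcongr
      _ = 2 * (2 * (B : ℝ)) ^ 2 * ∑ p ∈ primesBetween s t, 1 / (p : ℝ) ^ 2 :=
          (Finset.mul_sum _ _ _).symm
      _ ≤ 2 * (2 * (B : ℝ)) ^ 2 * (2 / s) := by
          gcongr; exact sum_primesBetween_inv_sq_le hs t
      _ = _ := by ring
  rw [densityError, Finset.sum_add_distrib]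
  refine add_le_add h₁ (Finset.sum_le_sum fun p _ => ?_)
  have := collisions_pair_le (I := I) n m p
  calc (B : ℝ) * collisions I {n, m} p / p ≤
      B * (2 * (diffPrimes I (n - m)).indicator 1 p) / p := by gcongr
    _ = _ := by ring

/-- Each prime contributes about `1 / p ^ 2`: one factor from the weight, one from the density of
the classes of `n`. The hypothesis `t * primeProd r ≤ y` lets a full period fit into `[1, y]` for
every prime involved, so incomplete periods cost only a factor 2. -/
theorem sum_diffPrimes_weight_le (hB : ∀ p : ℕ, p.Prime → (I p).card ≤ B)
    (hI : ∀ p : ℕ, p.Prime → (I p).card ≤ p - 1) {r s t : ℝ} {y : ℕ} (hrs : r ≤ s)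
    (hs : 0 < s) (hty : t * primeProd r ≤ y) (m b : ℤ) :
    ∑ n ∈ Finset.Icc (1 : ℤ) y,
        (∑ p ∈ primesBetween s t, 2 * (B : ℝ) / p * (diffPrimes I (n - m)).indicator 1 p) *
          (shiftedSet I 0 r b).indicator 1 n ≤
      8 * (B : ℝ) ^ 3 / s * (sieveDensity I r * y) := by
  have hP : (0 : ℝ) < primeProd r := by exact_mod_cast primeProd_pos r
  have hσ := sieveDensity_pos hI r
  calc _ = ∑ p ∈ primesBetween s t, 2 * (B : ℝ) / p * ∑ n ∈ Finset.Icc (1 : ℤ) y,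
          ((diffPrimes I (n - m)).indicator 1 p * (shiftedSet I 0 r b).indicator 1 n) := by
        simp_rw [Finset.sum_mul, Finset.mul_sum]
        rw [Finset.sum_comm]
        simp_rw [mul_assoc]
    _ ≤ ∑ p ∈ primesBetween s t, 2 * (B : ℝ) / p *
          ((B : ℝ) ^ 2 * (2 * y / p * sieveDensity I r)) := by
        refine Finset.sum_le_sum fun p hp => ?_
        obtain ⟨hpp, h₁, h₂⟩ := mem_primesBetween.1 hp
        have hp0 : (0 : ℝ) < p := by exact_mod_cast hpp.pos
        have hle : (p : ℝ) * primeProd r ≤ y := le_trans (by gcongr) hty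
        gcongr
        refine (sum_indicator_diffPrimes_le hB hpp
          (coprime_prime_primeProd hpp (hrs.trans_lt h₁)) hσ.le m b y).trans ?_
        rw [← mul_assoc _ (primeProd r : ℝ)]
        gcongr
        rw [add_mul, one_mul]
        have e : (y : ℝ) / (p * primeProd r) * primeProd r = y / p := by field_simp
        rw [e]
        have : (primeProd r : ℝ) ≤ y / p := by
          rw [le_div_iff₀ hp0]; linarith
        linarith [mul_div_assoc 2 (y : ℝ) p]
    _ = 4 * (B : ℝ) ^ 3 * (sieveDensity I r * y) * ∑ p ∈ primesBetween s t, 1 / (p : ℝ) ^ 2 := by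
        rw [Finset.mul_sum]
        refine Finset.sum_congr rfl fun p hp => ?_
        field_simp
        ring
    _ ≤ 4 * (B : ℝ) ^ 3 * (sieveDensity I r * y) * (2 / s) := by
        gcongr; exact sum_primesBetween_inv_sq_le hs t
    _ = _ := by ring

end

theorem primesUpTo_zero : primesUpTo 0 = ∅ := by
  ext p
  simp only [mem_primesUpTo, Finset.notMem_empty, iff_false, not_and, not_le]
  exact fun hp => by exact_mod_cast hp.pos

/-- Three ranges of primes are treated differently. Those up to `T` are kept exactly; those in `(T,
L]` have a correlation factor bounded by `c`, whose excess `F₁` is averaged over `n` sifted by the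
primes up to `T`; those in `(L, z]` have the larger factor `G`, compensated by the average of `F₂`,
which is `O(1 / L)`. -/
theorem second_moment_le {I : (p : ℕ) → Finset (ZMod p)} {B : ℕ}
    (hI : ∀ p : ℕ, p.Prime → (I p).card ≤ p - 1) (hB : ∀ p : ℕ, p.Prime → (I p).card ≤ B)
    {T L z : ℝ} {y : ℕ} (hT : 0 < T) (hBT : 4 * (B : ℝ) ≤ T) (hTL : T ≤ L) (hLz : L ≤ z)
    (hzy : z ≤ y) (hy : L * primeProd T ≤ y) {c G : ℝ}
    (hc : Real.exp (4 * B) * (1 / sieveDensityBetween I T L) ^ (2 * B) ≤ c)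
    (hG : (1 / sieveDensityBetween I L z) ^ (2 * B) ≤ G) :
    residueExpectation (primeProd z) (fun b => ((sievedInterval I z y b).card : ℝ) ^ 2) ≤
      y + (sieveDensity I z * y) ^ 2 * ((1 + c * (16 * (B : ℝ) ^ 2 / T)) * (1 + primeProd T / y) +
        c * (8 * (B : ℝ) ^ 3 / T)) + c * G * (8 * (B : ℝ) ^ 3 / L) * (y : ℝ) ^ 2 := by
  classical
  have hL : 0 < L := hT.trans_le hTL
  have hz : 0 < z := hL.trans_le hLz
  have hy0 : (0 : ℝ) < y := hz.trans_le hzy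
  have hP : (0 : ℝ) < primeProd T := by exact_mod_cast primeProd_pos T
  have hσ₁ := sieveDensity_pos hI T
  have hσ₂ := sieveDensityBetween_pos hI T z
  have hσ₂' := sieveDensityBetween_le_one hI T z
  have hσ := sieveDensity_eq_mul I (hTL.trans hLz)
  set σ₁ := sieveDensity I T
  set σ₂ := sieveDensityBetween I T z
  set u : ℝ := 16 * (B : ℝ) ^ 2 / T with hu
  have hu0 : 0 ≤ u := by positivity
  have hu4 : u ≤ 4 * B := by
    rw [hu, div_le_iff₀ hT]; nlinarith [(Nat.cast_nonneg B : (0 : ℝ) ≤ B)]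
  have hc0 : 0 ≤ c := le_trans (mul_nonneg (Real.exp_nonneg _) (pow_nonneg (one_div_nonneg.2
    (sieveDensityBetween_pos hI T L).le) _)) hc
  have hG0 : 0 ≤ G := le_trans (pow_nonneg (one_div_nonneg.2
    (sieveDensityBetween_pos hI L z).le) _) hG
  set F₁ : ℤ → ℤ → ℝ := fun n m => ∑ p ∈ primesBetween T L,
    2 * (B : ℝ) / p * (diffPrimes I (n - m)).indicator 1 p with hF₁
  set F₂ : ℤ → ℤ → ℝ := fun n m => ∑ p ∈ primesBetween L z,
    2 * (B : ℝ) / p * (diffPrimes I (n - m)).indicator 1 p with hF₂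
  have hF₁0 : ∀ n m, 0 ≤ F₁ n m := fun n m => Finset.sum_nonneg fun p _ =>
    mul_nonneg (by positivity) (indicator_one_nonneg _ _)
  have hF₂0 : ∀ n m, 0 ≤ F₂ n m := fun n m => Finset.sum_nonneg fun p _ =>
    mul_nonneg (by positivity) (indicator_one_nonneg _ _)
  -- The diagonal is bounded trivially by 1 and gives the term `y`; the comparison with two
  -- independent elements is only available for `n ≠ m`.
  have hpt : ∀ n m : ℤ, containDensity I 0 z {n, m} ≤ (if n = m then 1 else 0) +
      (σ₂ ^ 2 * (1 + c * u) * (containDensity I 0 T {n, m} * 1) +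
        σ₂ ^ 2 * c * (containDensity I 0 T {n, m} * F₁ n m) +
        c * G * (containDensity I 0 0 {n, m} * F₂ n m)) := by
    intro n m
    have hd := containDensity_nonneg I 0 T {n, m}
    have hd1 := containDensity_le_one I 0 T {n, m}
    -- An empty range of primes: this trivial factor brings the third term into the shape required
    -- by `sum_containDensity_pair_mul_le`.
    have hd0 : containDensity I 0 0 {n, m} = 1 := by
      simp [containDensity, primesBetween_zero, primesUpTo_zero]
    by_cases hnm : n = m
    · rw [if_pos hnm]
      have h₁ := containDensity_le_one I 0 z {n, m}
      have h₂ := hF₁0 n m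
      have h₃ := hF₂0 n m
      have : 0 ≤ (σ₂ ^ 2 * (1 + c * u) * (containDensity I 0 T {n, m} * 1) +
        σ₂ ^ 2 * c * (containDensity I 0 T {n, m} * F₁ n m) +
        c * G * (containDensity I 0 0 {n, m} * F₂ n m)) := by
        rw [hd0]; positivity
      linarith
    · rw [if_neg hnm, zero_add, hd0, containDensity_zero_eq_mul (hTL.trans hLz)]
      have hcard : ({n, m} : Finset ℤ).card = 2 := Finset.card_pair hnm
      have h₁ := abs_containDensity_sub_le (I := I) (B := B) (s := T) (t := z) (V := {n, m}) hB
        (by linarith [(Nat.cast_nonneg B : (0 : ℝ) ≤ B)]) (by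
          rw [hcard]; push_cast; linarith)
      rw [hcard] at h₁
      have h₂ : containDensity I T z {n, m} ≤
          Real.exp (densityError I B T z {n, m}) * σ₂ ^ 2 := by
        have := (abs_le.1 h₁).2
        linarith
      have h₃ : densityError I B T z {n, m} ≤ u + F₁ n m + F₂ n m := by
        refine (densityError_pair_le hT n m).trans ?_
        rw [sum_primesBetween_split hTL hLz, ← add_assoc]
      have h₄ : Real.exp (u + F₁ n m) ≤ c := by
        rw [Real.exp_add]
        refine le_trans ?_ hc
        exact mul_le_mul (Real.exp_le_exp.2 hu4) (exp_sum_diffPrimes_le hI T L _)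
          (Real.exp_nonneg _) (Real.exp_nonneg _)
      have h₅ : Real.exp (F₂ n m) ≤ G := (exp_sum_diffPrimes_le hI L z _).trans hG
      have h₆ := exp_add_add_le (add_nonneg hu0 (hF₁0 n m)) (hF₂0 n m) h₄ h₅
      have h₇ : containDensity I T z {n, m} ≤
          (1 + c * (u + F₁ n m) + c * G * F₂ n m) * σ₂ ^ 2 :=
        h₂.trans (by gcongr; exact (Real.exp_le_exp.2 h₃).trans h₆)
      -- The sieve factors are discarded in the term of the large primes; the loss, a power of `log
      -- y`, is recovered from `1 / L`.
      have h₈ : containDensity I 0 T {n, m} * (c * G * F₂ n m * σ₂ ^ 2) ≤ c * G * F₂ n m := by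
        have : 0 ≤ c * G * F₂ n m := mul_nonneg (mul_nonneg hc0 hG0) (hF₂0 n m)
        have h9 : σ₂ ^ 2 ≤ 1 := pow_le_one₀ hσ₂.le hσ₂'
        calc _ ≤ 1 * (c * G * F₂ n m * 1) := by gcongr
          _ = _ := by ring
      calc _ ≤ containDensity I 0 T {n, m} *
            ((1 + c * (u + F₁ n m) + c * G * F₂ n m) * σ₂ ^ 2) := by gcongr
        _ = σ₂ ^ 2 * (1 + c * u) * (containDensity I 0 T {n, m} * 1) +
            σ₂ ^ 2 * c * (containDensity I 0 T {n, m} * F₁ n m) +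
            containDensity I 0 T {n, m} * (c * G * F₂ n m * σ₂ ^ 2) := by ring
        _ ≤ _ := by linarith
  have hdiag : ∑ m ∈ Finset.Icc (1 : ℤ) y, ∑ n ∈ Finset.Icc (1 : ℤ) y,
      (if n = m then (1 : ℝ) else 0) = y := by
    rw [Finset.sum_congr rfl fun m hm => by rw [Finset.sum_ite_eq' , if_pos hm]]
    simp
  have hX₀ := sum_containDensity_pair_mul_le (I := I) (fun _ _ => 1) T
    (σ₁ * y * (1 + primeProd T / y)) y (fun m b => by
      have := sum_indicator_class_le I (s := T) one_pos (Nat.coprime_one_left _) 0 b y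
      simp only [Nat.cast_one, one_dvd, one_mul] at this
      have e : ({_n : ℤ | True}.indicator (1 : ℤ → ℝ)) = 1 := by
        funext n; rw [Set.indicator_of_mem (by trivial)]
      rw [e] at this
      simp only [Pi.one_apply] at this
      refine this.trans (le_of_eq ?_)
      field_simp
      ring)
  have hX₁ := sum_containDensity_pair_mul_le (I := I) F₁ T _ y
    (fun m b => sum_diffPrimes_weight_le hB hI le_rfl hT hy m b)
  -- No sifting of `n` here: `z * primeProd T` may exceed `y`, whereas with empty sifting only `z ≤
  -- y` is needed.
  have hX₂ := sum_containDensity_pair_mul_le (I := I) F₂ 0 _ y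
    (fun m b => sum_diffPrimes_weight_le hB hI hL.le hL (t := z) (r := 0) (by
      simpa [primeProd, primesUpTo_zero] using hzy) m b)
  have hσ0 : sieveDensity I 0 = 1 := by simp [sieveDensity, primesUpTo_zero]
  rw [hσ0] at hX₂
  rw [residueExpectation_card_sievedInterval_sq]
  refine (Finset.sum_le_sum fun m _ => Finset.sum_le_sum fun n _ => hpt n m).trans ?_
  simp_rw [Finset.sum_add_distrib, ← Finset.mul_sum]
  rw [hdiag, hσ]
  have h₁ : σ₂ ^ 2 * (1 + c * u) * _ ≤ σ₂ ^ 2 * (1 + c * u) * _ :=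
    mul_le_mul_of_nonneg_left hX₀ (by positivity)
  have h₂ : σ₂ ^ 2 * c * _ ≤ σ₂ ^ 2 * c * _ := mul_le_mul_of_nonneg_left hX₁ (by positivity)
  have h₃ : c * G * _ ≤ c * G * _ := mul_le_mul_of_nonneg_left hX₂ (by positivity)
  refine (add_le_add le_rfl (add_le_add (add_le_add h₁ h₂) h₃)).trans (le_of_eq ?_)
  ring

/-! ### Growth of the parameters and consequences of the Mertens hypothesis. -/

theorem eventually_yParam_bounds {δ : ℝ} (hδ : 0 < δ) (hδ' : δ < 1 / 2) :
    ∀ᶠ x : ℝ in atTop, 1 ≤ Real.log x ∧ x * Real.log x ^ δ ≤ yParam δ x ∧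
      x ≤ yParam δ x ∧ (yParam δ x : ℝ) ≤ x ^ 2 := by
  have h₁ : ∀ᶠ x : ℝ in atTop, 1 ≤ Real.log x := Real.tendsto_log_atTop.eventually_ge_atTop 1
  have h₂ : ∀ᶠ x : ℝ in atTop, Real.log x ≤ x / 4 := by
    have := Real.isLittleO_log_id_atTop.bound (c := 1 / 4) (by norm_num)
    filter_upwards [this, h₁, eventually_ge_atTop 1] with x hx h h'
    rw [Real.norm_of_nonneg (by linarith), id, Real.norm_of_nonneg (by linarith)] at hx
    linarith
  filter_upwards [h₁, h₂, eventually_ge_atTop 4] with x h₁ h₂ h₃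
  have hx0 : 0 < x := by linarith
  have hpow : 1 ≤ Real.log x ^ δ := Real.one_le_rpow h₁ hδ.le
  have hpow' : Real.log x ^ δ ≤ Real.log x := by
    calc _ ≤ Real.log x ^ (1 : ℝ) := Real.rpow_le_rpow_of_exponent_le h₁ (by linarith)
      _ = _ := Real.rpow_one _
  have hle : x * Real.log x ^ δ ≤ yParam δ x := Nat.le_ceil _
  refine ⟨h₁, hle, by nlinarith, ?_⟩
  have hlt : (yParam δ x : ℝ) < x * Real.log x ^ δ + 1 := Nat.ceil_lt_add_one (by positivity)
  nlinarith

theorem tendsto_yParam {δ : ℝ} (hδ : 0 < δ) (hδ' : δ < 1 / 2) :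
    Tendsto (fun x : ℝ => (yParam δ x : ℝ)) atTop atTop :=
  tendsto_atTop_mono' _ ((eventually_yParam_bounds hδ hδ').mono fun _ h => h.2.2.1) tendsto_id

theorem eventually_log_yParam {δ : ℝ} (hδ : 0 < δ) (hδ' : δ < 1 / 2) :
    ∀ᶠ x : ℝ in atTop, Real.log x ≤ Real.log (yParam δ x) ∧
      Real.log (yParam δ x) ≤ 2 * Real.log x := by
  filter_upwards [eventually_yParam_bounds hδ hδ', eventually_gt_atTop 0] with x h h0
  refine ⟨Real.log_le_log h0 h.2.2.1, ?_⟩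
  calc _ ≤ Real.log (x ^ 2) := Real.log_le_log (h0.trans_le h.2.2.1) h.2.2.2
    _ = _ := by rw [Real.log_pow]; norm_num

theorem tendsto_log_yParam {δ : ℝ} (hδ : 0 < δ) (hδ' : δ < 1 / 2) :
    Tendsto (fun x : ℝ => Real.log (yParam δ x)) atTop atTop :=
  Real.tendsto_log_atTop.comp (tendsto_yParam hδ hδ')

theorem eventually_log_le_rpow {a : ℝ} (ha : 0 < a) : ∀ᶠ t : ℝ in atTop, Real.log t ≤ t ^ a := by
  have := (isLittleO_log_rpow_atTop ha).bound one_pos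
  filter_upwards [this, eventually_ge_atTop 1] with t h h1
  rw [one_mul, Real.norm_of_nonneg (Real.log_nonneg h1),
    Real.norm_of_nonneg (Real.rpow_nonneg (by linarith) _)] at h
  exact h

theorem eventually_zParam_bounds {δ : ℝ} (hδ : 0 < δ) (hδ' : δ < 1 / 2) :
    ∀ᶠ x : ℝ in atTop, (yParam δ x : ℝ) ^ (1 / 2 : ℝ) ≤ zParam δ x ∧
      zParam δ x ≤ yParam δ x ∧
      yParam δ x / zParam δ x ≤ Real.log (yParam δ x) ^ (1 / 2 : ℝ) := by
  have hL := Real.tendsto_log_atTop.eventually (eventually_log_le_rpow (a := 1 / 2) (by norm_num))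
  have hL' := (Real.tendsto_log_atTop.comp Real.tendsto_log_atTop).eventually_ge_atTop 1
  filter_upwards [eventually_yParam_bounds hδ hδ', eventually_log_yParam hδ hδ', hL, hL',
    eventually_gt_atTop 0] with x h₁ h₂ h₃ h₄ h₀
  simp only [Function.comp] at h₄
  have hy : (0 : ℝ) < yParam δ x := h₀.trans_le h₁.2.2.1
  have hLp : 0 < Real.log x := by linarith [h₁.1]
  set y : ℝ := ((yParam δ x : ℕ) : ℝ) with hyd
  have hr : 0 < Real.log x ^ (1 / 2 : ℝ) := Real.rpow_pos_of_pos hLp _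
  have hz : y / Real.log x ^ (1 / 2 : ℝ) ≤ zParam δ x := by
    rw [zParam, ← hyd]
    gcongr
    nlinarith
  have hrl : Real.log x ^ (1 / 2 : ℝ) ≤ Real.log y ^ (1 / 2 : ℝ) :=
    Real.rpow_le_rpow hLp.le h₂.1 (by norm_num)
  have hly : Real.log y ^ (1 / 2 : ℝ) ≤ y ^ (1 / 2 : ℝ) :=
    Real.rpow_le_rpow (by linarith) ((Real.log_le_sub_one_of_pos hy).trans (by linarith))
      (by norm_num)
  have hyy : y ^ (1 / 2 : ℝ) * y ^ (1 / 2 : ℝ) = y := by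
    rw [← Real.rpow_add hy]; norm_num
  have hyr : 0 < y ^ (1 / 2 : ℝ) := Real.rpow_pos_of_pos hy _
  refine ⟨le_trans ?_ hz, ?_, ?_⟩
  · rw [le_div_iff₀ hr]
    calc _ ≤ y ^ (1 / 2 : ℝ) * y ^ (1 / 2 : ℝ) :=
          mul_le_mul_of_nonneg_left (hrl.trans hly) hyr.le
      _ = y := hyy
  · rw [zParam, ← hyd, div_le_iff₀ hr]
    gcongr
  · have hzp : 0 < zParam δ x := lt_of_lt_of_le (by positivity) hz
    rw [div_le_iff₀ hr] at hz
    rw [div_le_iff₀ hzp]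
    nlinarith

theorem tendsto_zParam {δ : ℝ} (hδ : 0 < δ) (hδ' : δ < 1 / 2) :
    Tendsto (fun x : ℝ => zParam δ x) atTop atTop :=
  tendsto_atTop_mono' _ ((eventually_zParam_bounds hδ hδ').mono fun _ h => h.1)
    ((tendsto_rpow_atTop (by norm_num)).comp (tendsto_yParam hδ hδ'))

theorem IsRegularSievingSystem.exists_tendsto {I : (p : ℕ) → Finset (ZMod p)} {B : ℕ} {ρ : ℕ → ℝ}
    (hI : IsRegularSievingSystem I B ρ) :
    ∃ C₁ : ℝ, 0 < C₁ ∧ Tendsto (fun t => sieveDensity I t * Real.log t) atTop (nhds C₁) := by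
  obtain ⟨C₁, hC, h⟩ := hI.mertens
  refine ⟨C₁, hC, ?_⟩
  rw [isEquivalent_iff_tendsto_one] at h
  · have h' := h.mul_const C₁
    rw [one_mul] at h'
    refine h'.congr' ?_
    filter_upwards [eventually_gt_atTop 1] with t ht
    have := Real.log_pos ht
    simp only [Pi.div_apply, sieveDensity]
    field_simp
  · filter_upwards [eventually_gt_atTop 1] with t ht
    have := Real.log_pos ht
    positivity

/-- Mertens gives the order `1 / log z`, which is at least of order `1 / log y`; the second power of
the logarithm swallows the constant. -/
theorem eventually_sieveDensity_zParam {I : (p : ℕ) → Finset (ZMod p)} {B : ℕ} {ρ : ℕ → ℝ}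
    (hI : IsRegularSievingSystem I B ρ) {δ : ℝ} (hδ : 0 < δ) (hδ' : δ < 1 / 2) :
    ∀ᶠ x : ℝ in atTop, 1 / Real.log (yParam δ x) ^ 2 ≤ sieveDensity I (zParam δ x) := by
  obtain ⟨C₁, hC, h⟩ := hI.exists_tendsto
  have h₁ := (tendsto_zParam hδ hδ').eventually (h.eventually (lt_mem_nhds (half_lt_self hC)))
  have h₂ := (tendsto_log_yParam hδ hδ').eventually_ge_atTop (2 / C₁)
  filter_upwards [h₁, h₂, eventually_zParam_bounds hδ hδ',
    (tendsto_zParam hδ hδ').eventually_gt_atTop 1] with x h₁ h₂ h₃ h₄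
  have hz := Real.log_pos h₄
  have hzy : Real.log (zParam δ x) ≤ Real.log (yParam δ x) :=
    Real.log_le_log (by linarith) h₃.2.1
  have hy : 0 < Real.log (yParam δ x) := hz.trans_le hzy
  have hσ : 0 < sieveDensity I (zParam δ x) := sieveDensity_pos hI.card_le_pred _
  rw [div_le_iff₀ (by positivity)]
  rw [div_le_iff₀ hC] at h₂
  have h₅ : C₁ / 2 ≤ sieveDensity I (zParam δ x) * Real.log (yParam δ x) :=
    h₁.le.trans (by gcongr)
  nlinarith

/-- The inverse density of `(T, T ^ N]` tends to `N`, because `log (T ^ N) = N * log T`. In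
particular it stays bounded, which makes the middle range of the second moment harmless. -/
theorem eventually_sieveDensityBetween_pow {I : (p : ℕ) → Finset (ZMod p)} {B : ℕ} {ρ : ℕ → ℝ}
    (hI : IsRegularSievingSystem I B ρ) {N : ℕ} (hN : 1 ≤ N) :
    ∀ᶠ T : ℝ in atTop, 1 / sieveDensityBetween I T (T ^ N) ≤ 2 * N := by
  obtain ⟨C₁, hC, h⟩ := hI.exists_tendsto
  have h' : Tendsto (fun T : ℝ => sieveDensity I (T ^ N) * Real.log (T ^ N)) atTop (nhds C₁) :=
    h.comp (tendsto_pow_atTop (by omega))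
  -- The factors `4 / 3` and `2 / 3` have quotient 2, whence the bound `2 * N`.
  have h₁ := h.eventually (gt_mem_nhds (show C₁ < 4 / 3 * C₁ by linarith))
  have h₂ := h'.eventually (lt_mem_nhds (show 2 / 3 * C₁ < C₁ by linarith))
  filter_upwards [h₁, h₂, eventually_gt_atTop 1] with T h₁ h₂ h₃
  have hlog := Real.log_pos h₃
  have hT : T ≤ T ^ N := le_self_pow₀ h₃.le (by omega)
  have hb := sieveDensityBetween_pos hI.card_le_pred T (T ^ N)
  have hs := sieveDensity_pos hI.card_le_pred T
  rw [sieveDensity_eq_mul I hT, Real.log_pow] at h₂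
  have hN' : (1 : ℝ) ≤ N := by exact_mod_cast hN
  rw [div_le_iff₀ hb]
  by_contra! hcon
  have : sieveDensity I T * sieveDensityBetween I T (T ^ N) * (N * Real.log T) =
      (sieveDensity I T * Real.log T) * (2 * N * sieveDensityBetween I T (T ^ N)) / 2 := by ring
  rw [this] at h₂
  have h₄ : (sieveDensity I T * Real.log T) * (2 * N * sieveDensityBetween I T (T ^ N)) ≤
      (sieveDensity I T * Real.log T) * 1 := by gcongr
  linarith

theorem primeProd_le_rpow {T : ℝ} (hT : 0 ≤ T) : (primeProd T : ℝ) ≤ (4 : ℝ) ^ T := by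
  have h : primeProd T = primorial ⌊T⌋₊ := rfl
  rw [h]
  calc (primorial ⌊T⌋₊ : ℝ) ≤ ((4 ^ ⌊T⌋₊ : ℕ) : ℝ) := by exact_mod_cast primorial_le_four_pow _
    _ = (4 : ℝ) ^ ((⌊T⌋₊ : ℕ) : ℝ) := by push_cast; rw [Real.rpow_natCast]
    _ ≤ _ := Real.rpow_le_rpow_of_exponent_le (by norm_num) (Nat.floor_le hT)

/-- Powers of `log t` are eventually smaller than positive powers of `t`. -/
theorem eventually_const_mul_log_rpow_le (C A : ℝ) {a : ℝ} (ha : 0 < a) :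
    ∀ᶠ t : ℝ in atTop, C * Real.log t ^ A ≤ t ^ a := by
  have h := (isLittleO_log_rpow_rpow_atTop A ha).bound (c := 1 / (|C| + 1)) (by positivity)
  filter_upwards [h, eventually_ge_atTop 1] with t h ht
  have hl := Real.log_nonneg ht
  rw [Real.norm_of_nonneg (Real.rpow_nonneg hl _),
    Real.norm_of_nonneg (Real.rpow_nonneg (by linarith) _), div_mul_eq_mul_div, one_mul,
    le_div_iff₀ (by positivity)] at h
  nlinarith [le_abs_self C, Real.rpow_nonneg hl A]

/-! ### The second moment asymptotics. -/

/-- With `20 * T = log y`, every error is brought to the form of a constant times `(σ * y) ^ 2 / log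
y`. The power `T ^ (4 * B + 6)` cancels `(log y) ^ (4 * B)` from the correlation of the large primes
and `(log y) ^ 4` from replacing `y ^ 2` by `(σ * y) ^ 2`; one of the two remaining powers gives the
saving. -/
theorem second_moment_error_le {B : ℕ} {c T σ y r P : ℝ} (hc0 : 0 ≤ c) (hT1 : 1 ≤ T)
    (hTB : 4 * (B : ℝ) ≤ T) (hσ : 0 < σ) (hy0 : 0 < y) (hℓσ : 1 ≤ (20 * T) ^ 2 * σ) (hr0 : 0 < r)
    (hrr : r * r = y) (h₅ : (20 * T) ^ (4 * B + 6) ≤ r) (hP0 : 0 ≤ P) (hP : P ≤ r) :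
    y + (σ * y) ^ 2 * ((1 + c * (16 * (B : ℝ) ^ 2 / T)) * (1 + P / y) +
        c * (8 * (B : ℝ) ^ 3 / T)) +
      c * (20 * T) ^ (4 * B) * (8 * (B : ℝ) ^ 3 / T ^ (4 * B + 6)) * y ^ 2 ≤
    (σ * y) ^ 2 + (1 + 320 * c * B ^ 2 + (1 + 4 * B * c) + 160 * c * B ^ 3 +
      8 * c * B ^ 3 * 20 ^ (4 * B + 5)) / (20 * T) * (σ * y) ^ 2 := by
  have hB0 : (0 : ℝ) ≤ B := Nat.cast_nonneg _
  have hℓ1 : 1 ≤ 20 * T := by linarith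
  have hT0 : 0 < T := by linarith
  have hX : 0 ≤ (σ * y) ^ 2 := by positivity
  have hy2 : y ^ 2 ≤ (σ * y) ^ 2 * (20 * T) ^ 4 := by
    have : (1 : ℝ) ≤ ((20 * T) ^ 2 * σ) ^ 2 := one_le_pow₀ hℓσ
    calc y ^ 2 = 1 * y ^ 2 := by ring
      _ ≤ ((20 * T) ^ 2 * σ) ^ 2 * y ^ 2 := mul_le_mul_of_nonneg_right this (by positivity)
      _ = _ := by ring
  have hℓ5 : (20 * T) ^ 5 ≤ y := by
    have h1r : 1 ≤ r := (one_le_pow₀ hℓ1).trans h₅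
    calc (20 * T) ^ 5 ≤ (20 * T) ^ (4 * B + 6) := pow_le_pow_right₀ hℓ1 (by omega)
      _ ≤ r := h₅
      _ ≤ r * r := by nlinarith
      _ = y := hrr
  have e₁ : y ≤ (σ * y) ^ 2 * (1 / (20 * T)) := by
    rw [mul_one_div, le_div_iff₀ (by linarith)]
    have : y * (20 * T) * (20 * T) ^ 4 ≤ (σ * y) ^ 2 * (20 * T) ^ 4 := by
      calc y * (20 * T) * (20 * T) ^ 4 = y * (20 * T) ^ 5 := by ring
        _ ≤ y * y := mul_le_mul_of_nonneg_left hℓ5 hy0.le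
        _ = y ^ 2 := by ring
        _ ≤ _ := hy2
    exact le_of_mul_le_mul_right this (by positivity)
  have e₂ : c * (16 * (B : ℝ) ^ 2 / T) = 320 * c * B ^ 2 * (1 / (20 * T)) := by
    field_simp; ring
  have e₂' : c * (16 * (B : ℝ) ^ 2 / T) ≤ 4 * B * c := by
    have : 16 * (B : ℝ) ^ 2 / T ≤ 4 * B := by
      rw [div_le_iff₀ (by linarith)]; nlinarith
    nlinarith
  have e₃ : P / y ≤ 1 / (20 * T) := by
    rw [div_le_div_iff₀ hy0 (by linarith), one_mul, ← hrr]
    have : 20 * T ≤ r := (le_self_pow₀ hℓ1 (by omega)).trans h₅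
    exact mul_le_mul hP this (by linarith) hr0.le
  have e₄ : c * (8 * (B : ℝ) ^ 3 / T) = 160 * c * B ^ 3 * (1 / (20 * T)) := by
    field_simp; ring
  have e₅ : c * (20 * T) ^ (4 * B) * (8 * (B : ℝ) ^ 3 / T ^ (4 * B + 6)) * y ^ 2 ≤
      8 * c * B ^ 3 * 20 ^ (4 * B + 5) * (1 / (20 * T)) * (σ * y) ^ 2 := by
    have h9 : (20 * T) ^ (4 * B) * (1 / T ^ (4 * B + 6)) * (20 * T) ^ 4 ≤
        20 ^ (4 * B + 5) * (1 / (20 * T)) := by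
      rw [mul_one_div, mul_one_div, div_mul_eq_mul_div, div_le_div_iff₀ (by positivity)
        (by positivity), ← pow_add, ← pow_succ, mul_pow]
      exact mul_le_mul_of_nonneg_left (pow_le_pow_right₀ hT1 (by omega)) (by positivity)
    have h10 : 0 ≤ c * (20 * T) ^ (4 * B) * (8 * (B : ℝ) ^ 3 / T ^ (4 * B + 6)) := by positivity
    calc c * (20 * T) ^ (4 * B) * (8 * (B : ℝ) ^ 3 / T ^ (4 * B + 6)) * y ^ 2
        ≤ c * (20 * T) ^ (4 * B) * (8 * (B : ℝ) ^ 3 / T ^ (4 * B + 6)) *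
          ((σ * y) ^ 2 * (20 * T) ^ 4) := mul_le_mul_of_nonneg_left hy2 h10
      _ = 8 * c * B ^ 3 * (σ * y) ^ 2 *
          ((20 * T) ^ (4 * B) * (1 / T ^ (4 * B + 6)) * (20 * T) ^ 4) := by ring
      _ ≤ 8 * c * B ^ 3 * (σ * y) ^ 2 * (20 ^ (4 * B + 5) * (1 / (20 * T))) :=
          mul_le_mul_of_nonneg_left h9 (by positivity)
      _ = _ := by ring
  have e₆ : (1 + c * (16 * (B : ℝ) ^ 2 / T)) * (1 + P / y) ≤
      1 + 320 * c * B ^ 2 * (1 / (20 * T)) + (1 + 4 * B * c) * (1 / (20 * T)) := by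
    have h0 : 0 ≤ P / y := by positivity
    have h1 : 0 ≤ c * (16 * (B : ℝ) ^ 2 / T) := by positivity
    have h2 : (1 + c * (16 * (B : ℝ) ^ 2 / T)) * (P / y) ≤ (1 + 4 * B * c) * (1 / (20 * T)) :=
      mul_le_mul (by linarith) e₃ h0 (by positivity)
    calc _ = 1 + c * (16 * (B : ℝ) ^ 2 / T) +
          (1 + c * (16 * (B : ℝ) ^ 2 / T)) * (P / y) := by ring
      _ ≤ _ := by rw [e₂] at h2 ⊢; linarith
  have e₇ : (σ * y) ^ 2 * ((1 + c * (16 * (B : ℝ) ^ 2 / T)) * (1 + P / y) +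
        c * (8 * (B : ℝ) ^ 3 / T)) ≤ (σ * y) ^ 2 * ((1 + 320 * c * B ^ 2 * (1 / (20 * T)) +
        (1 + 4 * B * c) * (1 / (20 * T))) + 160 * c * B ^ 3 * (1 / (20 * T))) := by
    rw [e₄]; exact mul_le_mul_of_nonneg_left (by linarith) hX
  calc _ ≤ (σ * y) ^ 2 * (1 / (20 * T)) + (σ * y) ^ 2 * ((1 + 320 * c * B ^ 2 * (1 / (20 * T)) +
        (1 + 4 * B * c) * (1 / (20 * T))) + 160 * c * B ^ 3 * (1 / (20 * T))) +
        8 * c * B ^ 3 * 20 ^ (4 * B + 5) * (1 / (20 * T)) * (σ * y) ^ 2 :=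
        add_le_add (add_le_add e₁ e₇) e₅
    _ = _ := by ring

theorem eventually_abs_second_moment_sub_le {I : (p : ℕ) → Finset (ZMod p)} {B : ℕ} {ρ : ℕ → ℝ}
    (hI : IsRegularSievingSystem I B ρ) {δ : ℝ} (hδ : 0 < δ) (hδ' : δ < 1 / 2) :
    ∃ C : ℝ, 0 ≤ C ∧ ∀ᶠ x : ℝ in atTop,
      |residueExpectation (primeProd (zParam δ x))
          (fun b => ((sievedInterval I (zParam δ x) (yParam δ x) b).card : ℝ) ^ 2) -
          (sieveDensity I (zParam δ x) * yParam δ x) ^ 2| ≤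
        C / Real.log (yParam δ x) * (sieveDensity I (zParam δ x) * yParam δ x) ^ 2 := by
  set N : ℕ := 4 * B + 6 with hN
  set c : ℝ := Real.exp (4 * B) * (2 * N) ^ (2 * B) with hc
  have hc0 : 0 ≤ c := by positivity
  have hB0 : (0 : ℝ) ≤ B := Nat.cast_nonneg _
  refine ⟨1 + 320 * c * B ^ 2 + (1 + 4 * B * c) + 160 * c * B ^ 3 +
    8 * c * B ^ 3 * 20 ^ (4 * B + 5), by positivity, ?_⟩
  have hℓ := tendsto_log_yParam hδ hδ'
  have hT : Tendsto (fun x : ℝ => Real.log (yParam δ x) / 20) atTop atTop :=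
    hℓ.atTop_div_const (by norm_num)
  have hy := tendsto_yParam hδ hδ'
  filter_upwards [hT.eventually_ge_atTop (max 1 (4 * B)), eventually_zParam_bounds hδ hδ',
    eventually_sieveDensity_zParam hI hδ hδ',
    hT.eventually (eventually_sieveDensityBetween_pow hI (N := N) (by omega)),
    hy.eventually (eventually_const_mul_log_rpow_le 1 N (a := 1 / 2) (by norm_num)),
    hy.eventually_ge_atTop 1] with x h₁ h₂ h₃ h₄ h₅ h₆
  set z := zParam δ x
  set y := yParam δ x
  set ℓ := Real.log y with hℓd
  -- Small enough that `primeProd T ≤ 4 ^ T ≤ y ^ (1 / 2)`, yet of order `log y`, so that errors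
  -- `O(1 / T)` are admissible.
  set T : ℝ := ℓ / 20 with hTd
  have hℓT : ℓ = 20 * T := by rw [hTd]; ring
  have hT1 : 1 ≤ T := (le_max_left _ _).trans h₁
  have hTB : 4 * (B : ℝ) ≤ T := (le_max_right _ _).trans h₁
  have hℓ1 : 1 ≤ ℓ := by linarith
  have hy0 : (0 : ℝ) < y := by linarith
  have hσ := sieveDensity_pos hI.card_le_pred z
  set σ := sieveDensity I z
  set r : ℝ := (y : ℝ) ^ (1 / 2 : ℝ) with hr
  have hr0 : 0 < r := Real.rpow_pos_of_pos hy0 _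
  have hrr : r * r = y := by rw [hr, ← Real.rpow_add hy0]; norm_num
  rw [one_mul, Real.rpow_natCast] at h₅
  have hTN : T ^ N ≤ r := le_trans (by gcongr; linarith) h₅
  have hP : (primeProd T : ℝ) ≤ r := by
    refine (primeProd_le_rpow (by linarith)).trans ?_
    rw [hr, Real.rpow_def_of_pos (by norm_num), Real.rpow_def_of_pos hy0, ← hℓd]
    refine Real.exp_le_exp.2 ?_
    have : Real.log 4 ≤ 3 := (Real.log_le_sub_one_of_pos (by norm_num)).trans (by norm_num)
    nlinarith
  have hTTN : T ≤ T ^ N := le_self_pow₀ hT1 (by omega)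
  have hTNz : T ^ N ≤ z := hTN.trans h₂.1
  have hLP : T ^ N * primeProd T ≤ y := by rw [← hrr]; gcongr
  have hℓσ : 1 ≤ ℓ ^ 2 * σ := by
    rw [div_le_iff₀ (by positivity)] at h₃; linarith
  have hG : (1 / sieveDensityBetween I (T ^ N) z) ^ (2 * B) ≤ ℓ ^ (4 * B) := by
    have hb := sieveDensityBetween_pos hI.card_le_pred (T ^ N) z
    have : σ ≤ sieveDensityBetween I (T ^ N) z := by
      have e := sieveDensity_eq_mul I hTNz
      have h7 := sieveDensity_le_one hI.card_le_pred (T ^ N)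
      have h8 := sieveDensity_pos hI.card_le_pred (T ^ N)
      change sieveDensity I z ≤ _
      rw [e]; nlinarith
    rw [show 4 * B = 2 * (2 * B) by ring, pow_mul ℓ]
    gcongr
    rw [div_le_iff₀ hb]
    exact hℓσ.trans (by gcongr)
  have hcc : Real.exp (4 * B) * (1 / sieveDensityBetween I T (T ^ N)) ^ (2 * B) ≤ c := by
    have hb := sieveDensityBetween_pos hI.card_le_pred T (T ^ N)
    rw [hc]; gcongr
  have hmain := second_moment_le hI.card_le_pred hI.card_le (by linarith) hTB hTTN hTNz h₂.2.1 hLP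
    hcc hG
  have hlow : (σ * y) ^ 2 ≤ residueExpectation (primeProd z)
      (fun b => ((sievedInterval I z y b).card : ℝ) ^ 2) := by
    rw [← residueExpectation_card_sievedInterval (I := I) z y]
    exact residueExpectation_sq_le (primeProd_pos z) _
  rw [abs_of_nonneg (by linarith)]
  have := second_moment_error_le (B := B) hc0 hT1 hTB hσ hy0 (hℓT ▸ hℓσ) hr0 hrr
    (hℓT ▸ h₅) (Nat.cast_nonneg _) hP
  rw [hℓT] at hmain ⊢
  linarith

/-! ### The scales `H` and the number of primes attached to them. -/

/-- The factor 2 in `2 * y / x ≤ H` absorbs `log y ≤ 2 * log x`. The lower bound makes `log log y` a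
constant times `log H` at most; the upper bound keeps `σ₂` to the power of minus a multiple of `H`
below any power of `y`. -/
theorem eventually_scales_bounds {δ ξ : ℝ} (hδ : 0 < δ) (hδ' : δ < 1 / 2) (hξ : 1 < ξ) :
    ∀ᶠ x : ℝ in atTop, ∀ H ∈ scales ξ δ x, Real.log (yParam δ x) ^ δ ≤ H ∧
      H ≤ Real.log (yParam δ x) ^ (1 / 2 : ℝ) := by
  filter_upwards [eventually_yParam_bounds hδ hδ', eventually_log_yParam hδ hδ',
    eventually_zParam_bounds hδ hδ', eventually_gt_atTop 0] with x h₁ h₂ h₃ h₀ H hH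
  obtain ⟨-, hl, hu⟩ := hH
  have hy : (0 : ℝ) < yParam δ x := h₀.trans_le h₁.2.2.1
  have hz : 0 < zParam δ x := (Real.rpow_pos_of_pos hy _).trans_le h₃.1
  constructor
  · refine le_trans ?_ hl
    rw [mul_div_assoc]
    have h4 : Real.log x ^ δ ≤ yParam δ x / x := by
      rw [le_div_iff₀ h₀]; linarith [h₁.2.1]
    have h5 : (2 : ℝ) ^ δ ≤ 2 := by
      calc (2 : ℝ) ^ δ ≤ 2 ^ (1 : ℝ) :=
            Real.rpow_le_rpow_of_exponent_le (by norm_num) (by linarith)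
        _ = 2 := Real.rpow_one _
    calc Real.log (yParam δ x) ^ δ ≤ (2 * Real.log x) ^ δ :=
          Real.rpow_le_rpow (by linarith) h₂.2 hδ.le
      _ = 2 ^ δ * Real.log x ^ δ := Real.mul_rpow (by norm_num) (by linarith)
      _ ≤ 2 * (yParam δ x / x) := by
          have : 0 ≤ Real.log x ^ δ := Real.rpow_nonneg (by linarith) _
          gcongr
  · refine hu.trans (le_trans ?_ h₃.2.2)
    gcongr
    nlinarith

/-- The counts up to `t` and up to `t / ξ` are subtracted. The limit density `r * (1 - 1 / ξ)` is
positive because `ξ > 1`, and a second logarithm replaces the constant. -/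
theorem eventually_card_primes_Ioc {I : (p : ℕ) → Finset (ZMod p)} {r ξ : ℝ} {ν : ℕ} (hξ : 1 < ξ)
    (hr : 0 < r)
    (h : Tendsto (fun x : ℝ =>
      (((primesUpTo x).filter (fun p => (I p).card = ν)).card : ℝ) / (x / Real.log x))
      atTop (nhds r)) :
    ∀ᶠ t : ℝ in atTop, t / Real.log t ^ 2 ≤
      ((primesUpTo t).filter (fun q : ℕ => t / ξ < (q : ℝ) ∧ (I q).card = ν)).card := by
  have hξ0 : 0 < ξ := by linarith
  set f : ℝ → ℝ := fun x => ((primesUpTo x).filter (fun p => (I p).card = ν)).card with hf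
  have hsc : Tendsto (fun t : ℝ => t / ξ) atTop atTop := tendsto_id.atTop_div_const hξ0
  have h1 : Tendsto (fun t => f (t / ξ) / (t / ξ / Real.log (t / ξ))) atTop (nhds r) := h.comp hsc
  -- This puts both counts over the common normalisation `t / log t`.
  have h2 : Tendsto (fun t => Real.log t / Real.log (t / ξ)) atTop (nhds 1) := by
    have h3 : Tendsto (fun t => 1 + Real.log ξ / Real.log (t / ξ)) atTop (nhds (1 + 0)) :=
      tendsto_const_nhds.add
        (tendsto_const_nhds.div_atTop (Real.tendsto_log_atTop.comp hsc))
    rw [add_zero] at h3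
    refine h3.congr' ?_
    filter_upwards [hsc.eventually_gt_atTop 1] with t ht
    have ht0 : 0 < t := by
      by_contra! hn
      have : t / ξ ≤ 0 := div_nonpos_of_nonpos_of_nonneg hn hξ0.le
      linarith
    have := Real.log_pos ht
    have e : Real.log t = Real.log (t / ξ) + Real.log ξ := by
      rw [← Real.log_mul (by positivity) hξ0.ne', div_mul_cancel₀ _ hξ0.ne']
    rw [e]; field_simp
  have h4 := (h.sub ((h1.mul h2).mul_const (1 / ξ)))
  have hpos : 0 < r - r * 1 * (1 / ξ) := by
    have : 1 / ξ < 1 := by rw [div_lt_one hξ0]; exact hξ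
    nlinarith
  have h5 := h4.eventually (lt_mem_nhds (half_lt_self hpos))
  set κ := (r - r * 1 * (1 / ξ)) / 2 with hκ
  have hκ0 : 0 < κ := by positivity
  filter_upwards [h5, hsc.eventually_gt_atTop 1, eventually_gt_atTop 1,
    Real.tendsto_log_atTop.eventually_ge_atTop (1 / κ)] with t h6 h7 h8 h9
  have hl := Real.log_pos h7
  have hl' := Real.log_pos h8
  have e : f t / (t / Real.log t) - f (t / ξ) / (t / ξ / Real.log (t / ξ)) *
      (Real.log t / Real.log (t / ξ)) * (1 / ξ) = (f t - f (t / ξ)) / (t / Real.log t) := by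
    field_simp
  change κ < f t / (t / Real.log t) - _ at h6
  rw [e, lt_div_iff₀ (by positivity)] at h6
  have hcard : f t - f (t / ξ) ≤
      ((primesUpTo t).filter (fun q : ℕ => t / ξ < (q : ℝ) ∧ (I q).card = ν)).card := by
    rw [sub_le_iff_le_add]
    simp only [hf]
    rw [← Nat.cast_add, Nat.cast_le]
    refine (Finset.card_le_card ?_).trans (Finset.card_union_le _ _)
    intro q hq
    simp only [Finset.mem_union, Finset.mem_filter, mem_primesUpTo] at hq ⊢
    rcases lt_or_ge (t / ξ) (q : ℝ) with hq' | hq'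
    · exact Or.inl ⟨hq.1, hq', hq.2⟩
    · exact Or.inr ⟨⟨hq.1.1, hq'⟩, hq.2⟩
  refine le_trans ?_ (h6.le.trans hcard)
  rw [div_le_iff₀ hκ0] at h9
  rw [div_le_iff₀ (by positivity)]
  calc t = t * 1 := (mul_one t).symm
    _ ≤ t * (Real.log t * κ) := by gcongr
    _ = κ * (t / Real.log t) * Real.log t ^ 2 := by field_simp

theorem mem_scalePrimes {I : (p : ℕ) → Finset (ZMod p)} {ξ δ x H : ℝ} {ν q : ℕ} :
    q ∈ scalePrimes I ξ δ x H ν ↔ q.Prime ∧ (q : ℝ) ≤ yParam δ x / H ∧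
      yParam δ x / (ξ * H) < q ∧ (I q).card = ν := by
  simp only [scalePrimes, Finset.mem_filter, mem_primesUpTo]
  tauto

theorem eventually_card_scalePrimes {I : (p : ℕ) → Finset (ZMod p)} {B : ℕ} {ρ : ℕ → ℝ}
    (hI : IsRegularSievingSystem I B ρ) {δ ξ : ℝ} (hδ : 0 < δ) (hδ' : δ < 1 / 2) (hξ : 1 < ξ) :
    ∀ᶠ x : ℝ in atTop, ∀ H ∈ scales ξ δ x, ∀ ν ∈ frequentSizes B ρ,
      yParam δ x / Real.log (yParam δ x) ^ 3 ≤ ((scalePrimes I ξ δ x H ν).card : ℝ) := by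
  have h₁ : ∀ᶠ t : ℝ in atTop, ∀ ν ∈ frequentSizes B ρ, t / Real.log t ^ 2 ≤
      ((primesUpTo t).filter (fun q : ℕ => t / ξ < (q : ℝ) ∧ (I q).card = ν)).card := by
    have : (frequentSizes B ρ).Finite :=
      (Set.finite_Icc 1 B).subset fun ν hν => ⟨hν.1, hν.2.1⟩
    rw [eventually_all_finite this]
    intro ν hν
    exact eventually_card_primes_Ioc hξ hν.2.2 (hI.density ν hν.1 hν.2.1)
  obtain ⟨t₀, ht₀⟩ := eventually_atTop.1 h₁
  have hy := tendsto_yParam hδ hδ'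
  filter_upwards [eventually_scales_bounds hδ hδ' hξ,
    hy.eventually (eventually_const_mul_log_rpow_le 1 (1 / 2) (a := 1 / 2) (by norm_num)),
    ((tendsto_rpow_atTop (show (0 : ℝ) < 1 / 2 by norm_num)).comp hy).eventually_ge_atTop
      (max t₀ 2), hy.eventually_gt_atTop 1,
    (tendsto_log_yParam hδ hδ').eventually_ge_atTop 1] with x h₂ h₃ h₄ h₅ h₆ H hH ν hν
  obtain ⟨h₇, h₈⟩ := h₂ H hH
  set y : ℝ := ((yParam δ x : ℕ) : ℝ) with hyd
  have hℓ : 0 < Real.log y := by linarith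
  have hH1 : 1 ≤ H := (Real.one_le_rpow h₆ hδ.le).trans h₇
  have hH0 : 0 < H := by linarith
  rw [one_mul] at h₃
  simp only [Function.comp] at h₄
  have hyr : 0 < y ^ (1 / 2 : ℝ) := Real.rpow_pos_of_pos (by linarith) _
  have hyy : y ^ (1 / 2 : ℝ) * y ^ (1 / 2 : ℝ) = y := by
    rw [← Real.rpow_add (by linarith)]; norm_num
  have ht : y ^ (1 / 2 : ℝ) ≤ y / H := by
    rw [le_div_iff₀ hH0]
    calc _ ≤ y ^ (1 / 2 : ℝ) * y ^ (1 / 2 : ℝ) :=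
          mul_le_mul_of_nonneg_left (h₈.trans h₃) hyr.le
      _ = y := hyy
  have h₉ := ht₀ (y / H) ((le_max_left _ _).trans (h₄.trans ht)) ν hν
  have ht2 : 2 ≤ y / H := (le_max_right _ _).trans (h₄.trans ht)
  have hlog : Real.log (y / H) ≤ Real.log y :=
    Real.log_le_log (by linarith) (div_le_self (by linarith) hH1)
  have hlog0 : 0 < Real.log (y / H) := Real.log_pos (by linarith)
  have e : scalePrimes I ξ δ x H ν =
      (primesUpTo (y / H)).filter (fun q : ℕ => y / H / ξ < (q : ℝ) ∧ (I q).card = ν) := by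
    rw [scalePrimes, div_div, mul_comm H ξ]
  rw [e]
  refine le_trans ?_ h₉
  rw [div_div]
  have hHℓ : H ≤ Real.log y := by
    refine h₈.trans ?_
    calc _ ≤ Real.log y ^ (1 : ℝ) := Real.rpow_le_rpow_of_exponent_le h₆ (by norm_num)
      _ = _ := Real.rpow_one _
  gcongr
  calc H * Real.log (y / H) ^ 2 ≤ Real.log y * Real.log y ^ 2 := by gcongr
    _ = _ := by ring

/-! ### Averaging errors that have exponential tails. -/

/-- Summation by the value `k` of `N`: the growth `exp (c * k / 2)` loses against the tail `exp (-c
* k)`, leaving a geometric series. -/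
theorem sum_exp_tail_le {X : Type} (G : Finset X) (N : X → ℕ) {c L : ℝ} (hc : 0 < c) (k₀ : ℕ)
    (hk₀ : 1 ≤ k₀)
    (htail : ∀ k : ℕ, 1 ≤ k → ((G.filter (fun x => k ≤ N x)).card : ℝ) ≤ L * Real.exp (-c * k)) :
    ∑ x ∈ G.filter (fun x => k₀ ≤ N x), Real.exp (c / 2 * N x) ≤
      L * (Real.exp (-c / 2) ^ k₀ / (1 - Real.exp (-c / 2))) := by
  classical
  set n := G.sup N with hn
  have hL : 0 ≤ L := by
    have h := (Nat.cast_nonneg _).trans (htail 1 le_rfl)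
    exact nonneg_of_mul_nonneg_left h (Real.exp_pos _)
  have hr1 : Real.exp (-c / 2) < 1 := by rw [Real.exp_lt_one_iff]; linarith
  calc ∑ x ∈ G.filter (fun x => k₀ ≤ N x), Real.exp (c / 2 * N x)
      ≤ ∑ x ∈ G.filter (fun x => k₀ ≤ N x), ∑ k ∈ Finset.Ico k₀ (n + 1),
          if k ≤ N x then (if N x = k then Real.exp (c / 2 * k) else 0) else 0 := by
        refine Finset.sum_le_sum fun x hx => ?_
        rw [Finset.mem_filter] at hx
        have hmem : N x ∈ Finset.Ico k₀ (n + 1) :=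
          Finset.mem_Ico.2 ⟨hx.2, Nat.lt_succ_of_le (Finset.le_sup hx.1)⟩
        refine le_trans ?_ (Finset.single_le_sum (fun k _ => ?_) hmem)
        · simp
        · split_ifs <;> positivity
    _ ≤ ∑ x ∈ G, ∑ k ∈ Finset.Ico k₀ (n + 1),
          if k ≤ N x then Real.exp (c / 2 * k) else 0 := by
        refine (Finset.sum_le_sum_of_subset_of_nonneg (Finset.filter_subset _ _)
          fun x _ _ => Finset.sum_nonneg fun k _ => ?_).trans
          (Finset.sum_le_sum fun x _ => Finset.sum_le_sum fun k _ => ?_)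
        · split_ifs <;> positivity
        · split_ifs <;> first | positivity | exact le_rfl
    _ = ∑ k ∈ Finset.Ico k₀ (n + 1), Real.exp (c / 2 * k) * (G.filter (fun x => k ≤ N x)).card := by
        rw [Finset.sum_comm]
        refine Finset.sum_congr rfl fun k _ => ?_
        rw [← Finset.sum_filter, Finset.sum_const, nsmul_eq_mul, mul_comm]
    _ ≤ ∑ k ∈ Finset.Ico k₀ (n + 1), L * Real.exp (-c / 2) ^ k := by
        refine Finset.sum_le_sum fun k hk => ?_
        have h1 := htail k (hk₀.trans (Finset.mem_Ico.1 hk).1)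
        calc _ ≤ Real.exp (c / 2 * k) * (L * Real.exp (-c * k)) := by gcongr
          _ = L * (Real.exp (c / 2 * k) * Real.exp (-c * k)) := by ring
          _ = _ := by
            rw [← Real.exp_add, ← Real.exp_nat_mul]
            congr 2; ring
    _ = L * ∑ k ∈ Finset.Ico k₀ (n + 1), Real.exp (-c / 2) ^ k := (Finset.mul_sum _ _ _).symm
    _ ≤ _ := by
        gcongr
        exact geom_sum_Ico_le_of_lt_one (Real.exp_nonneg _) hr1

/-- Three kinds of terms. If `N x < k₀`, the exponent is at most 1 and the error is linear in it; if
`N x ≥ k₀`, the error is at most `3 * exp (c / 2 * N x)` and `sum_exp_tail_le` applies; outside `G`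
only the crude bound `Y` is available, on a proportion `η` of the set. -/
theorem abs_sum_sub_le_of_tail {X : Type} {S G : Finset X} (hGS : G ⊆ S) {e : X → ℝ} {N : X → ℕ}
    {μ θ c L Y η : ℝ} {k₀ : ℕ} (hμ : 0 ≤ μ) (hc : 0 < c) (hk₀ : 1 ≤ k₀) (hθ0 : 0 ≤ θ)
    (hθc : θ ≤ c / 2) (hθ : θ * (1 + k₀) ≤ 1) (hY : 0 ≤ Y)
    (hgood : ∀ x ∈ G, |e x - μ| ≤ μ * (Real.exp (θ * (1 + N x)) - 1))
    (hbad : ∀ x ∈ S, x ∉ G → |e x - μ| ≤ μ * Y)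
    (hcard : (S.card : ℝ) - G.card ≤ S.card * η)
    (htail : ∀ k : ℕ, 1 ≤ k →
      ((G.filter (fun x => k ≤ N x)).card : ℝ) ≤ S.card * L * Real.exp (-c * k)) :
    |∑ x ∈ S, e x - S.card * μ| ≤ S.card * μ * (2 * (θ * (1 + k₀)) +
      3 * (L * (Real.exp (-c / 2) ^ k₀ / (1 - Real.exp (-c / 2)))) + η * Y) := by
  classical
  have hk0' : (0 : ℝ) ≤ k₀ := Nat.cast_nonneg _
  have hθ1 : θ ≤ 1 := by nlinarith
  have h₁ : |∑ x ∈ S, e x - S.card * μ| ≤ ∑ x ∈ S, |e x - μ| := by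
    have : (S.card : ℝ) * μ = ∑ x ∈ S, μ := by simp
    rw [this, ← Finset.sum_sub_distrib]
    exact Finset.abs_sum_le_sum_abs _ _
  have h₂ : ∑ x ∈ S \ G, |e x - μ| ≤ S.card * μ * (η * Y) := by
    calc _ ≤ ∑ x ∈ S \ G, μ * Y := Finset.sum_le_sum fun x hx =>
          hbad x (Finset.mem_sdiff.1 hx).1 (Finset.mem_sdiff.1 hx).2
      _ = ((S.card : ℝ) - G.card) * (μ * Y) := by
          rw [Finset.sum_const, nsmul_eq_mul, Finset.card_sdiff_of_subset hGS,
            Nat.cast_sub (Finset.card_le_card hGS)]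
      _ ≤ S.card * η * (μ * Y) := by gcongr
      _ = _ := by ring
  have h₃ : ∑ x ∈ G, |e x - μ| ≤ S.card * μ * (2 * (θ * (1 + k₀))) +
      μ * (3 * ∑ x ∈ G.filter (fun x => k₀ ≤ N x), Real.exp (c / 2 * N x)) := by
    rw [← Finset.sum_filter_add_sum_filter_not G (fun x => k₀ ≤ N x), add_comm]
    refine add_le_add ?_ ?_
    · calc _ ≤ ∑ x ∈ G.filter (fun x => ¬ k₀ ≤ N x), μ * (2 * (θ * (1 + k₀))) := by
            refine Finset.sum_le_sum fun x hx => ?_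
            rw [Finset.mem_filter, not_le] at hx
            refine (hgood x hx.1).trans ?_
            gcongr
            have h4 : (N x : ℝ) ≤ k₀ := by exact_mod_cast hx.2.le
            have h5 : θ * (1 + N x) ≤ θ * (1 + k₀) := by gcongr
            have h6 : 0 ≤ θ * (1 + (N x : ℝ)) := by positivity
            have h7 := Real.abs_exp_sub_one_le (x := θ * (1 + N x)) (by
              rw [abs_of_nonneg h6]; linarith)
            rw [abs_of_nonneg h6] at h7
            have := le_abs_self (Real.exp (θ * (1 + N x)) - 1)
            linarith
        _ = ((G.filter (fun x => ¬ k₀ ≤ N x)).card : ℝ) * (μ * (2 * (θ * (1 + k₀)))) := by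
            rw [Finset.sum_const, nsmul_eq_mul]
        _ ≤ S.card * (μ * (2 * (θ * (1 + k₀)))) := by
            gcongr
            exact (Finset.filter_subset _ _).trans hGS
        _ = _ := by ring
    · rw [Finset.mul_sum, Finset.mul_sum]
      refine Finset.sum_le_sum fun x hx => ?_
      rw [Finset.mem_filter] at hx
      refine (hgood x hx.1).trans ?_
      gcongr
      -- `θ ≤ 1` handles the constant part of the exponent and `θ ≤ c / 2` the part growing with
      -- `N`; then `e < 3`.
      have h8 : Real.exp (θ * (1 + N x)) ≤ Real.exp (1 + c / 2 * N x) := by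
        gcongr
        have : θ * N x ≤ c / 2 * N x := by gcongr
        linarith
      rw [Real.exp_add] at h8
      have h9 := Real.exp_one_lt_d9
      have h10 := Real.exp_pos (c / 2 * N x)
      nlinarith
  have h₄ := sum_exp_tail_le G N hc k₀ hk₀ htail
  have h₅ : μ * (3 * ∑ x ∈ G.filter (fun x => k₀ ≤ N x), Real.exp (c / 2 * N x)) ≤
      μ * (3 * (S.card * L * (Real.exp (-c / 2) ^ k₀ / (1 - Real.exp (-c / 2))))) := by gcongr
  rw [← Finset.sum_sdiff hGS (f := fun x => |e x - μ|)] at h₁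
  calc _ ≤ _ := h₁
    _ ≤ _ := add_le_add h₂ (h₃.trans (add_le_add le_rfl h₅))
    _ = _ := by ring

/-- The threshold `k₀` is a multiple of `log log y`. The tail beyond it is at most a negative power
of `log y`, and the terms below it contribute `k₀ * D / H ^ (M - 2)`, where `k₀ ≪ log H` since `H ≥
(log y) ^ δ`. The exceptional terms contribute `y ^ (-1 / 10 + 1 / 20)`. -/
theorem eventually_abs_sum_sub_le {δ ξ M : ℝ} (hδ : 0 < δ) (hδ' : δ < 1 / 2) (hξ : 1 < ξ)
    (hM : 2 < M) {c D A : ℝ} (hc : 0 < c) (hD : 0 ≤ D) (hA : 0 ≤ A) :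
    ∃ C : ℝ, 0 ≤ C ∧ ∀ᶠ x : ℝ in atTop, ∀ H ∈ scales ξ δ x,
      ∀ (X : Type) (S G : Finset X) (e : X → ℝ) (N : X → ℕ) (μ : ℝ), G ⊆ S → 0 ≤ μ →
        (∀ x ∈ G, |e x - μ| ≤ μ * (Real.exp (D / H ^ (M - 2) * (1 + N x)) - 1)) →
        (∀ a ∈ S, a ∉ G → |e a - μ| ≤ μ * (yParam δ x : ℝ) ^ (1 / 20 : ℝ)) →
        ((S.card : ℝ) - G.card ≤ S.card * (yParam δ x : ℝ) ^ (-1 / 10 : ℝ)) →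
        (∀ k : ℕ, 1 ≤ k → ((G.filter (fun x => k ≤ N x)).card : ℝ) ≤
          S.card * Real.log (yParam δ x) ^ A * Real.exp (-c * k)) →
        |∑ x ∈ S, e x - S.card * μ| ≤ C * (Real.log H / H ^ (M - 2)) * (S.card * μ) := by
  -- Chosen so that `exp (-c / 2 * k₀) ≤ ℓ ^ (-(A + M))`: this cancels the factor `ℓ ^ A` of the
  -- tail and leaves `ℓ ^ (-M)`.
  set C₂ : ℝ := 2 * (A + M) / c with hC₂
  have hC₂0 : 0 ≤ C₂ := by positivity
  set r : ℝ := Real.exp (-c / 2) with hr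
  have hr1 : r < 1 := by rw [hr, Real.exp_lt_one_iff]; linarith
  set E : ℝ := D * ((C₂ + 3) / δ) with hE
  have hE0 : 0 ≤ E := by positivity
  refine ⟨2 * E + 3 * (1 / (1 - r)) + 1, by have : 0 < 1 - r := by linarith
                                            positivity, ?_⟩
  have hlim₁ : ∀ᶠ t : ℝ in atTop, E * (Real.log t / t ^ (M - 2)) ≤ 1 := by
    filter_upwards [eventually_const_mul_log_rpow_le E 1 (a := M - 2) (by linarith),
      eventually_gt_atTop 0] with t ht ht0
    rw [Real.rpow_one] at ht
    rw [← mul_div_assoc, div_le_one (Real.rpow_pos_of_pos ht0 _)]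
    exact ht
  have hlim₂ : ∀ᶠ t : ℝ in atTop, D / t ^ (M - 2) ≤ c / 2 :=
    (tendsto_const_nhds.div_atTop (tendsto_rpow_atTop (by linarith))).eventually_le_const
      (by positivity)
  obtain ⟨t₀, ht₀⟩ := eventually_atTop.1 (hlim₁.and hlim₂)
  have hℓ := tendsto_log_yParam hδ hδ'
  filter_upwards [eventually_scales_bounds hδ hδ' hξ,
    ((tendsto_rpow_atTop hδ).comp hℓ).eventually_ge_atTop (max t₀ 3),
    hℓ.eventually_ge_atTop 3, (tendsto_yParam hδ hδ').eventually
      (eventually_const_mul_log_rpow_le 1 M (a := 1 / 20) (by norm_num)),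
    (tendsto_yParam hδ hδ').eventually_gt_atTop 1]
    with x h₁ h₂ h₃ h₄ h₅ H hH X S G e N μ hGS hμ hgood hbad hcard htail
  obtain ⟨h₆, h₇⟩ := h₁ H hH
  simp only [Function.comp] at h₂
  obtain ⟨h₈, h₉⟩ := ht₀ H ((le_max_left _ _).trans (h₂.trans h₆))
  have hH3 : 3 ≤ H := (le_max_right _ _).trans (h₂.trans h₆)
  have hH0 : 0 < H := by linarith
  set y : ℝ := ((yParam δ x : ℕ) : ℝ)
  set ℓ := Real.log y
  have hℓ0 : 0 < ℓ := by linarith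
  have hlog3 : ∀ t : ℝ, 3 ≤ t → 1 ≤ Real.log t := fun t ht => by
    rw [Real.le_log_iff_exp_le (by linarith)]
    linarith [Real.exp_one_lt_d9]
  have hlℓ := hlog3 ℓ h₃
  have hlH := hlog3 H hH3
  have hHpow : 0 < H ^ (M - 2) := Real.rpow_pos_of_pos hH0 _
  have hlogH : δ * Real.log ℓ ≤ Real.log H := by
    rw [← Real.log_rpow hℓ0]
    exact Real.log_le_log (Real.rpow_pos_of_pos hℓ0 _) h₆
  have hHℓ : H ≤ ℓ := by
    refine h₇.trans ?_
    calc _ ≤ ℓ ^ (1 : ℝ) := Real.rpow_le_rpow_of_exponent_le (by linarith) (by norm_num)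
      _ = _ := Real.rpow_one _
  -- The added 1 makes the threshold positive, as the tail bounds start at `k = 1`.
  set k₀ : ℕ := ⌈C₂ * Real.log ℓ⌉₊ + 1 with hk₀
  have hk₀u : (1 + k₀ : ℝ) ≤ (C₂ + 3) * Real.log ℓ := by
    have := Nat.ceil_lt_add_one (show 0 ≤ C₂ * Real.log ℓ by positivity)
    rw [hk₀]; push_cast
    nlinarith
  have hk₀l : C₂ * Real.log ℓ ≤ k₀ := by
    have := Nat.le_ceil (C₂ * Real.log ℓ)
    rw [hk₀]; push_cast
    linarith
  have hθ : D / H ^ (M - 2) * (1 + k₀) ≤ E * (Real.log H / H ^ (M - 2)) := by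
    have : (1 + k₀ : ℝ) ≤ (C₂ + 3) / δ * Real.log H := by
      calc _ ≤ (C₂ + 3) * Real.log ℓ := hk₀u
        _ = (C₂ + 3) / δ * (δ * Real.log ℓ) := by field_simp
        _ ≤ _ := by gcongr
    calc _ ≤ D / H ^ (M - 2) * ((C₂ + 3) / δ * Real.log H) := by gcongr
      _ = _ := by rw [hE]; ring
  have hmain := abs_sum_sub_le_of_tail (L := ℓ ^ A) hGS hμ hc (by omega) (by positivity) h₉
    (hθ.trans h₈) (Y := y ^ (1 / 20 : ℝ)) (by positivity) hgood hbad hcard htail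
  have hℓM : ℓ ^ (-M) ≤ Real.log H / H ^ (M - 2) := by
    rw [Real.rpow_neg hℓ0.le, ← one_div]
    gcongr
    calc H ^ (M - 2) ≤ H ^ M := Real.rpow_le_rpow_of_exponent_le (by linarith) (by linarith)
      _ ≤ ℓ ^ M := Real.rpow_le_rpow hH0.le hHℓ (by linarith)
  have htl : ℓ ^ A * (r ^ k₀ / (1 - r)) ≤ 1 / (1 - r) * (Real.log H / H ^ (M - 2)) := by
    have h10 : r ^ k₀ ≤ ℓ ^ (-(A + M)) := by
      rw [hr, ← Real.exp_nat_mul, Real.rpow_def_of_pos hℓ0]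
      refine Real.exp_le_exp.2 ?_
      have h11 : c / 2 * (C₂ * Real.log ℓ) = Real.log ℓ * (A + M) := by
        rw [hC₂]; field_simp
      have h12 : c / 2 * (C₂ * Real.log ℓ) ≤ c / 2 * k₀ := by gcongr
      linarith
    have h13 : 0 < 1 - r := by linarith
    calc _ ≤ ℓ ^ A * (ℓ ^ (-(A + M)) / (1 - r)) := by gcongr
      _ = 1 / (1 - r) * (ℓ ^ A * ℓ ^ (-(A + M))) := by ring
      _ = 1 / (1 - r) * ℓ ^ (-M) := by rw [← Real.rpow_add hℓ0]; ring_nf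
      _ ≤ _ := by gcongr
  have hyy : y ^ (-1 / 10 : ℝ) * y ^ (1 / 20 : ℝ) ≤ Real.log H / H ^ (M - 2) := by
    refine le_trans ?_ hℓM
    rw [one_mul] at h₄
    rw [← Real.rpow_add (by linarith), Real.rpow_neg hℓ0.le,
      show (-1 / 10 + 1 / 20 : ℝ) = -(1 / 20) by norm_num, Real.rpow_neg (by linarith)]
    exact inv_anti₀ (Real.rpow_pos_of_pos hℓ0 _) h₄
  refine hmain.trans ?_
  have hSμ : 0 ≤ S.card * μ := by positivity
  calc _ ≤ S.card * μ * (2 * (E * (Real.log H / H ^ (M - 2))) +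
        3 * (1 / (1 - r) * (Real.log H / H ^ (M - 2))) + Real.log H / H ^ (M - 2)) := by
        gcongr
    _ = _ := by ring

/-! ### Progressions and their weights. -/

section
variable {I : (p : ℕ) → Finset (ZMod p)}

theorem injOn_cast_Icc (q : ℕ) : Set.InjOn (fun a : ℤ => (a : ZMod q)) (Set.Icc 1 (q : ℤ)) := by
  intro a ha b hb hab
  rw [Set.mem_Icc] at ha hb
  have h := (ZMod.intCast_eq_intCast_iff_dvd_sub a b q).1 hab
  obtain ⟨k, hk⟩ := h
  have h1 : -1 < k := by nlinarith
  have h2 : k < 1 := by nlinarith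
  have : k = 0 := by omega
  subst this
  linarith

theorem card_residueReps (I : (p : ℕ) → Finset (ZMod p)) {q : ℕ} (hq : q.Prime) :
    (residueReps I q).card = (I q).card := by
  classical
  have : NeZero q := ⟨hq.ne_zero⟩
  have hinj : Set.InjOn (fun a : ℤ => (a : ZMod q)) (residueReps I q) :=
    (injOn_cast_Icc q).mono fun a ha => by
      have := (Finset.mem_filter.1 (Finset.mem_coe.1 ha)).1
      simpa using this
  rw [← Finset.card_image_of_injOn hinj]
  congr 1
  ext c
  simp only [Finset.mem_image, residueReps, Finset.mem_filter, Finset.mem_Icc]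
  constructor
  · rintro ⟨a, ⟨-, ha⟩, rfl⟩; exact ha
  · intro hc
    have hval := ZMod.val_lt c
    have hq0 : (0 : ℤ) < q := by exact_mod_cast hq.pos
    -- The representatives lie in `[1, q]`, so the zero class is represented by `q`.
    rcases Nat.eq_zero_or_pos c.val with h0 | h0
    · refine ⟨q, ⟨⟨by omega, le_rfl⟩, ?_⟩, ?_⟩
      · rw [ZMod.val_eq_zero] at h0
        simpa [h0] using hc
      · rw [ZMod.val_eq_zero] at h0
        simp [h0]
    · exact ⟨c.val, ⟨⟨by omega, by omega⟩, by simpa using hc⟩, by simp⟩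

/-- Part (ii) mentions no enumeration, but the counting of differences is organised by indices, so
one has to be chosen. -/
theorem exists_isEnumeration (I : (p : ℕ) → Finset (ZMod p)) : ∃ a, IsEnumeration I a := by
  have h : ∀ q : ℕ, ∃ f : ℕ → ℤ, q.Prime →
      Set.BijOn f (Set.Icc 1 (I q).card) (residueReps I q : Set ℤ) := by
    intro q
    by_cases hq : q.Prime
    · obtain ⟨f, hf⟩ := (Set.finite_Icc 1 (I q).card).exists_bijOn_of_encard_eq
        (t := (residueReps I q : Set ℤ)) (by
          rw [Set.encard_coe_eq_coe_finsetCard, card_residueReps I hq, ← Finset.coe_Icc,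
            Set.encard_coe_eq_coe_finsetCard, Nat.card_Icc]
          simp)
      exact ⟨f, fun _ => hf⟩
    · exact ⟨0, fun h => absurd h hq⟩
  choose f hf using h
  exact ⟨fun i q => f q i, fun q hq => hf q hq⟩

/-- The progressions `n + a + h q`, before sifting. -/
noncomputable def groundSet (I : (p : ℕ) → Finset (ZMod p)) (J : ℝ) (q : ℕ) (n : ℤ) : Finset ℤ :=
  (residueReps I q ×ˢ Finset.Icc 1 ⌊J⌋₊).image (fun ah : ℤ × ℕ => n + ah.1 + (ah.2 : ℤ) * q)

theorem card_groundSet_le (I : (p : ℕ) → Finset (ZMod p)) {q : ℕ} (hq : q.Prime) (J : ℝ) (n : ℤ) :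
    (groundSet I J q n).card ≤ (I q).card * ⌊J⌋₊ := by
  refine Finset.card_image_le.trans ?_
  rw [Finset.card_product, card_residueReps I hq, Nat.card_Icc, Nat.add_sub_cancel]

theorem mem_groundSet_iff {a : ℕ → ℕ → ℤ} (ha : IsEnumeration I a) {q : ℕ} (hq : q.Prime) {J : ℝ}
    {n v : ℤ} : v ∈ groundSet I J q n ↔ ∃ i ∈ Finset.Icc 1 (I q).card, ∃ h ∈ Finset.Icc 1 ⌊J⌋₊,
      v = n + a i q + (h : ℤ) * q := by
  simp only [groundSet, Finset.mem_image, Finset.mem_product, Prod.exists]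
  constructor
  · rintro ⟨r, h, ⟨hr, hh⟩, rfl⟩
    obtain ⟨i, hi, rfl⟩ := (ha q hq).surjOn hr
    exact ⟨i, Finset.mem_Icc.2 hi, h, hh, rfl⟩
  · rintro ⟨i, hi, h, hh, rfl⟩
    exact ⟨a i q, h, ⟨(ha q hq).mapsTo (Finset.mem_Icc.1 hi), hh⟩, rfl⟩

theorem apSet_eq_siftedPart (M H : ℝ) (b : ℤ) (J : ℝ) (q : ℕ) (n : ℤ) :
    apSet I M H b J q n = siftedPart I (H ^ M) (groundSet I J q n) b := rfl

theorem sieveDensity₂_eq (hI : ∀ p : ℕ, p.Prime → (I p).card ≤ p - 1) {M z H : ℝ}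
    (h : H ^ M ≤ z) : sieveDensity₂ I M z H = sieveDensityBetween I (H ^ M) z := by
  rw [sieveDensity₂, sieveDensity_eq_mul I h,
    mul_div_cancel_left₀ _ (sieveDensity_pos hI _).ne']

theorem sieveWeight_eq (hI : ∀ p : ℕ, p.Prime → (I p).card ≤ p - 1) {M K z H : ℝ}
    (h : H ^ M ≤ z) (b : ℤ) (q : ℕ) (n : ℤ) :
    sieveWeight I M K z b H q n =
      containWeight I (H ^ M) z (groundSet I (K * H) q n) b b := by
  classical
  rw [sieveWeight, containWeight, sieveDensity₂_eq hI h, apSet_eq_siftedPart]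
  by_cases hs : (siftedPart I (H ^ M) (groundSet I (K * H) q n) b : Set ℤ) ⊆
      shiftedSet I (H ^ M) z b
  · rw [if_pos hs, Set.indicator_of_mem (by exact hs)]; rfl
  · rw [if_neg hs, Set.indicator_of_notMem (by exact hs), zero_div]

theorem siftedPart_union (s : ℝ) (A₁ A₂ : Finset ℤ) (b : ℤ) :
    siftedPart I s (A₁ ∪ A₂) b = siftedPart I s A₁ b ∪ siftedPart I s A₂ b := by
  classical
  exact Finset.filter_union _ _ _

theorem indicator_union_subset (s t : ℝ) (A₁ A₂ : Finset ℤ) (b : ℤ) :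
    {c : ℤ | (siftedPart I s (A₁ ∪ A₂) b : Set ℤ) ⊆ shiftedSet I s t c}.indicator (1 : ℤ → ℝ) b =
      {c : ℤ | (siftedPart I s A₁ b : Set ℤ) ⊆ shiftedSet I s t c}.indicator 1 b *
        {c : ℤ | (siftedPart I s A₂ b : Set ℤ) ⊆ shiftedSet I s t c}.indicator 1 b := by
  rw [← Pi.mul_apply, ← Set.inter_indicator_one]
  refine indicator_one_congr ?_
  simp only [siftedPart_union, Set.mem_ofPred_eq, Set.mem_inter_iff, Finset.coe_union,
    Set.union_subset_iff]

theorem containWeight_mul_of_disjoint {s t : ℝ} {A₁ A₂ : Finset ℤ} (h : Disjoint A₁ A₂) (b : ℤ) :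
    containWeight I s t A₁ b b * containWeight I s t A₂ b b =
      containWeight I s t (A₁ ∪ A₂) b b := by
  have hd : Disjoint (siftedPart I s A₁ b) (siftedPart I s A₂ b) :=
    h.mono (siftedPart_subset _ _ _ _) (siftedPart_subset _ _ _ _)
  simp only [containWeight]
  rw [indicator_union_subset, siftedPart_union, Finset.card_union_of_disjoint hd, pow_add,
    div_mul_div_comm]

theorem mem_siftedPart {s : ℝ} {A : Finset ℤ} {n b : ℤ} :
    n ∈ siftedPart I s A b ↔ n ∈ A ∧ n ∈ shiftedSet I 0 s b := by
  classical
  exact Finset.mem_filter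

/-- If `n ∈ A` survives the small primes, it belongs to the sifted part, and the containment then
makes it survive the large primes. So membership in `S` may be replaced by membership in `S₁`, which
depends on the small primes only. -/
theorem indicator_mul_containWeight {s t : ℝ} (hs : 0 ≤ s) (hst : s ≤ t) {A : Finset ℤ} {n : ℤ}
    (hn : n ∈ A) (b : ℤ) :
    {b : ℤ | n ∈ shiftedSet I 0 t b}.indicator 1 b * containWeight I s t A b b =
      {b : ℤ | n ∈ shiftedSet I 0 s b}.indicator 1 b * containWeight I s t A b b := by
  simp only [containWeight]
  rw [← mul_div_assoc, ← mul_div_assoc]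
  congr 1
  rw [← Pi.mul_apply, ← Set.inter_indicator_one, ← Pi.mul_apply, ← Set.inter_indicator_one]
  refine indicator_one_congr ?_
  simp only [Set.mem_inter_iff, Set.mem_ofPred_eq, mem_shiftedSet_split hs hst]
  constructor
  · rintro ⟨⟨h₁, -⟩, h₂⟩; exact ⟨h₁, h₂⟩
  · rintro ⟨h₁, h₂⟩
    exact ⟨⟨h₁, h₂ (Finset.mem_coe.2 (mem_siftedPart.2 ⟨hn, h₁⟩))⟩, h₂⟩

/-- Inclusion–exclusion in the exponent: the common point is counted twice in the product and once
in the union, hence the extra factor. -/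
theorem indicator_mul_containWeight_mul {s t : ℝ} (hσ : 0 < sieveDensityBetween I s t)
    {A₁ A₂ : Finset ℤ} {n : ℤ} (hn : A₁ ∩ A₂ = {n}) (b : ℤ) :
    {b : ℤ | n ∈ shiftedSet I 0 s b}.indicator 1 b *
        (containWeight I s t A₁ b b * containWeight I s t A₂ b b) =
      {b : ℤ | n ∈ shiftedSet I 0 s b}.indicator 1 b * containWeight I s t (A₁ ∪ A₂) b b *
        (1 / sieveDensityBetween I s t) := by
  by_cases hb : n ∈ shiftedSet I 0 s b
  · rw [Set.indicator_of_mem (by exact hb)]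
    have hi : siftedPart I s A₁ b ∩ siftedPart I s A₂ b = {n} := by
      ext v
      have := Finset.ext_iff.1 hn v
      simp only [Finset.mem_inter, Finset.mem_singleton, mem_siftedPart] at this ⊢
      constructor
      · rintro ⟨⟨h₁, -⟩, h₂, -⟩; exact this.1 ⟨h₁, h₂⟩
      · rintro rfl
        exact ⟨⟨(this.2 rfl).1, hb⟩, (this.2 rfl).2, hb⟩
    have hc := Finset.card_union_add_card_inter (siftedPart I s A₁ b) (siftedPart I s A₂ b)
    rw [hi, Finset.card_singleton] at hc
    simp only [containWeight, Pi.one_apply, one_mul]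
    rw [indicator_union_subset, siftedPart_union, div_mul_div_comm, ← pow_add, ← hc, pow_succ]
    field_simp
  · rw [Set.indicator_of_notMem (by exact hb)]; simp

theorem containWeight_nonneg {s t : ℝ} (hσ : 0 < sieveDensityBetween I s t) (A : Finset ℤ)
    (b c : ℤ) : 0 ≤ containWeight I s t A b c :=
  div_nonneg (indicator_one_nonneg _ _) (pow_nonneg hσ.le _)

/-- The trivial bound: each element costs at most one factor of the inverse density. It serves the
exceptional pairs. -/
theorem containWeight_le {s t : ℝ} (hσ : 0 < sieveDensityBetween I s t)
    (hσ' : sieveDensityBetween I s t ≤ 1) {A : Finset ℤ} {k : ℕ} (hA : A.card ≤ k)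
    (b c : ℤ) : containWeight I s t A b c ≤ (1 / sieveDensityBetween I s t) ^ k := by
  have h₁ : (siftedPart I s A b).card ≤ k :=
    (Finset.card_le_card (siftedPart_subset _ _ _ _)).trans hA
  have h₂ : 1 ≤ 1 / sieveDensityBetween I s t := by rw [le_div_iff₀ hσ]; linarith
  calc containWeight I s t A b c ≤ 1 / sieveDensityBetween I s t ^ (siftedPart I s A b).card := by
        rw [containWeight]
        gcongr
        exact Set.indicator_le_self' (by simp) _
    _ = (1 / sieveDensityBetween I s t) ^ (siftedPart I s A b).card := by
        rw [div_pow, one_pow]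
    _ ≤ _ := pow_le_pow_right₀ h₂ h₁

end

/-! ### Expectations of weights at a good scale. -/

/-- Inequalities between the parameters that hold for large `x` and `H ∈ scales ξ δ x`. -/
structure GoodScale (I : (p : ℕ) → Finset (ZMod p)) (B : ℕ) (M K : ℝ) (y : ℕ) (z H : ℝ) :
    Prop where
  one_le : 1 ≤ H
  rpow_le : H ^ M ≤ z
  two_mul_le : 2 * (B : ℝ) ≤ H ^ M
  four_mul_le : 4 * ((B : ℝ) * (K * H)) * B ≤ H ^ M
  inv_pow_le : Real.log y ^ 2 * (1 / sieveDensityBetween I (H ^ M) z) ^ (2 * (B * ⌊K * H⌋₊)) + 1 ≤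
    (y : ℝ) ^ (1 / 20 : ℝ)
  le_sieveDensity : 1 / Real.log y ^ 2 ≤ sieveDensity I z

/-- Since `H ≤ ℓ ^ (1 / 2)` with `ℓ = log y`, and the inverse density is at most `ℓ ^ 2`, its power
with exponent `O(H)` is `exp (O(ℓ ^ (1 / 2) * log ℓ))`, below any power of `y`. The linear
conditions on `H` hold because `H` tends to infinity and `M > 2`. -/
theorem eventually_goodScale {I : (p : ℕ) → Finset (ZMod p)} {B : ℕ} {ρ : ℕ → ℝ}
    (hI : IsRegularSievingSystem I B ρ) {δ ξ M K : ℝ} (hδ : 0 < δ) (hδ' : δ < 1 / 2) (hξ : 1 < ξ)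
    (hM : 2 < M) (hK : 0 < K) :
    ∀ᶠ x : ℝ in atTop, ∀ H ∈ scales ξ δ x,
      GoodScale I B M K (yParam δ x) (zParam δ x) H := by
  have hB0 : (0 : ℝ) ≤ B := Nat.cast_nonneg _
  have hℓ := tendsto_log_yParam hδ hδ'
  have hy := tendsto_yParam hδ hδ'
  filter_upwards [eventually_scales_bounds hδ hδ' hξ, eventually_zParam_bounds hδ hδ',
    eventually_sieveDensity_zParam hI hδ hδ',
    hy.eventually (eventually_const_mul_log_rpow_le 1 M (a := 1 / 2) (by norm_num)),
    ((tendsto_rpow_atTop hδ).comp hℓ).eventually_ge_atTop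
      (max 1 (max (2 * B) (4 * (B * K) * B))),
    hℓ.eventually_ge_atTop 1, hy.eventually_ge_atTop 1,
    hℓ.eventually (eventually_const_mul_log_rpow_le (40 * (4 * B * K + 2)) 1
      (a := 1 / 2) (by norm_num)),
    ((tendsto_rpow_atTop (show (0 : ℝ) < 1 / 40 by norm_num)).comp hy).eventually_ge_atTop 2]
    with x h₁ h₂ h₃ h₄ h₅ h₆ h₇ h₈ h₉ H hH
  obtain ⟨hl, hu⟩ := h₁ H hH
  set z := zParam δ x
  set y := yParam δ x
  set ℓ := Real.log y with hℓd
  simp only [Function.comp] at h₅ h₉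
  have h₅' := h₅.trans hl
  have hH1 : 1 ≤ H := (le_max_left _ _).trans h₅'
  have hH2 : 2 * (B : ℝ) ≤ H := (le_max_left _ _).trans ((le_max_right _ _).trans h₅')
  have hH3 : 4 * (B * K) * (B : ℝ) ≤ H := (le_max_right _ _).trans ((le_max_right _ _).trans h₅')
  have hH0 : 0 < H := by linarith
  have hℓ0 : 0 < ℓ := by linarith
  have hy0 : (0 : ℝ) < y := by linarith
  have hpow1 : H ≤ H ^ M := by
    calc H = H ^ (1 : ℝ) := (Real.rpow_one H).symm
      _ ≤ _ := Real.rpow_le_rpow_of_exponent_le hH1 (by linarith)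
  have hpow2 : H * H ≤ H ^ M := by
    calc H * H = H ^ (2 : ℝ) := by rw [Real.rpow_two]; ring
      _ ≤ _ := Real.rpow_le_rpow_of_exponent_le hH1 hM.le
  have hHℓ : H ≤ ℓ := by
    refine hu.trans ?_
    calc _ ≤ ℓ ^ (1 : ℝ) := Real.rpow_le_rpow_of_exponent_le h₆ (by norm_num)
      _ = _ := Real.rpow_one _
  have hHz : H ^ M ≤ z := by
    rw [one_mul] at h₄
    exact ((Real.rpow_le_rpow hH0.le hHℓ (by linarith)).trans h₄).trans h₂.1
  have hb := sieveDensityBetween_pos hI.card_le_pred (H ^ M) z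
  have hb' : 1 / sieveDensityBetween I (H ^ M) z ≤ ℓ ^ 2 := by
    have e := sieveDensity_eq_mul I hHz
    have h7 := sieveDensity_le_one hI.card_le_pred (H ^ M)
    have h8 := sieveDensity_pos hI.card_le_pred (H ^ M)
    have h9 : sieveDensity I z ≤ sieveDensityBetween I (H ^ M) z := by rw [e]; nlinarith
    rw [div_le_iff₀ (by positivity)] at h₃
    rw [div_le_iff₀ hb]
    nlinarith [sq_nonneg ℓ]
  refine ⟨hH1, hHz, hH2.trans hpow1, ?_, ?_, h₃⟩
  · calc 4 * ((B : ℝ) * (K * H)) * B = 4 * (B * K) * B * H := by ring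
      _ ≤ H * H := by gcongr
      _ ≤ _ := hpow2
  · have h10 : ℓ ^ 2 * (1 / sieveDensityBetween I (H ^ M) z) ^ (2 * (B * ⌊K * H⌋₊)) ≤
        (y : ℝ) ^ (1 / 40 : ℝ) := by
      calc _ ≤ ℓ ^ 2 * (ℓ ^ 2) ^ (2 * (B * ⌊K * H⌋₊)) := by gcongr
        _ = ℓ ^ (4 * (B * ⌊K * H⌋₊) + 2) := by
            rw [← pow_mul, ← pow_add]; congr 1; ring
        _ = Real.exp (Real.log ℓ * ((4 * (B * ⌊K * H⌋₊) + 2 : ℕ) : ℝ)) := by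
            rw [← Real.rpow_natCast, Real.rpow_def_of_pos hℓ0]
        _ ≤ Real.exp (ℓ * (1 / 40)) := by
            refine Real.exp_le_exp.2 ?_
            have hfl : (⌊K * H⌋₊ : ℝ) ≤ K * H := Nat.floor_le (by positivity)
            have hlog0 : 0 ≤ Real.log ℓ := Real.log_nonneg h₆
            rw [Real.rpow_one] at h₈
            push_cast
            have h1r : 1 ≤ ℓ ^ (1 / 2 : ℝ) := Real.one_le_rpow h₆ (by norm_num)
            have h11 : 4 * ((B : ℝ) * ⌊K * H⌋₊) + 2 ≤ (4 * B * K + 2) * ℓ ^ (1 / 2 : ℝ) := by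
              calc _ ≤ 4 * ((B : ℝ) * (K * ℓ ^ (1 / 2 : ℝ))) + 2 * ℓ ^ (1 / 2 : ℝ) := by
                    have h12 : (⌊K * H⌋₊ : ℝ) ≤ K * ℓ ^ (1 / 2 : ℝ) := hfl.trans (by gcongr)
                    have h13 : (B : ℝ) * ⌊K * H⌋₊ ≤ B * (K * ℓ ^ (1 / 2 : ℝ)) := by gcongr
                    linarith
                _ = _ := by ring
            have hrr : ℓ ^ (1 / 2 : ℝ) * ℓ ^ (1 / 2 : ℝ) = ℓ := by
              rw [← Real.rpow_add hℓ0]; norm_num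
            calc Real.log ℓ * (4 * ((B : ℝ) * ⌊K * H⌋₊) + 2)
                ≤ Real.log ℓ * ((4 * B * K + 2) * ℓ ^ (1 / 2 : ℝ)) := by gcongr
              _ = (40 * (4 * B * K + 2) * Real.log ℓ) * ℓ ^ (1 / 2 : ℝ) * (1 / 40) := by ring
              _ ≤ ℓ ^ (1 / 2 : ℝ) * ℓ ^ (1 / 2 : ℝ) * (1 / 40) := by gcongr
              _ = _ := by rw [hrr]
        _ = _ := by rw [Real.rpow_def_of_pos hy0]
    -- Half of the exponent is kept for the additional 1: `t + 1 ≤ t * t` for `t = y ^ (1 / 40) ≥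
    -- 2`.
    have hsq : (y : ℝ) ^ (1 / 40 : ℝ) * (y : ℝ) ^ (1 / 40 : ℝ) = (y : ℝ) ^ (1 / 20 : ℝ) := by
      rw [← Real.rpow_add hy0]; norm_num
    nlinarith

namespace IsRegularSievingSystem

variable {I : (p : ℕ) → Finset (ZMod p)} {B : ℕ} {ρ : ℕ → ℝ}

theorem diffPrimes_finite (hI : IsRegularSievingSystem I B ρ) {v : ℤ} (hv : v ≠ 0) :
    (diffPrimes I v).Finite := by
  obtain ⟨C, hC⟩ := hI.diff_bound
  rcases lt_or_gt_of_ne hv with h | h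
  · rw [← diffPrimes_neg]; exact (hC (-v) (by omega)).1
  · exact (hC v (by omega)).1

variable {M K : ℝ} {y : ℕ} {z H : ℝ}

/-- A union of two progressions has at most `2 * B * K * H` elements; its square over `H ^ M`
produces `H ^ (2 - M)`, and `4 * B ^ 2` dominates both coefficients. -/
theorem densityError_le_of_goodScale (hI : IsRegularSievingSystem I B ρ) (hK : 0 < K)
    (hg : GoodScale I B M K y z H) {A : Finset ℤ} (hA : A.card ≤ 2 * (B * ⌊K * H⌋₊)) :
    densityError I B (H ^ M) z A ≤
      16 * (B : ℝ) ^ 4 * K ^ 2 / H ^ (M - 2) * (1 + maxDiffCount I A) := by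
  have hH0 : 0 < H := by linarith [hg.one_le]
  have hHM : 0 < H ^ M := Real.rpow_pos_of_pos hH0 _
  refine (densityError_le hHM fun v hv => hI.diffPrimes_finite hv).trans ?_
  have hfl : (⌊K * H⌋₊ : ℝ) ≤ K * H := Nat.floor_le (by positivity)
  have hA' : (A.card : ℝ) ≤ 2 * (B * (K * H)) := by
    calc (A.card : ℝ) ≤ ((2 * (B * ⌊K * H⌋₊) : ℕ) : ℝ) := by exact_mod_cast hA
      _ ≤ _ := by push_cast; gcongr
  have hB : (B : ℝ) ≤ 4 * (B : ℝ) ^ 2 := by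
    have : B ≤ 4 * B ^ 2 := by nlinarith
    exact_mod_cast this
  have hN : (0 : ℝ) ≤ maxDiffCount I A := Nat.cast_nonneg _
  calc (A.card : ℝ) ^ 2 / H ^ M * (4 * (B : ℝ) ^ 2 + B * maxDiffCount I A)
      ≤ (2 * (B * (K * H))) ^ 2 / H ^ M * (4 * (B : ℝ) ^ 2 + 4 * (B : ℝ) ^ 2 * maxDiffCount I A) := by
        gcongr
    _ = _ := by
        rw [Real.rpow_sub hH0, Real.rpow_two]
        field_simp
        ring

theorem residueExpectation_containWeight_of_goodScale (hI : IsRegularSievingSystem I B ρ)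
    (hK : 0 < K) (hg : GoodScale I B M K y z H) {A : Finset ℤ}
    (hA : A.card ≤ 2 * (B * ⌊K * H⌋₊)) {R : ℤ → ℝ} (hR : ∀ b, 0 ≤ R b)
    (hRp : ∀ b b' : ℤ, (primeProd (H ^ M) : ℤ) ∣ b - b' → R b = R b') :
    |residueExpectation (primeProd z) (fun b => R b * containWeight I (H ^ M) z A b b) -
        residueExpectation (primeProd (H ^ M)) R| ≤
      residueExpectation (primeProd (H ^ M)) R *
        (Real.exp (16 * (B : ℝ) ^ 4 * K ^ 2 / H ^ (M - 2) * (1 + maxDiffCount I A)) - 1) := by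
  have hH0 : 0 < H := by linarith [hg.one_le]
  have hfl : (⌊K * H⌋₊ : ℝ) ≤ K * H := Nat.floor_le (by positivity)
  have hA' : (A.card : ℝ) ≤ 2 * (B * (K * H)) := by
    calc (A.card : ℝ) ≤ ((2 * (B * ⌊K * H⌋₊) : ℕ) : ℝ) := by exact_mod_cast hA
      _ ≤ _ := by push_cast; gcongr
  have h₂ : 2 * ((A.card : ℝ) * B) ≤ H ^ M := by
    refine le_trans ?_ hg.four_mul_le
    calc 2 * ((A.card : ℝ) * B) ≤ 2 * (2 * (B * (K * H)) * B) := by gcongr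
      _ = _ := by ring
  refine (abs_residueExpectation_containWeight_sub_le hI.card_le
    (sieveDensityBetween_pos hI.card_le_pred _ _) hg.rpow_le hg.two_mul_le h₂ hR hRp).trans ?_
  rw [mul_comm]
  have := hI.densityError_le_of_goodScale hK hg hA
  have h0 := residueExpectation_nonneg (primeProd (H ^ M)) hR
  gcongr

theorem sieveWeight_expectation (hI : IsRegularSievingSystem I B ρ) (hK : 0 < K)
    (hg : GoodScale I B M K y z H) {q : ℕ} (hq : q.Prime) (n : ℤ) :
    |residueExpectation (primeProd z) (fun b => sieveWeight I M K z b H q n) - 1| ≤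
      1 * (Real.exp (16 * (B : ℝ) ^ 4 * K ^ 2 / H ^ (M - 2) *
        (1 + maxDiffCount I (groundSet I (K * H) q n))) - 1) := by
  have hc : (groundSet I (K * H) q n).card ≤ 2 * (B * ⌊K * H⌋₊) := by
    have h1 := card_groundSet_le I hq (K * H) n
    have h2 := Nat.mul_le_mul_right ⌊K * H⌋₊ (hI.card_le q hq)
    omega
  have h := hI.residueExpectation_containWeight_of_goodScale hK hg hc (R := fun _ => 1)
    (fun _ => zero_le_one) (fun _ _ _ => rfl)
  simp only [residueExpectation_const (primeProd_pos _), one_mul] at h ⊢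
  simpa only [sieveWeight_eq hI.card_le_pred hg.rpow_le] using h

theorem card_groundSet_union_le (hI : IsRegularSievingSystem I B ρ) {q₁ q₂ : ℕ} (hq₁ : q₁.Prime)
    (hq₂ : q₂.Prime) (J : ℝ) (n₁ n₂ : ℤ) :
    (groundSet I J q₁ n₁ ∪ groundSet I J q₂ n₂).card ≤ 2 * (B * ⌊J⌋₊) := by
  have h1 := card_groundSet_le I hq₁ J n₁
  have h2 := Nat.mul_le_mul_right ⌊J⌋₊ (hI.card_le q₁ hq₁)
  have h3 := card_groundSet_le I hq₂ J n₂
  have h4 := Nat.mul_le_mul_right ⌊J⌋₊ (hI.card_le q₂ hq₂)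
  have h5 := Finset.card_union_le (groundSet I J q₁ n₁) (groundSet I J q₂ n₂)
  omega

theorem sieveWeight_mul_expectation (hI : IsRegularSievingSystem I B ρ) (hK : 0 < K)
    (hg : GoodScale I B M K y z H) {q₁ q₂ : ℕ} (hq₁ : q₁.Prime) (hq₂ : q₂.Prime) {n₁ n₂ : ℤ}
    (hd : Disjoint (groundSet I (K * H) q₁ n₁) (groundSet I (K * H) q₂ n₂)) :
    |residueExpectation (primeProd z)
        (fun b => sieveWeight I M K z b H q₁ n₁ * sieveWeight I M K z b H q₂ n₂) - 1| ≤
      1 * (Real.exp (16 * (B : ℝ) ^ 4 * K ^ 2 / H ^ (M - 2) *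
        (1 + maxDiffCount I (groundSet I (K * H) q₁ n₁ ∪ groundSet I (K * H) q₂ n₂))) - 1) := by
  have h := hI.residueExpectation_containWeight_of_goodScale hK hg
    (hI.card_groundSet_union_le hq₁ hq₂ (K * H) n₁ n₂) (R := fun _ => 1)
    (fun _ => zero_le_one) (fun _ _ _ => rfl)
  simp only [residueExpectation_const (primeProd_pos _), one_mul] at h ⊢
  simpa only [sieveWeight_eq hI.card_le_pred hg.rpow_le,
    containWeight_mul_of_disjoint hd] using h

theorem indicator_shiftedSet_periodic (s : ℝ) (n b b' : ℤ) (h : (primeProd s : ℤ) ∣ b - b') :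
    {b : ℤ | n ∈ shiftedSet I 0 s b}.indicator (1 : ℤ → ℝ) b =
      {b : ℤ | n ∈ shiftedSet I 0 s b}.indicator 1 b' := by
  rw [← primeProdBetween_zero] at h
  exact indicator_one_congr (mem_shiftedSet_congr h)

theorem indicator_sieveWeight_expectation (hI : IsRegularSievingSystem I B ρ) (hK : 0 < K)
    (hg : GoodScale I B M K y z H) {q : ℕ} (hq : q.Prime) {n n' : ℤ}
    (hn : n ∈ groundSet I (K * H) q n') :
    |residueExpectation (primeProd z) (fun b => {b : ℤ | n ∈ shiftedSet I 0 z b}.indicator 1 b *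
        sieveWeight I M K z b H q n') - sieveDensity I (H ^ M)| ≤
      sieveDensity I (H ^ M) * (Real.exp (16 * (B : ℝ) ^ 4 * K ^ 2 / H ^ (M - 2) *
        (1 + maxDiffCount I (groundSet I (K * H) q n'))) - 1) := by
  have hH0 : 0 < H := by linarith [hg.one_le]
  have hc : (groundSet I (K * H) q n').card ≤ 2 * (B * ⌊K * H⌋₊) := by
    have h1 := card_groundSet_le I hq (K * H) n'
    have h2 := Nat.mul_le_mul_right ⌊K * H⌋₊ (hI.card_le q hq)
    omega
  have h := hI.residueExpectation_containWeight_of_goodScale hK hg hc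
    (fun b => indicator_one_nonneg {b : ℤ | n ∈ shiftedSet I 0 (H ^ M) b} b)
    (indicator_shiftedSet_periodic _ n)
  rw [residueExpectation_mem_shiftedSet] at h
  simpa only [sieveWeight_eq hI.card_le_pred hg.rpow_le, indicator_mul_containWeight
    (Real.rpow_nonneg hH0.le M) hg.rpow_le hn] using h

/-- The shared point `n` must survive the small primes, which gives `sieveDensity I (H ^ M)`; being
counted in both weights, it also gives one surplus inverse density of the large primes. -/
theorem indicator_sieveWeight_mul_expectation (hI : IsRegularSievingSystem I B ρ) (hK : 0 < K)
    (hg : GoodScale I B M K y z H) {q₁ q₂ : ℕ} (hq₁ : q₁.Prime) (hq₂ : q₂.Prime) {n n₁ n₂ : ℤ}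
    (hd : groundSet I (K * H) q₁ n₁ ∩ groundSet I (K * H) q₂ n₂ = {n}) :
    |residueExpectation (primeProd z) (fun b => {b : ℤ | n ∈ shiftedSet I 0 z b}.indicator 1 b *
        (sieveWeight I M K z b H q₁ n₁ * sieveWeight I M K z b H q₂ n₂)) -
        sieveDensity I (H ^ M) * (1 / sieveDensityBetween I (H ^ M) z)| ≤
      sieveDensity I (H ^ M) * (1 / sieveDensityBetween I (H ^ M) z) *
        (Real.exp (16 * (B : ℝ) ^ 4 * K ^ 2 / H ^ (M - 2) *
        (1 + maxDiffCount I (groundSet I (K * H) q₁ n₁ ∪ groundSet I (K * H) q₂ n₂))) - 1) := by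
  have hH0 : 0 < H := by linarith [hg.one_le]
  have hσ := sieveDensityBetween_pos hI.card_le_pred (H ^ M) z
  have h := hI.residueExpectation_containWeight_of_goodScale hK hg
    (hI.card_groundSet_union_le hq₁ hq₂ (K * H) n₁ n₂)
    (fun b => indicator_one_nonneg {b : ℤ | n ∈ shiftedSet I 0 (H ^ M) b} b)
    (indicator_shiftedSet_periodic _ n)
  rw [residueExpectation_mem_shiftedSet] at h
  have hn : n ∈ groundSet I (K * H) q₁ n₁ := by
    have := Finset.mem_singleton_self n
    rw [← hd] at this
    exact (Finset.mem_inter.1 this).1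
  have e : ∀ b : ℤ, {b : ℤ | n ∈ shiftedSet I 0 z b}.indicator 1 b *
        (sieveWeight I M K z b H q₁ n₁ * sieveWeight I M K z b H q₂ n₂) =
      {b : ℤ | n ∈ shiftedSet I 0 (H ^ M) b}.indicator 1 b * containWeight I (H ^ M) z
        (groundSet I (K * H) q₁ n₁ ∪ groundSet I (K * H) q₂ n₂) b b *
        (1 / sieveDensityBetween I (H ^ M) z) := by
    intro b
    rw [← indicator_mul_containWeight_mul hσ hd, ← mul_assoc, ← mul_assoc,
      sieveWeight_eq hI.card_le_pred hg.rpow_le, sieveWeight_eq hI.card_le_pred hg.rpow_le,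
      indicator_mul_containWeight (Real.rpow_nonneg hH0.le M) hg.rpow_le hn]
  simp_rw [e]
  rw [residueExpectation_mul_const, ← sub_mul, abs_mul, abs_of_pos (one_div_pos.2 hσ),
    mul_right_comm]
  gcongr

theorem sieveWeight_mul_expectation_trivial (hI : IsRegularSievingSystem I B ρ)
    (hg : GoodScale I B M K y z H) {q₁ q₂ : ℕ} (hq₁ : q₁.Prime) (hq₂ : q₂.Prime) (n₁ n₂ : ℤ)
    {R : ℤ → ℝ} (hR : ∀ b, 0 ≤ R b) (hR' : ∀ b, R b ≤ 1) :
    0 ≤ residueExpectation (primeProd z) (fun b => R b *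
        (sieveWeight I M K z b H q₁ n₁ * sieveWeight I M K z b H q₂ n₂)) ∧
      residueExpectation (primeProd z) (fun b => R b *
        (sieveWeight I M K z b H q₁ n₁ * sieveWeight I M K z b H q₂ n₂)) ≤
      (1 / sieveDensityBetween I (H ^ M) z) ^ (2 * (B * ⌊K * H⌋₊)) := by
  have hσ := sieveDensityBetween_pos hI.card_le_pred (H ^ M) z
  have hσ' := sieveDensityBetween_le_one hI.card_le_pred (H ^ M) z
  have hc : ∀ {q : ℕ} (_ : q.Prime) (n : ℤ), (groundSet I (K * H) q n).card ≤ B * ⌊K * H⌋₊ :=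
    fun {q} hq n => (card_groundSet_le I hq (K * H) n).trans
      (Nat.mul_le_mul_right ⌊K * H⌋₊ (hI.card_le q hq))
  simp only [sieveWeight_eq hI.card_le_pred hg.rpow_le]
  refine ⟨residueExpectation_nonneg _ fun b => mul_nonneg (hR b)
    (mul_nonneg (containWeight_nonneg hσ _ _ _) (containWeight_nonneg hσ _ _ _)), ?_⟩
  rw [← residueExpectation_const (primeProd_pos z)
    ((1 / sieveDensityBetween I (H ^ M) z) ^ (2 * (B * ⌊K * H⌋₊)))]
  refine residueExpectation_mono _ fun b => ?_
  have h₁ := containWeight_le hσ hσ' (hc hq₁ n₁) b b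
  have h₂ := containWeight_le hσ hσ' (hc hq₂ n₂) b b
  have h₃ := containWeight_nonneg hσ (groundSet I (K * H) q₁ n₁) b b
  have h₄ := containWeight_nonneg hσ (groundSet I (K * H) q₂ n₂) b b
  calc _ ≤ 1 * ((1 / sieveDensityBetween I (H ^ M) z) ^ (B * ⌊K * H⌋₊) *
        (1 / sieveDensityBetween I (H ^ M) z) ^ (B * ⌊K * H⌋₊)) := by
        have := hR b
        have := hR' b
        gcongr
    _ = _ := by rw [one_mul, ← pow_add]; congr 1; ring

end IsRegularSievingSystem

/-! ### Counting primes for which the differences have many collision primes. -/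

/-- The difference of the elements of `a i q + hq` and `a i' q + h'q`, where `t = h - h'`. -/
def shiftDiff (a : ℕ → ℕ → ℤ) (i i' : ℕ) (t : ℤ) (q : ℕ) : ℤ := a i q - a i' q + t * q

section
variable {I : (p : ℕ) → Finset (ZMod p)} {a : ℕ → ℕ → ℤ}

theorem IsEnumeration.bounds (ha : IsEnumeration I a) {q : ℕ} (hq : q.Prime) {i : ℕ}
    (hi : i ∈ Finset.Icc 1 (I q).card) : 1 ≤ a i q ∧ a i q ≤ q ∧ (a i q : ZMod q) ∈ I q := by
  have h := (ha q hq).mapsTo (Finset.mem_Icc.1 hi)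
  have h' := Finset.mem_filter.1 (Finset.mem_coe.1 h)
  exact ⟨(Finset.mem_Icc.1 h'.1).1, (Finset.mem_Icc.1 h'.1).2, h'.2⟩

theorem IsEnumeration.shiftDiff_mem (ha : IsEnumeration I a) {q : ℕ} (hq : q.Prime) {i i' : ℕ}
    (hi : i ∈ Finset.Icc 1 (I q).card) (hi' : i' ∈ Finset.Icc 1 (I q).card) (t : ℤ) :
    q ∈ diffPrimes I (shiftDiff a i i' t q) :=
  ⟨hq, _, (ha.bounds hq hi).2.2, _, (ha.bounds hq hi').2.2, by simp [shiftDiff]⟩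

/-- Two representatives in `[1, q]` differ by less than `q`, so the difference can vanish only for
`t = 0`, and then injectivity of the enumeration forces `i = i'`. -/
theorem IsEnumeration.shiftDiff_ne_zero (ha : IsEnumeration I a) {q : ℕ} (hq : q.Prime) {i i' : ℕ}
    (hi : i ∈ Finset.Icc 1 (I q).card) (hi' : i' ∈ Finset.Icc 1 (I q).card) {t : ℤ}
    (h : i ≠ i' ∨ t ≠ 0) : shiftDiff a i i' t q ≠ 0 := by
  intro h0
  obtain ⟨h₁, h₂, -⟩ := ha.bounds hq hi
  obtain ⟨h₃, h₄, -⟩ := ha.bounds hq hi'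
  rw [shiftDiff] at h0
  have h5 : -1 < t := by nlinarith
  have h6 : t < 1 := by nlinarith
  have ht : t = 0 := by omega
  subst ht
  have h7 : a i q = a i' q := by linarith
  have h8 : i = i' := (ha q hq).injOn (Finset.mem_Icc.1 hi) (Finset.mem_Icc.1 hi') h7
  simp [h8] at h

theorem IsEnumeration.abs_shiftDiff_le (ha : IsEnumeration I a) {q : ℕ} (hq : q.Prime) {i i' : ℕ}
    (hi : i ∈ Finset.Icc 1 (I q).card) (hi' : i' ∈ Finset.Icc 1 (I q).card) (t : ℤ) :
    |(shiftDiff a i i' t q : ℝ)| ≤ (1 + |(t : ℝ)|) * q := by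
  obtain ⟨h₁, h₂, -⟩ := ha.bounds hq hi
  obtain ⟨h₃, h₄, -⟩ := ha.bounds hq hi'
  have h5 : |((a i q - a i' q : ℤ) : ℝ)| ≤ q := by
    rw [← Int.cast_abs]
    have : |a i q - a i' q| ≤ q := by rw [abs_le]; constructor <;> linarith
    exact_mod_cast this
  rw [shiftDiff]
  push_cast at h5 ⊢
  calc _ ≤ |(a i q - a i' q : ℝ)| + |(t * q : ℝ)| := abs_add_le _ _
    _ ≤ q + |(t : ℝ)| * q := by
        rw [abs_mul, Nat.abs_cast]; gcongr
    _ = _ := by ring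

theorem card_filter_shiftDiff_le {B : ℕ} {ρ : ℕ → ℝ} (hI : IsRegularSievingSystem I B ρ) :
    ∃ c₁ c₂ C : ℝ, 0 < c₁ ∧ 0 < c₂ ∧ 0 ≤ C ∧ ∀ (a : ℕ → ℕ → ℤ), IsEnumeration I a →
      ∀ (Q : Finset ℕ) (ν : ℕ), 1 ≤ ν → (∀ q ∈ Q, q.Prime ∧ (I q).card = ν) →
      ∀ i ∈ Finset.Icc 1 ν, ∀ i' ∈ Finset.Icc 1 ν, ∀ t : ℤ, (i ≠ i' ∨ t ≠ 0) →
      ∀ (u : ℝ) (w : ℤ) (k : ℕ), 10 ≤ u → (∀ q ∈ Q, |(shiftDiff a i i' t q : ℝ)| ≤ u) →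
        |(w : ℝ)| ≤ u → 1 ≤ k →
        ((Q.filter (fun q => shiftDiff a i i' t q + w ≠ 0 ∧
          k ≤ (diffPrimes I (shiftDiff a i i' t q + w)).ncard)).card : ℝ) ≤
          C * u * Real.log u ^ c₁ * Real.exp (-c₂ * k) := by
  classical
  obtain ⟨c₁, c₂, C, hc₁, hc₂, h⟩ := hI.diff_overlap
  refine ⟨c₁, c₂, max C 0, hc₁, hc₂, le_max_right _ _, ?_⟩
  intro a ha Q ν hν hQ i hi i' hi' t ht u w k hu hm hw hk
  -- The hypothesis wants an admissible `m q` for every prime with `I_q` nonempty. Outside `Q` the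
  -- value `q` serves: it is nonzero and represents the class 0, a difference of equal elements.
  obtain ⟨hfin, hcard⟩ := h u (fun q => if q ∈ Q then shiftDiff a i i' t q else (q : ℤ)) w k hu
    (by
      intro q hq hcq
      by_cases hqQ : q ∈ Q
      · have e := (hQ q hqQ).2
        simp only [if_pos hqQ]
        exact ⟨ha.shiftDiff_ne_zero hq (e ▸ hi) (e ▸ hi') ht,
          ha.shiftDiff_mem hq (e ▸ hi) (e ▸ hi') t⟩
      · simp only [if_neg hqQ]
        obtain ⟨c, hc⟩ := Finset.card_pos.1 hcq
        exact ⟨by exact_mod_cast hq.ne_zero, hq, c, hc, c, hc, by simp⟩) hw hk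
  have hu1 : 0 ≤ Real.log u := Real.log_nonneg (by linarith)
  calc _ ≤ (Set.ncard _ : ℝ) := by
        rw [← Set.ncard_coe_finset]
        refine Nat.cast_le.2 (Set.ncard_le_ncard ?_ hfin)
        intro q hq
        obtain ⟨hqQ, hne, hN⟩ := Finset.mem_filter.1 (Finset.mem_coe.1 hq)
        have e := (hQ q hqQ).2
        have hne0 := ha.shiftDiff_ne_zero (hQ q hqQ).1 (e ▸ hi) (e ▸ hi') ht
        simp only [Set.mem_ofPred_eq, if_pos hqQ]
        exact ⟨(hQ q hqQ).1, by omega, abs_pos.2 hne0, hm q hqQ, hne, hN⟩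
    _ ≤ C * u * Real.log u ^ c₁ * Real.exp (-c₂ * k) := hcard
    _ ≤ _ := by
        have := Real.rpow_nonneg hu1 c₁
        gcongr
        exact le_max_left _ _

end

/-- The large values of `N` along shifts of the sequences `shiftDiff` are rare among the primes in
`Q`, and `Q` has almost `y` elements. -/
structure SparseShifts (I : (p : ℕ) → Finset (ZMod p)) (K : ℝ) (y : ℕ) (H c A : ℝ)
    (Q : Finset ℕ) (ν : ℕ) : Prop where
  le_card : (y : ℝ) / Real.log y ^ 3 ≤ Q.card
  prime : ∀ q ∈ Q, q.Prime
  le : ∀ q ∈ Q, (q : ℝ) ≤ y / H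
  card_eq : ∀ q ∈ Q, (I q).card = ν
  card_filter_le : ∀ a : ℕ → ℕ → ℤ, IsEnumeration I a → ∀ i ∈ Finset.Icc 1 ν,
    ∀ i' ∈ Finset.Icc 1 ν, ∀ t : ℤ, |(t : ℝ)| ≤ K * H + 1 → (i ≠ i' ∨ t ≠ 0) →
    ∀ (w : ℤ) (k : ℕ), |(w : ℝ)| ≤ (K + 3) * y → 1 ≤ k →
      ((Q.filter (fun q => shiftDiff a i i' t q + w ≠ 0 ∧
          k ≤ (diffPrimes I (shiftDiff a i i' t q + w)).ncard)).card : ℝ) ≤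
        Q.card * Real.log y ^ A * Real.exp (-c * k)

theorem eventually_sparseShifts {I : (p : ℕ) → Finset (ZMod p)} {B : ℕ} {ρ : ℕ → ℝ}
    (hI : IsRegularSievingSystem I B ρ) {δ ξ K : ℝ} (hδ : 0 < δ) (hδ' : δ < 1 / 2) (hξ : 1 < ξ)
    (hK : 0 < K) :
    ∃ c A : ℝ, 0 < c ∧ 0 ≤ A ∧ ∀ᶠ x : ℝ in atTop, ∀ H ∈ scales ξ δ x, ∀ ν ∈ frequentSizes B ρ,
      SparseShifts I K (yParam δ x) H c A (scalePrimes I ξ δ x H ν) ν := by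
  obtain ⟨c₁, c₂, C, hc₁, hc₂, hC, hcount⟩ := card_filter_shiftDiff_le hI
  -- Three of the four extra logarithms convert `y` into the size of the prime set, the fourth
  -- absorbs the constants.
  refine ⟨c₂, c₁ + 4, hc₂, by linarith, ?_⟩
  have hy := tendsto_yParam hδ hδ'
  have hℓ := tendsto_log_yParam hδ hδ'
  filter_upwards [eventually_scales_bounds hδ hδ' hξ, eventually_card_scalePrimes hI hδ hδ' hξ,
    hℓ.eventually_ge_atTop 1, hℓ.eventually_ge_atTop (C * (K + 3) * 2 ^ c₁),
    hy.eventually_ge_atTop 10, hy.eventually_ge_atTop (K + 3)]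
    with x h₁ h₂ h₃ h₄ h₅ h₆ H hH ν hν
  set y := yParam δ x
  set ℓ := Real.log y with hℓd
  have hy0 : (0 : ℝ) < y := by linarith
  have hH1 : 1 ≤ H := (Real.one_le_rpow h₃ hδ.le).trans (h₁ H hH).1
  have hcard := h₂ H hH ν hν
  have hprop : ∀ q ∈ scalePrimes I ξ δ x H ν, q.Prime ∧ (I q).card = ν := fun q hq =>
    ⟨(mem_scalePrimes.1 hq).1, (mem_scalePrimes.1 hq).2.2.2⟩
  refine ⟨hcard, fun q hq => (hprop q hq).1, fun q hq => (mem_scalePrimes.1 hq).2.1,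
    fun q hq => (hprop q hq).2, ?_⟩
  intro a ha i hi i' hi' t ht hne w k hw hk
  have hu : 10 ≤ (K + 3) * y := by nlinarith
  have h := hcount a ha (scalePrimes I ξ δ x H ν) ν hν.1 hprop i hi i' hi' t hne ((K + 3) * y) w k
    hu (fun q hq => by
      obtain ⟨hqp, hqν⟩ := hprop q hq
      have hqle : (q : ℝ) ≤ y / H := (mem_scalePrimes.1 hq).2.1
      refine (ha.abs_shiftDiff_le hqp (hqν ▸ hi) (hqν ▸ hi') t).trans ?_
      have h7 : 1 + |(t : ℝ)| ≤ (K + 3) * H := by nlinarith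
      calc (1 + |(t : ℝ)|) * q ≤ (K + 3) * H * (y / H) := by gcongr
        _ = _ := by field_simp) hw hk
  refine h.trans ?_
  have hlog : Real.log ((K + 3) * y) ≤ 2 * ℓ := by
    rw [Real.log_mul (by positivity) (by positivity)]
    have := Real.log_le_log (by linarith) h₆
    linarith
  have hlog0 : 0 ≤ Real.log ((K + 3) * y) := Real.log_nonneg (by linarith)
  have hℓ0 : 0 < ℓ := by linarith
  refine mul_le_mul_of_nonneg_right ?_ (Real.exp_nonneg _)
  have e : ℓ ^ (c₁ + 4) = ℓ ^ c₁ * ℓ * ℓ ^ 3 := by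
    rw [Real.rpow_add hℓ0, mul_assoc, ← pow_succ', show (4 : ℝ) = ((4 : ℕ) : ℝ) by norm_num,
      Real.rpow_natCast]
  rw [div_le_iff₀ (by positivity)] at hcard
  calc C * ((K + 3) * y) * Real.log ((K + 3) * y) ^ c₁
      ≤ C * ((K + 3) * y) * (2 * ℓ) ^ c₁ := by gcongr
    _ = (C * (K + 3) * 2 ^ c₁) * (y * ℓ ^ c₁) := by
        rw [Real.mul_rpow (by norm_num) hℓ0.le]; ring
    _ ≤ ℓ * (y * ℓ ^ c₁) := by gcongr
    _ = y * (ℓ ^ c₁ * ℓ) := by ring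
    _ ≤ ((scalePrimes I ξ δ x H ν).card * ℓ ^ 3) * (ℓ ^ c₁ * ℓ) := by gcongr
    _ = _ := by rw [e]; ring

theorem card_filter_le_sum_card_filter {α ι : Type*} (S : Finset α) (T : Finset ι)
    (p : α → Prop) (r : ι → α → Prop) [DecidablePred p] [∀ j, DecidablePred (r j)]
    (h : ∀ x ∈ S, p x → ∃ j ∈ T, r j x) :
    (S.filter p).card ≤ ∑ j ∈ T, (S.filter (r j)).card := by
  classical
  refine (Finset.card_le_card ?_).trans Finset.card_biUnion_le
  intro x hx
  obtain ⟨hxS, hpx⟩ := Finset.mem_filter.1 hx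
  obtain ⟨j, hj, hjx⟩ := h x hxS hpx
  exact Finset.mem_biUnion.2 ⟨j, hj, Finset.mem_filter.2 ⟨hxS, hjx⟩⟩

theorem exists_of_le_maxDiffCount {I : (p : ℕ) → Finset (ZMod p)} {V : Finset ℤ} {k : ℕ}
    (hk : 1 ≤ k) (h : k ≤ maxDiffCount I V) :
    ∃ v ∈ V, ∃ v' ∈ V, v ≠ v' ∧ k ≤ (diffPrimes I (v - v')).ncard := by
  rw [maxDiffCount, Finset.le_sup_iff (by simp; omega)] at h
  obtain ⟨⟨v, v'⟩, hv, h⟩ := h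
  rw [Finset.mem_offDiag] at hv
  exact ⟨v, hv.1, v', hv.2.1, hv.2.2, h⟩

/-- The indices `(i, i', t)` of the sequences `shiftDiff a i i' t` that do not vanish. -/
noncomputable def shiftIndices (ν J : ℕ) : Finset (ℕ × ℕ × ℤ) :=
  (Finset.Icc 1 ν ×ˢ Finset.Icc 1 ν ×ˢ Finset.Icc (-(J : ℤ)) J).filter
    (fun j => j.1 ≠ j.2.1 ∨ j.2.2 ≠ 0)

theorem mem_shiftIndices {ν J : ℕ} {j : ℕ × ℕ × ℤ} : j ∈ shiftIndices ν J ↔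
    (j.1 ∈ Finset.Icc 1 ν ∧ j.2.1 ∈ Finset.Icc 1 ν ∧ |j.2.2| ≤ J) ∧ (j.1 ≠ j.2.1 ∨ j.2.2 ≠ 0) := by
  simp only [shiftIndices, Finset.mem_filter, Finset.mem_product, Finset.mem_Icc, abs_le]

theorem card_shiftIndices_le (ν J : ℕ) : (shiftIndices ν J).card ≤ ν ^ 2 * (2 * J + 1) := by
  refine (Finset.card_filter_le _ _).trans (le_of_eq ?_)
  rw [Finset.card_product, Finset.card_product, Nat.card_Icc, Int.card_Icc, Nat.add_sub_cancel]
  have : ((J : ℤ) + 1 - -(J : ℤ)).toNat = 2 * J + 1 := by omega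
  rw [this]; ring

theorem sub_mem_Icc_abs {J h h' : ℕ} (hh : h ∈ Finset.Icc 1 J) (hh' : h' ∈ Finset.Icc 1 J) :
    |(h : ℤ) - h'| ≤ J := by
  rw [Finset.mem_Icc] at hh hh'
  rw [abs_le]; constructor <;> omega

section
variable {I : (p : ℕ) → Finset (ZMod p)} {K : ℝ} {y : ℕ} {H c A : ℝ} {Q : Finset ℕ} {ν : ℕ}
  {a : ℕ → ℕ → ℤ}

/-- For one prime, the difference of two elements depends on the indices only through `i`, `i'` and
`h - h'`. Equal indices leave `n - n'`; all others give a nonvanishing element of `I_q - I_q`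
shifted by `n - n'`. -/
theorem groundSet_sub_groundSet (ha : IsEnumeration I a) {q : ℕ} (hq : q.Prime)
    (hν : (I q).card = ν) {J : ℝ} {n n' v v' : ℤ} (hv : v ∈ groundSet I J q n)
    (hv' : v' ∈ groundSet I J q n') :
    v - v' = n - n' ∨ ∃ j ∈ shiftIndices ν ⌊J⌋₊,
      v - v' = shiftDiff a j.1 j.2.1 j.2.2 q + (n - n') := by
  obtain ⟨i, hi, h, hh, rfl⟩ := (mem_groundSet_iff ha hq).1 hv
  obtain ⟨i', hi', h', hh', rfl⟩ := (mem_groundSet_iff ha hq).1 hv'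
  rw [hν] at hi hi'
  by_cases hj : i ≠ i' ∨ (h : ℤ) - h' ≠ 0
  · refine Or.inr ⟨(i, i', (h : ℤ) - h'), mem_shiftIndices.2
      ⟨⟨hi, hi', sub_mem_Icc_abs hh hh'⟩, hj⟩, ?_⟩
    simp only [shiftDiff]; ring
  · push Not at hj
    obtain ⟨rfl, hj⟩ := hj
    have : h = h' := by omega
    subst this
    exact Or.inl (by ring)

theorem mem_groundSet_shift (ha : IsEnumeration I a) {q : ℕ} (hq : q.Prime)
    (hν : (I q).card = ν) {J : ℝ} {n v : ℤ} {i₀ h₀ : ℕ} (hi₀ : i₀ ∈ Finset.Icc 1 ν)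
    (hh₀ : h₀ ∈ Finset.Icc 1 ⌊J⌋₊) (hv : v ∈ groundSet I J q (n - a i₀ q - (q : ℤ) * h₀)) :
    v = n ∨ ∃ j ∈ shiftIndices ν ⌊J⌋₊, v = n + shiftDiff a j.1 j.2.1 j.2.2 q := by
  have hn : n ∈ groundSet I J q (n - a i₀ q - (q : ℤ) * h₀) :=
    (mem_groundSet_iff ha hq).2 ⟨i₀, hν ▸ hi₀, h₀, hh₀, by ring⟩
  rcases groundSet_sub_groundSet ha hq hν hv hn with h | ⟨j, hj, h⟩
  · exact Or.inl (by linarith)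
  · exact Or.inr ⟨j, hj, by linarith⟩

theorem self_mem_groundSet (ha : IsEnumeration I a) {q : ℕ} (hq : q.Prime)
    (hν : (I q).card = ν) {J : ℝ} {n : ℤ} {i₀ h₀ : ℕ} (hi₀ : i₀ ∈ Finset.Icc 1 ν)
    (hh₀ : h₀ ∈ Finset.Icc 1 ⌊J⌋₊) : n ∈ groundSet I J q (n - a i₀ q - (q : ℤ) * h₀) :=
  (mem_groundSet_iff ha hq).2 ⟨i₀, hν ▸ hi₀, h₀, hh₀, by ring⟩

namespace SparseShifts

theorem card_filter_le_of_mem (hs : SparseShifts I K y H c A Q ν) (hKH : 0 ≤ K * H)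
    (ha : IsEnumeration I a) {j : ℕ × ℕ × ℤ} (hj : j ∈ shiftIndices ν ⌊K * H⌋₊) {w : ℤ} {k : ℕ}
    (hw : |(w : ℝ)| ≤ (K + 3) * y) (hk : 1 ≤ k) :
    ((Q.filter (fun q => shiftDiff a j.1 j.2.1 j.2.2 q + w ≠ 0 ∧
          k ≤ (diffPrimes I (shiftDiff a j.1 j.2.1 j.2.2 q + w)).ncard)).card : ℝ) ≤
        Q.card * Real.log y ^ A * Real.exp (-c * k) := by
  obtain ⟨⟨h₁, h₂, h₃⟩, h₄⟩ := mem_shiftIndices.1 hj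
  refine hs.card_filter_le a ha _ h₁ _ h₂ _ ?_ h₄ w k hw hk
  have h₅ : |(j.2.2 : ℝ)| ≤ ⌊K * H⌋₊ := by exact_mod_cast h₃
  linarith [Nat.floor_le hKH]

/-- A union bound over the index triples. Within one progression the shift is 0, so the base point
may vary with `q`. -/
theorem card_single_le (hs : SparseShifts I K y H c A Q ν) (hK : 0 < K) (hH : 0 < H)
    (ha : IsEnumeration I a) (n : ℕ → ℤ) {k : ℕ} (hk : 1 ≤ k) :
    ((Q.filter (fun q => k ≤ maxDiffCount I (groundSet I (K * H) q (n q)))).card : ℝ) ≤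
      (shiftIndices ν ⌊K * H⌋₊).card * (Q.card * Real.log y ^ A * Real.exp (-c * k)) := by
  have h := card_filter_le_sum_card_filter Q (shiftIndices ν ⌊K * H⌋₊)
    (fun q => k ≤ maxDiffCount I (groundSet I (K * H) q (n q)))
    (fun j q => shiftDiff a j.1 j.2.1 j.2.2 q + 0 ≠ 0 ∧
      k ≤ (diffPrimes I (shiftDiff a j.1 j.2.1 j.2.2 q + 0)).ncard) (by
    intro q hq hkq
    obtain ⟨v, hv, v', hv', hne, hN⟩ := exists_of_le_maxDiffCount hk hkq
    rcases groundSet_sub_groundSet ha (hs.prime q hq) (hs.card_eq q hq) hv hv' with h | ⟨j, hj, h⟩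
    · exact absurd (by linarith) hne
    · rw [sub_self] at h
      exact ⟨j, hj, h ▸ sub_ne_zero.2 hne, h ▸ hN⟩)
  have h' : ((Q.filter (fun q => k ≤ maxDiffCount I (groundSet I (K * H) q (n q)))).card : ℝ) ≤
      ∑ j ∈ shiftIndices ν ⌊K * H⌋₊, ((Q.filter (fun q => shiftDiff a j.1 j.2.1 j.2.2 q + 0 ≠ 0 ∧
      k ≤ (diffPrimes I (shiftDiff a j.1 j.2.1 j.2.2 q + 0)).ncard)).card : ℝ) := by
    exact_mod_cast h
  refine h'.trans ((Finset.sum_le_sum fun j hj =>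
    hs.card_filter_le_of_mem (by positivity) ha hj (w := 0) (by simp; positivity) hk).trans ?_)
  rw [Finset.sum_const, nsmul_eq_mul]

/-- The shifts that occur are 0 and `±(n₁ - n₂)`. The unshifted difference `n₁ - n₂` may be present
for every `q`, so no averaging over `q` can help with it; the hypothesis `hN` excludes it. -/
theorem card_pair_le (hs : SparseShifts I K y H c A Q ν) (hK : 0 < K) (hH : 0 < H)
    (ha : IsEnumeration I a) {n₁ n₂ : ℤ} (hn : |((n₁ - n₂ : ℤ) : ℝ)| ≤ (K + 3) * y) {k : ℕ}
    (hk : 1 ≤ k) (hN : n₁ = n₂ ∨ (diffPrimes I (n₁ - n₂)).ncard < k) :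
    ((Q.filter (fun q => k ≤ maxDiffCount I (groundSet I (K * H) q n₁ ∪
        groundSet I (K * H) q n₂))).card : ℝ) ≤
      3 * (shiftIndices ν ⌊K * H⌋₊).card * (Q.card * Real.log y ^ A * Real.exp (-c * k)) := by
  set W : Finset ℤ := {0, n₁ - n₂, n₂ - n₁} with hW
  have hWc : W.card ≤ 3 := Finset.card_le_three
  have hWb : ∀ w ∈ W, |(w : ℝ)| ≤ (K + 3) * y ∧ (w = 0 ∨ (diffPrimes I w).ncard < k) := by
    intro w hw
    simp only [hW, Finset.mem_insert, Finset.mem_singleton] at hw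
    rcases hw with rfl | rfl | rfl
    · exact ⟨by simp; positivity, Or.inl rfl⟩
    · refine ⟨hn, hN.imp (fun h => by rw [h, sub_self]) id⟩
    · refine ⟨?_, hN.imp (fun h => by rw [h, sub_self]) fun h => by rwa [diffPrimes_sub_comm]⟩
      rw [← neg_sub, Int.cast_neg, abs_neg]; exact hn
  have h := card_filter_le_sum_card_filter Q (shiftIndices ν ⌊K * H⌋₊ ×ˢ W)
    (fun q => k ≤ maxDiffCount I (groundSet I (K * H) q n₁ ∪ groundSet I (K * H) q n₂))
    (fun j q => shiftDiff a j.1.1 j.1.2.1 j.1.2.2 q + j.2 ≠ 0 ∧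
      k ≤ (diffPrimes I (shiftDiff a j.1.1 j.1.2.1 j.1.2.2 q + j.2)).ncard) (by
    intro q hq hkq
    obtain ⟨v, hv, v', hv', hne, hNv⟩ := exists_of_le_maxDiffCount hk hkq
    have key : ∃ w ∈ W, v - v' = w ∨ ∃ j ∈ shiftIndices ν ⌊K * H⌋₊,
        v - v' = shiftDiff a j.1 j.2.1 j.2.2 q + w := by
      rw [Finset.mem_union] at hv hv'
      have hqp := hs.prime q hq
      have hqν := hs.card_eq q hq
      rcases hv with hv | hv <;> rcases hv' with hv' | hv'
      · exact ⟨n₁ - n₁, by simp [hW], groundSet_sub_groundSet ha hqp hqν hv hv'⟩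
      · exact ⟨n₁ - n₂, by simp [hW], groundSet_sub_groundSet ha hqp hqν hv hv'⟩
      · exact ⟨n₂ - n₁, by simp [hW], groundSet_sub_groundSet ha hqp hqν hv hv'⟩
      · exact ⟨n₂ - n₂, by simp [hW], groundSet_sub_groundSet ha hqp hqν hv hv'⟩
    obtain ⟨w, hw, h | ⟨j, hj, h⟩⟩ := key
    · exfalso
      rcases (hWb w hw).2 with h0 | h0
      · exact hne (by linarith)
      · rw [← h] at h0; omega
    · exact ⟨(j, w), Finset.mk_mem_product hj hw, h ▸ sub_ne_zero.2 hne, h ▸ hNv⟩)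
  have h' : ((Q.filter (fun q => k ≤ maxDiffCount I (groundSet I (K * H) q n₁ ∪
        groundSet I (K * H) q n₂))).card : ℝ) ≤
      ∑ j ∈ shiftIndices ν ⌊K * H⌋₊ ×ˢ W,
        ((Q.filter (fun q => shiftDiff a j.1.1 j.1.2.1 j.1.2.2 q + j.2 ≠ 0 ∧
      k ≤ (diffPrimes I (shiftDiff a j.1.1 j.1.2.1 j.1.2.2 q + j.2)).ncard)).card : ℝ) := by
    exact_mod_cast h
  have hX : 0 ≤ (Q.card : ℝ) * Real.log y ^ A * Real.exp (-c * k) := by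
    have := Real.rpow_nonneg (Real.log_natCast_nonneg y) A
    positivity
  refine h'.trans ((Finset.sum_le_sum fun j hj =>
    hs.card_filter_le_of_mem (by positivity) ha (Finset.mem_product.1 hj).1 (w := j.2)
      (hWb _ (Finset.mem_product.1 hj).2).1 hk).trans ?_)
  rw [Finset.sum_const, nsmul_eq_mul, Finset.card_product, Nat.cast_mul]
  refine mul_le_mul_of_nonneg_right ?_ hX
  have : (W.card : ℝ) ≤ 3 := by exact_mod_cast hWc
  nlinarith [(Nat.cast_nonneg (shiftIndices ν ⌊K * H⌋₊).card : (0 : ℝ) ≤ _)]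

/-- Double counting of pairs `(w, q)`. Write `w = q + (w - q)`, where `q` itself is an admissible
difference (`i = i' = t = 1`). For each value of the shift `w - q`, few primes `q` give a large
count; summing over the `O(y)` shifts and dividing by `Q.card` bounds the number of `w`. -/
theorem card_large_diffPrimes_le (hs : SparseShifts I K y H c A Q ν) (hK : 0 < K) (hH : 1 ≤ H)
    (ha : IsEnumeration I a) (hν : 1 ≤ ν) (hQ : 0 < Q.card) {k : ℕ} (hk : 1 ≤ k) :
    (((Finset.Icc (-⌊(K + 2) * y⌋) ⌊(K + 2) * y⌋).filter
        (fun w => w ≠ 0 ∧ k ≤ (diffPrimes I w).ncard)).card : ℝ) ≤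
      (2 * ((K + 3) * y) + 1) * (Real.log y ^ A * Real.exp (-c * k)) := by
  set W := (Finset.Icc (-⌊(K + 2) * y⌋) ⌊(K + 2) * y⌋).filter
        (fun w => w ≠ 0 ∧ k ≤ (diffPrimes I w).ncard) with hW
  set R : ℕ := ⌊(K + 3) * y⌋₊ with hR
  have hy0 : (0 : ℝ) ≤ y := Nat.cast_nonneg _
  have hRle : (R : ℝ) ≤ (K + 3) * y := Nat.floor_le (by positivity)
  have h₁ : W.card * Q.card ≤ ∑ w ∈ Finset.Icc (-(R : ℤ)) R,
      (Q.filter (fun q => shiftDiff a 1 1 1 q + w ≠ 0 ∧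
          k ≤ (diffPrimes I (shiftDiff a 1 1 1 q + w)).ncard)).card := by
    rw [← Finset.card_product, ← Finset.card_sigma]
    -- The pair is reindexed by its shift and its prime; `q ≤ y` keeps the shift within `(K + 3) *
    -- y`.
    refine Finset.card_le_card_of_injOn (fun wq => ⟨wq.1 - wq.2, wq.2⟩) ?_ ?_
    · rintro ⟨w, q⟩ hwq
      obtain ⟨hw, hq⟩ := Finset.mem_product.1 (Finset.mem_coe.1 hwq)
      simp only [hW, Finset.mem_filter, Finset.mem_Icc] at hw hq
      have hqy : (q : ℝ) ≤ y := (hs.le q hq).trans (div_le_self hy0 hH)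
      have hw1 : (w : ℝ) ≤ (K + 2) * y := (Int.le_floor.1 hw.1.2)
      have hw2 : -(w : ℝ) ≤ (K + 2) * y := by
        have : -w ≤ ⌊(K + 2) * (y : ℝ)⌋ := by linarith [hw.1.1]
        have := Int.le_floor.1 this
        push_cast at this
        exact this
      have h2 : |w - (q : ℤ)| ≤ R := by
        have h3 : (w - (q : ℤ)).natAbs ≤ R := by
          rw [hR, Nat.le_floor_iff (by positivity), Nat.cast_natAbs]
          push_cast
          rw [abs_le]
          have := (Nat.cast_nonneg q : (0 : ℝ) ≤ q)
          constructor <;> nlinarith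
        rw [Int.abs_eq_natAbs]
        exact_mod_cast h3
      have e : shiftDiff a 1 1 1 q + (w - q) = w := by simp [shiftDiff]
      rw [Finset.mem_coe, Finset.mem_sigma, Finset.mem_filter, Finset.mem_Icc, e]
      exact ⟨abs_le.1 h2, hq, hw.2⟩
    · rintro ⟨w, q⟩ - ⟨w', q'⟩ - h
      simp only [Sigma.mk.injEq, heq_eq_eq] at h
      obtain ⟨h, rfl⟩ := h
      ext <;> simp_all
  have h₂ : (W.card : ℝ) * Q.card ≤ ∑ w ∈ Finset.Icc (-(R : ℤ)) R,
      ((Q.filter (fun q => shiftDiff a 1 1 1 q + w ≠ 0 ∧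
          k ≤ (diffPrimes I (shiftDiff a 1 1 1 q + w)).ncard)).card : ℝ) := by
    exact_mod_cast h₁
  have hQ' : (0 : ℝ) < Q.card := by exact_mod_cast hQ
  have hX : 0 ≤ Real.log y ^ A * Real.exp (-c * k) := by
    have := Real.rpow_nonneg (Real.log_natCast_nonneg y) A
    positivity
  have h₃ : (W.card : ℝ) * Q.card ≤
      (2 * R + 1) * (Q.card * Real.log y ^ A * Real.exp (-c * k)) := by
    refine h₂.trans ((Finset.sum_le_sum fun w hw => hs.card_filter_le a ha 1
      (Finset.mem_Icc.2 ⟨le_rfl, hν⟩) 1 (Finset.mem_Icc.2 ⟨le_rfl, hν⟩) 1 (by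
        simp; positivity) (Or.inr one_ne_zero) w k ?_ hk).trans (le_of_eq ?_))
    · refine le_trans ?_ hRle
      rw [Finset.mem_Icc, ← abs_le] at hw
      exact_mod_cast hw
    · rw [Finset.sum_const, nsmul_eq_mul, Int.card_Icc]
      have : ((R : ℤ) + 1 - -(R : ℤ)).toNat = 2 * R + 1 := by omega
      rw [this]; push_cast; ring
  have h₄ : (W.card : ℝ) ≤ (2 * R + 1) * (Real.log y ^ A * Real.exp (-c * k)) := by
    refine le_of_mul_le_mul_right ?_ hQ'
    linarith
  refine h₄.trans ?_
  gcongr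

end SparseShifts
end

theorem card_filter_product_fst {α β : Type*} (S : Finset α) (T : Finset β) (p : α → Prop)
    [DecidablePred p] :
    ((S ×ˢ T).filter (fun x => p x.1)).card = (S.filter p).card * T.card := by
  rw [← Finset.card_product]
  congr 1
  ext x
  simp only [Finset.mem_filter, Finset.mem_product]
  tauto

theorem card_filter_product_eq_sum {α β : Type*} (S : Finset α) (T : Finset β)
    (p : α → β → Prop) [∀ a b, Decidable (p a b)] :
    ((S ×ˢ T).filter (fun x => p x.1 x.2)).card = ∑ b ∈ T, (S.filter (fun a => p a b)).card := by
  simp only [Finset.card_filter]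
  rw [Finset.sum_product_right]

theorem card_filter_product_eq_sum_left {α β : Type*} (S : Finset α) (T : Finset β)
    (p : α → β → Prop) [∀ a b, Decidable (p a b)] :
    ((S ×ˢ T).filter (fun x => p x.1 x.2)).card = ∑ a ∈ S, (T.filter (fun b => p a b)).card := by
  simp only [Finset.card_filter]
  rw [Finset.sum_product]

section
variable {I : (p : ℕ) → Finset (ZMod p)} {K : ℝ} {y : ℕ} {H c A : ℝ} {Q : Finset ℕ} {ν : ℕ}
  {a : ℕ → ℕ → ℤ}

namespace SparseShifts

theorem abs_shiftDiff_le (hs : SparseShifts I K y H c A Q ν) (hK : 0 < K) (hH : 1 ≤ H)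
    (ha : IsEnumeration I a) {j : ℕ × ℕ × ℤ} (hj : j ∈ shiftIndices ν ⌊K * H⌋₊) {q : ℕ}
    (hq : q ∈ Q) : |(shiftDiff a j.1 j.2.1 j.2.2 q : ℝ)| ≤ (K + 1) * y := by
  obtain ⟨⟨h₁, h₂, h₃⟩, -⟩ := mem_shiftIndices.1 hj
  have e := hs.card_eq q hq
  refine (ha.abs_shiftDiff_le (hs.prime q hq) (e ▸ h₁) (e ▸ h₂) _).trans ?_
  have h₅ : |(j.2.2 : ℝ)| ≤ ⌊K * H⌋₊ := by exact_mod_cast h₃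
  have h₆ := Nat.floor_le (show 0 ≤ K * H by positivity)
  have h₇ : 1 + |(j.2.2 : ℝ)| ≤ (K + 1) * H := by nlinarith
  calc (1 + |(j.2.2 : ℝ)|) * q ≤ (K + 1) * H * (y / H) := by
        have := hs.le q hq
        gcongr
    _ = _ := by field_simp

/-- Both progressions pass through `n`, so every difference comes from `q₁` alone, from `q₂` alone,
or is a difference of two `shiftDiff` values. In the last case `q₂` is fixed and its value serves as
the shift `w` while `q₁` is counted. -/
theorem card_pair_shift_le (hs : SparseShifts I K y H c A Q ν) (hK : 0 < K) (hH : 1 ≤ H)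
    (ha : IsEnumeration I a) {n : ℤ} {i₀ h₁ h₂ : ℕ} (hi₀ : i₀ ∈ Finset.Icc 1 ν)
    (hh₁ : h₁ ∈ Finset.Icc 1 ⌊K * H⌋₊) (hh₂ : h₂ ∈ Finset.Icc 1 ⌊K * H⌋₊) {k : ℕ}
    (hk : 1 ≤ k) :
    (((Q ×ˢ Q).filter (fun q => k ≤ maxDiffCount I
        (groundSet I (K * H) q.1 (n - a i₀ q.1 - (q.1 : ℤ) * h₁) ∪
        groundSet I (K * H) q.2 (n - a i₀ q.2 - (q.2 : ℤ) * h₂)))).card : ℝ) ≤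
      3 * ((shiftIndices ν ⌊K * H⌋₊).card : ℝ) ^ 2 *
        (Q.card * (Q.card * Real.log y ^ A * Real.exp (-c * k))) := by
  have hH0 : 0 < H := by linarith
  have hKH : 0 ≤ K * H := by positivity
  have hy0 : (0 : ℝ) ≤ y := Nat.cast_nonneg _
  set T := shiftIndices ν ⌊K * H⌋₊ with hT
  set p : ℕ × ℕ × ℤ → ℤ → ℕ → Prop := fun j w q => shiftDiff a j.1 j.2.1 j.2.2 q + w ≠ 0 ∧
      k ≤ (diffPrimes I (shiftDiff a j.1 j.2.1 j.2.2 q + w)).ncard with hp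
  classical
  set X : ℝ := Q.card * Real.log y ^ A * Real.exp (-c * k) with hX
  have hX0 : 0 ≤ X := by
    have := Real.rpow_nonneg (Real.log_natCast_nonneg y) A
    positivity
  have hcount : ∀ j ∈ T, ∀ w : ℤ, |(w : ℝ)| ≤ (K + 3) * y → ((Q.filter (p j w)).card : ℝ) ≤ X := by
    intro j hj w hw
    have := hs.card_filter_le_of_mem hKH ha hj hw hk
    convert! this using 3
  have hzero : |((0 : ℤ) : ℝ)| ≤ (K + 3) * y := by simp; positivity
  have hwb : ∀ j ∈ T, ∀ q ∈ Q, |((-shiftDiff a j.1 j.2.1 j.2.2 q : ℤ) : ℝ)| ≤ (K + 3) * y := by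
    intro j hj q hq
    have := hs.abs_shiftDiff_le hK hH ha hj hq
    push_cast
    rw [abs_neg]
    nlinarith
  -- The left summand records which of the two primes produces the difference, the right one the
  -- mixed differences: `2 * |T| + |T| ^ 2` cases in all.
  set r : (Fin 2 × (ℕ × ℕ × ℤ)) ⊕ ((ℕ × ℕ × ℤ) × (ℕ × ℕ × ℤ)) → ℕ × ℕ → Prop := fun s q =>
    match s with
    | Sum.inl (0, j) => p j 0 q.1
    | Sum.inl (_, j) => p j 0 q.2
    | Sum.inr (j, j') => p j (-shiftDiff a j'.1 j'.2.1 j'.2.2 q.2) q.1 with hr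
  have h := card_filter_le_sum_card_filter (Q ×ˢ Q)
    (((Finset.univ : Finset (Fin 2)) ×ˢ T).disjSum (T ×ˢ T))
    (fun q => k ≤ maxDiffCount I
        (groundSet I (K * H) q.1 (n - a i₀ q.1 - (q.1 : ℤ) * h₁) ∪
        groundSet I (K * H) q.2 (n - a i₀ q.2 - (q.2 : ℤ) * h₂))) r (by
    rintro ⟨q₁, q₂⟩ hq hkq
    obtain ⟨hq₁, hq₂⟩ := Finset.mem_product.1 hq
    simp only at hq₁ hq₂ hkq
    have hp₁ := hs.prime _ hq₁
    have hp₂ := hs.prime _ hq₂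
    have hc₁ := hs.card_eq _ hq₁
    have hc₂ := hs.card_eq _ hq₂
    obtain ⟨v, hv, v', hv', hne, hN⟩ := exists_of_le_maxDiffCount hk hkq
    have cross : ∀ u u' : ℤ, u ∈ groundSet I (K * H) q₁ (n - a i₀ q₁ - (q₁ : ℤ) * h₁) →
        u' ∈ groundSet I (K * H) q₂ (n - a i₀ q₂ - (q₂ : ℤ) * h₂) → u ≠ u' →
        k ≤ (diffPrimes I (u - u')).ncard →
        ∃ s ∈ ((Finset.univ : Finset (Fin 2)) ×ˢ T).disjSum (T ×ˢ T), r s (q₁, q₂) := by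
      intro u u' hu hu' hne hN
      rcases mem_groundSet_shift ha hp₁ hc₁ hi₀ hh₁ hu with rfl | ⟨j, hj, rfl⟩
      · rcases mem_groundSet_shift ha hp₂ hc₂ hi₀ hh₂ hu' with rfl | ⟨j', hj', rfl⟩
        · exact absurd rfl hne
        · refine ⟨Sum.inl (1, j'), by simp [hj', hT], ?_⟩
          change p j' 0 q₂
          simp only [hp, add_zero]
          rw [show u - (u + shiftDiff a j'.1 j'.2.1 j'.2.2 q₂) =
            -shiftDiff a j'.1 j'.2.1 j'.2.2 q₂ by ring, diffPrimes_neg] at hN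
          exact ⟨fun h0 => hne (by rw [h0, add_zero]), hN⟩
      · rcases mem_groundSet_shift ha hp₂ hc₂ hi₀ hh₂ hu' with rfl | ⟨j', hj', rfl⟩
        · refine ⟨Sum.inl (0, j), by simp [hj, hT], ?_⟩
          change p j 0 q₁
          simp only [hp, add_zero]
          rw [add_sub_cancel_left] at hN
          exact ⟨fun h0 => hne (by rw [h0, add_zero]), hN⟩
        · refine ⟨Sum.inr (j, j'), by simp [hj, hj', hT], ?_⟩
          change p j (-shiftDiff a j'.1 j'.2.1 j'.2.2 q₂) q₁
          simp only [hp, ← sub_eq_add_neg]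
          rw [add_sub_add_left_eq_sub] at hN
          exact ⟨fun h0 => hne (by rw [sub_eq_zero.1 h0]), hN⟩
    rw [Finset.mem_union] at hv hv'
    rcases hv with hv | hv <;> rcases hv' with hv' | hv'
    · rcases groundSet_sub_groundSet ha hp₁ hc₁ hv hv' with h | ⟨j, hj, h⟩
      · exact absurd (by linarith) hne
      · rw [sub_self] at h
        refine ⟨Sum.inl (0, j), by simp [hj, hT], ?_⟩
        change p j 0 q₁
        exact ⟨h ▸ sub_ne_zero.2 hne, h ▸ hN⟩
    · exact cross v v' hv hv' hne hN
    · rw [diffPrimes_sub_comm] at hN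
      exact cross v' v hv' hv hne.symm hN
    · rcases groundSet_sub_groundSet ha hp₂ hc₂ hv hv' with h | ⟨j, hj, h⟩
      · exact absurd (by linarith) hne
      · rw [sub_self] at h
        refine ⟨Sum.inl (1, j), by simp [hj, hT], ?_⟩
        change p j 0 q₂
        exact ⟨h ▸ sub_ne_zero.2 hne, h ▸ hN⟩)
  have hb : ∀ s ∈ ((Finset.univ : Finset (Fin 2)) ×ˢ T).disjSum (T ×ˢ T),
      (((Q ×ˢ Q).filter (r s)).card : ℝ) ≤ Q.card * X := by
    intro s hsm
    rcases s with ⟨b, j⟩ | ⟨j, j'⟩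
    · have hj : j ∈ T := by simpa using hsm
      have hj0 := hcount j hj 0 hzero
      fin_cases b
      · calc _ = (((Q.filter (p j 0)).card * Q.card : ℕ) : ℝ) := by
              congr 1
              convert! card_filter_product_fst Q Q (p j 0)
          _ ≤ X * Q.card := by push_cast; gcongr
          _ = _ := mul_comm _ _
      · calc _ = ((∑ q ∈ Q, (Q.filter (p j 0)).card : ℕ) : ℝ) := by
              congr 1
              convert! card_filter_product_eq_sum_left Q Q (fun _ q => p j 0 q)
          _ = Q.card * ((Q.filter (p j 0)).card : ℝ) := by simp
          _ ≤ _ := by gcongr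
    · have hj : j ∈ T ∧ j' ∈ T := by simpa using hsm
      calc _ = ((∑ q ∈ Q, (Q.filter (p j (-shiftDiff a j'.1 j'.2.1 j'.2.2 q))).card : ℕ) : ℝ) := by
            congr 1
            convert! card_filter_product_eq_sum Q Q
              (fun q₁ q₂ => p j (-shiftDiff a j'.1 j'.2.1 j'.2.2 q₂) q₁)
        _ ≤ ∑ q ∈ Q, X := by
            push_cast
            exact Finset.sum_le_sum fun q hq => hcount j hj.1 _ (hwb j' hj.2 q hq)
        _ = _ := by simp
  have hcardT : ((((Finset.univ : Finset (Fin 2)) ×ˢ T).disjSum (T ×ˢ T)).card : ℝ) ≤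
      3 * (T.card : ℝ) ^ 2 := by
    rw [Finset.card_disjSum, Finset.card_product, Finset.card_product, Finset.card_univ,
      Fintype.card_fin]
    have : 2 * T.card + T.card * T.card ≤ 3 * T.card ^ 2 := by
      have := Nat.le_self_pow two_ne_zero T.card
      nlinarith
    exact_mod_cast this
  have h' : (((Q ×ˢ Q).filter (fun q => k ≤ maxDiffCount I
        (groundSet I (K * H) q.1 (n - a i₀ q.1 - (q.1 : ℤ) * h₁) ∪
        groundSet I (K * H) q.2 (n - a i₀ q.2 - (q.2 : ℤ) * h₂)))).card : ℝ) ≤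
      ∑ s ∈ ((Finset.univ : Finset (Fin 2)) ×ˢ T).disjSum (T ×ˢ T),
        (((Q ×ˢ Q).filter (r s)).card : ℝ) := by exact_mod_cast h
  refine (h'.trans (Finset.sum_le_sum hb)).trans ?_
  rw [Finset.sum_const, nsmul_eq_mul]
  gcongr

/-- A second common point `v` makes `v - n` a nonzero value of `shiftDiff` for both primes, so `q₂`
belongs to the `diffPrimes` of a number determined by `q₁` and an index. Given these, at most `D`
choices of `q₂` remain. -/
theorem card_bad_le (hs : SparseShifts I K y H c A Q ν) (hK : 0 < K) (hH : 1 ≤ H)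
    (ha : IsEnumeration I a) {D : ℝ}
    (hD : ∀ v : ℤ, v ≠ 0 → |(v : ℝ)| ≤ (K + 1) * y →
      (diffPrimes I v).Finite ∧ ((diffPrimes I v).ncard : ℝ) ≤ D)
    {n : ℤ} {i₀ h₁ h₂ : ℕ} (hi₀ : i₀ ∈ Finset.Icc 1 ν)
    (hh₁ : h₁ ∈ Finset.Icc 1 ⌊K * H⌋₊) (hh₂ : h₂ ∈ Finset.Icc 1 ⌊K * H⌋₊) :
    (((Q ×ˢ Q).filter (fun q => ¬ (groundSet I (K * H) q.1 (n - a i₀ q.1 - (q.1 : ℤ) * h₁) ∩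
        groundSet I (K * H) q.2 (n - a i₀ q.2 - (q.2 : ℤ) * h₂) = {n}))).card : ℝ) ≤
      Q.card * ((shiftIndices ν ⌊K * H⌋₊).card * D) := by
  classical
  set T := shiftIndices ν ⌊K * H⌋₊ with hT
  have h := card_filter_le_sum_card_filter (Q ×ˢ Q) T
    (fun q => ¬ (groundSet I (K * H) q.1 (n - a i₀ q.1 - (q.1 : ℤ) * h₁) ∩
        groundSet I (K * H) q.2 (n - a i₀ q.2 - (q.2 : ℤ) * h₂) = {n}))
    (fun j q => q.2 ∈ diffPrimes I (shiftDiff a j.1 j.2.1 j.2.2 q.1)) (by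
    rintro ⟨q₁, q₂⟩ hq hne
    obtain ⟨hq₁, hq₂⟩ := Finset.mem_product.1 hq
    simp only at hq₁ hq₂ hne
    have hp₁ := hs.prime _ hq₁
    have hp₂ := hs.prime _ hq₂
    have hc₁ := hs.card_eq _ hq₁
    have hc₂ := hs.card_eq _ hq₂
    by_contra! hcon
    apply hne
    ext v
    rw [Finset.mem_inter, Finset.mem_singleton]
    constructor
    · rintro ⟨hv₁, hv₂⟩
      rcases mem_groundSet_shift ha hp₁ hc₁ hi₀ hh₁ hv₁ with h | ⟨j, hj, h⟩
      · exact h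
      · rcases mem_groundSet_shift ha hp₂ hc₂ hi₀ hh₂ hv₂ with h' | ⟨j', hj', h'⟩
        · exact h'
        · exfalso
          refine hcon j hj ?_
          have e : shiftDiff a j.1 j.2.1 j.2.2 q₁ = shiftDiff a j'.1 j'.2.1 j'.2.2 q₂ := by
            linarith
          obtain ⟨⟨h3, h4, -⟩, -⟩ := mem_shiftIndices.1 hj'
          simp only [e]
          exact ha.shiftDiff_mem hp₂ (hc₂ ▸ h3) (hc₂ ▸ h4) _
    · rintro rfl
      exact ⟨self_mem_groundSet ha hp₁ hc₁ hi₀ hh₁, self_mem_groundSet ha hp₂ hc₂ hi₀ hh₂⟩)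
  have hb : ∀ j ∈ T, (((Q ×ˢ Q).filter (fun q : ℕ × ℕ =>
      q.2 ∈ diffPrimes I (shiftDiff a j.1 j.2.1 j.2.2 q.1))).card : ℝ) ≤ Q.card * D := by
    intro j hj
    obtain ⟨⟨h3, h4, -⟩, h5⟩ := mem_shiftIndices.1 hj
    rw [card_filter_product_eq_sum_left Q Q
      (fun q₁ q₂ => q₂ ∈ diffPrimes I (shiftDiff a j.1 j.2.1 j.2.2 q₁))]
    push_cast
    calc _ ≤ ∑ q ∈ Q, D := by
          refine Finset.sum_le_sum fun q hq => ?_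
          have e := hs.card_eq q hq
          obtain ⟨hfin, hle⟩ := hD _ (ha.shiftDiff_ne_zero (hs.prime q hq) (e ▸ h3) (e ▸ h4) h5)
            (hs.abs_shiftDiff_le hK hH ha hj hq)
          refine le_trans ?_ hle
          rw [← Set.ncard_coe_finset]
          exact Nat.cast_le.2 (Set.ncard_le_ncard
            (fun p hp => (Finset.mem_filter.1 (Finset.mem_coe.1 hp)).2) hfin)
      _ = _ := by simp
  have h' : (((Q ×ˢ Q).filter (fun q => ¬ (groundSet I (K * H) q.1
        (n - a i₀ q.1 - (q.1 : ℤ) * h₁) ∩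
        groundSet I (K * H) q.2 (n - a i₀ q.2 - (q.2 : ℤ) * h₂) = {n}))).card : ℝ) ≤
      ∑ j ∈ T, (((Q ×ˢ Q).filter (fun q : ℕ × ℕ =>
        q.2 ∈ diffPrimes I (shiftDiff a j.1 j.2.1 j.2.2 q.1))).card : ℝ) := by exact_mod_cast h
  refine (h'.trans (Finset.sum_le_sum hb)).trans (le_of_eq ?_)
  rw [Finset.sum_const, nsmul_eq_mul]
  ring

end SparseShifts
end

/-! ### Analytic inputs in the form used by the moment computations. -/

/-- A sum of terms `e x` is close to its number of terms times `μ` whenever most of the terms lie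
within `μ * (exp (D / H ^ (M - 2) * (1 + N x)) - 1)` of `μ`, with large values of `N` rare. -/
def MeanBound (y : ℕ) (H M c D A C : ℝ) : Prop :=
  ∀ (X : Type) (S G : Finset X) (e : X → ℝ) (N : X → ℕ) (μ : ℝ), G ⊆ S → 0 ≤ μ →
    (∀ x ∈ G, |e x - μ| ≤ μ * (Real.exp (D / H ^ (M - 2) * (1 + N x)) - 1)) →
    (∀ a ∈ S, a ∉ G → |e a - μ| ≤ μ * (y : ℝ) ^ (1 / 20 : ℝ)) →
    ((S.card : ℝ) - G.card ≤ S.card * (y : ℝ) ^ (-1 / 10 : ℝ)) →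
    (∀ k : ℕ, 1 ≤ k → ((G.filter (fun x => k ≤ N x)).card : ℝ) ≤
      S.card * Real.log y ^ A * Real.exp (-c * k)) →
    |∑ x ∈ S, e x - S.card * μ| ≤ C * (Real.log H / H ^ (M - 2)) * (S.card * μ)

/-- Numerical inequalities that hold for large `y`, with `D` a bound for the size of `diffPrimes`. -/
structure SizeBounds (M K D : ℝ) (y : ℕ) (H : ℝ) (ν : ℕ) : Prop where
  six_le_log : 6 ≤ Real.log y
  card_le : ((shiftIndices ν ⌊K * H⌋₊).card : ℝ) ≤ Real.log y ^ 2
  one_add_le : 1 + Real.log y ^ 2 ≤ (y : ℝ) ^ (9 / 10 : ℝ)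
  mul_le : Real.log y ^ 2 * D ≤ y / Real.log y ^ 3 * (y : ℝ) ^ (-1 / 10 : ℝ)
  one_le_mul : 1 ≤ Real.log H / H ^ (M - 2) * y
  two_mul_add_le : 2 * ((K + 3) * y) + 1 ≤ y * Real.log y

theorem eventually_sizeBounds {δ ξ M K : ℝ} (hδ : 0 < δ) (hδ' : δ < 1 / 2) (hξ : 1 < ξ)
    (hM : 2 < M) (hK : 0 < K) (B : ℕ) (C : ℝ) :
    ∀ᶠ x : ℝ in atTop, ∀ H ∈ scales ξ δ x, ∀ ν ≤ B,
      SizeBounds M K (C * ((K + 1) * yParam δ x) ^ (0.49 : ℝ)) (yParam δ x) H ν := by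
  have hℓ := tendsto_log_yParam hδ hδ'
  have hy := tendsto_yParam hδ hδ'
  filter_upwards [eventually_scales_bounds hδ hδ' hξ, hℓ.eventually_ge_atTop 6,
    hℓ.eventually_ge_atTop ((B : ℝ) ^ 2 * (2 * K + 1)), hℓ.eventually_ge_atTop (2 * (K + 3) + 1),
    hy.eventually_ge_atTop 1,
    hy.eventually (eventually_const_mul_log_rpow_le 2 2 (a := 9 / 10) (by norm_num)),
    hy.eventually (eventually_const_mul_log_rpow_le (C * (K + 1) ^ (0.49 : ℝ)) 5
      (a := 0.41) (by norm_num)),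
    hy.eventually (eventually_const_mul_log_rpow_le 1 M (a := 1) (by norm_num)),
    ((tendsto_rpow_atTop hδ).comp hℓ).eventually_ge_atTop 3]
    with x h₁ h₂ h₃ h₄ h₅ h₆ h₇ h₈ h₉ H hH ν hν
  obtain ⟨hl, hu⟩ := h₁ H hH
  set y := yParam δ x
  set ℓ := Real.log y with hℓd
  simp only [Function.comp] at h₉
  have hH3 : 3 ≤ H := h₉.trans hl
  have hH0 : 0 < H := by linarith
  have hℓ0 : 0 < ℓ := by linarith
  have hy0 : (0 : ℝ) < y := by linarith
  have hHℓ : H ≤ ℓ := by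
    refine hu.trans ?_
    calc _ ≤ ℓ ^ (1 : ℝ) := Real.rpow_le_rpow_of_exponent_le (by linarith) (by norm_num)
      _ = _ := Real.rpow_one _
  have e2 : ℓ ^ (2 : ℝ) = ℓ ^ 2 := Real.rpow_two _
  have e5 : ℓ ^ (5 : ℝ) = ℓ ^ 5 := by
    rw [show (5 : ℝ) = ((5 : ℕ) : ℝ) by norm_num, Real.rpow_natCast]
  refine ⟨h₂, ?_, ?_, ?_, ?_, by nlinarith⟩
  · have hc : ((shiftIndices ν ⌊K * H⌋₊).card : ℝ) ≤ (ν : ℝ) ^ 2 * (2 * ⌊K * H⌋₊ + 1) := by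
      exact_mod_cast card_shiftIndices_le ν ⌊K * H⌋₊
    have hfl : (⌊K * H⌋₊ : ℝ) ≤ K * H := Nat.floor_le (by positivity)
    have hνB : (ν : ℝ) ≤ B := by exact_mod_cast hν
    calc _ ≤ _ := hc
      _ ≤ (B : ℝ) ^ 2 * (2 * (K * ℓ) + ℓ) := by
          have : (⌊K * H⌋₊ : ℝ) ≤ K * ℓ := hfl.trans (by gcongr)
          gcongr
          linarith
      _ = (B : ℝ) ^ 2 * (2 * K + 1) * ℓ := by ring
      _ ≤ ℓ * ℓ := by gcongr
      _ = _ := by ring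
  · rw [e2] at h₆; nlinarith
  · rw [e5] at h₇
    rw [Real.mul_rpow (by linarith) hy0.le]
    -- The room left by the exponent `0.49`: `1 - 1 / 10 = 0.41 + 0.49`, and `y ^ 0.41` absorbs the
    -- five logarithms.
    have e : (y : ℝ) * (y : ℝ) ^ (-1 / 10 : ℝ) = (y : ℝ) ^ (0.41 : ℝ) * (y : ℝ) ^ (0.49 : ℝ) := by
      nth_rewrite 1 [← Real.rpow_one (y : ℝ)]
      rw [← Real.rpow_add hy0, ← Real.rpow_add hy0]; norm_num
    rw [div_mul_eq_mul_div, le_div_iff₀ (by positivity), e]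
    calc _ = (C * (K + 1) ^ (0.49 : ℝ) * ℓ ^ 5) * (y : ℝ) ^ (0.49 : ℝ) := by ring
      _ ≤ _ := by gcongr
  · rw [one_mul, Real.rpow_one] at h₈
    have hlog : 1 ≤ Real.log H := by
      rw [Real.le_log_iff_exp_le hH0]; linarith [Real.exp_one_lt_d9]
    have hp : 0 < H ^ (M - 2) := Real.rpow_pos_of_pos hH0 _
    rw [div_mul_eq_mul_div, le_div_iff₀ hp, one_mul]
    calc H ^ (M - 2) ≤ H ^ M := Real.rpow_le_rpow_of_exponent_le (by linarith) (by linarith)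
      _ ≤ ℓ ^ M := Real.rpow_le_rpow hH0.le hHℓ (by linarith)
      _ ≤ y := h₈
      _ ≤ Real.log H * y := by nlinarith

theorem IsRegularSievingSystem.exists_ncard_le {I : (p : ℕ) → Finset (ZMod p)} {B : ℕ} {ρ : ℕ → ℝ}
    (hI : IsRegularSievingSystem I B ρ) : ∃ C : ℝ, ∀ (v : ℤ) (u : ℝ), v ≠ 0 → |(v : ℝ)| ≤ u →
      (diffPrimes I v).Finite ∧ ((diffPrimes I v).ncard : ℝ) ≤ C * u ^ (0.49 : ℝ) := by
  obtain ⟨C, hC⟩ := hI.diff_bound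
  refine ⟨max C 0, fun v u hv hu => ⟨hI.diffPrimes_finite hv, ?_⟩⟩
  have key : ∀ v : ℤ, 1 ≤ v → (v : ℝ) ≤ u →
      ((diffPrimes I v).ncard : ℝ) ≤ max C 0 * u ^ (0.49 : ℝ) := by
    intro v hv hvu
    have hv0 : (0 : ℝ) ≤ v := by exact_mod_cast (by omega : (0 : ℤ) ≤ v)
    calc _ ≤ C * (v : ℝ) ^ (0.49 : ℝ) := (hC v hv).2
      _ ≤ max C 0 * (v : ℝ) ^ (0.49 : ℝ) := by gcongr; exact le_max_left _ _
      _ ≤ _ := by gcongr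
  rcases lt_or_gt_of_ne hv with h | h
  · rw [← diffPrimes_neg]
    exact key (-v) (by omega) (by push_cast; linarith [neg_le_abs (v : ℝ)])
  · exact key v (by omega) (by linarith [le_abs_self (v : ℝ)])

/-! ### Moments for (ii): sums over primes for given base points. -/

section
variable {I : (p : ℕ) → Finset (ZMod p)} {B : ℕ} {ρ : ℕ → ℝ} {M K : ℝ} {y : ℕ} {z H c A C D : ℝ}
  {Q : Finset ℕ} {ν : ℕ} {a : ℕ → ℕ → ℤ}

/-- The number of index tuples in each union bound costs at most `3 * ℓ ^ 4 + ℓ ≤ 6 * ℓ ^ 4 ≤ ℓ ^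
5`, with `ℓ = log y`; hence the exponent `A + 5` throughout. -/
theorem SizeBounds.mul_rpow_le (hb : SizeBounds M K D y H ν) {s : ℝ}
    (hs : s ≤ 3 * Real.log y ^ 4 + Real.log y) :
    s * Real.log y ^ A ≤ Real.log y ^ (A + 5) := by
  have hℓ := hb.six_le_log
  have hℓ0 : 0 < Real.log y := by linarith
  rw [add_comm, Real.rpow_add hℓ0, show (5 : ℝ) = ((5 : ℕ) : ℝ) by norm_num, Real.rpow_natCast]
  gcongr
  refine hs.trans ?_
  have : Real.log y ≤ Real.log y ^ 4 := le_self_pow₀ (by linarith) (by norm_num)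
  calc 3 * Real.log y ^ 4 + Real.log y ≤ 6 * Real.log y ^ 4 := by nlinarith
    _ ≤ Real.log y * Real.log y ^ 4 := by gcongr
    _ = _ := by ring

theorem abs_sum_sieveWeight_sub_le (hI : IsRegularSievingSystem I B ρ) (hK : 0 < K)
    (hg : GoodScale I B M K y z H) (hs : SparseShifts I K y H c A Q ν)
    (hb : SizeBounds M K D y H ν)
    (hm : MeanBound y H M c (16 * (B : ℝ) ^ 4 * K ^ 2) (A + 5) C) (n : ℤ) :
    |∑ q ∈ Q, residueExpectation (primeProd z) (fun b => sieveWeight I M K z b H q n) -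
      Q.card| ≤ C * (Real.log H / H ^ (M - 2)) * Q.card := by
  obtain ⟨a, ha⟩ := exists_isEnumeration I
  have hH0 : 0 < H := by linarith [hg.one_le]
  have h := hm ℕ Q Q (fun q => residueExpectation (primeProd z)
    (fun b => sieveWeight I M K z b H q n)) (fun q => maxDiffCount I (groundSet I (K * H) q n)) 1
    (Finset.Subset.refl _) zero_le_one
    (fun q hq => hI.sieveWeight_expectation hK hg (hs.prime q hq) n)
    (fun q hq hq' => absurd hq hq') (by rw [sub_self]; positivity) (fun k hk => by
      refine (hs.card_single_le hK hH0 ha (fun _ => n) hk).trans ?_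
      have := hb.mul_rpow_le (A := A) (s := (shiftIndices ν ⌊K * H⌋₊).card) (by
        have := hb.card_le
        have hℓ := hb.six_le_log
        nlinarith [sq_nonneg (Real.log y ^ 2), sq_nonneg (Real.log y)])
      calc _ = Q.card * ((shiftIndices ν ⌊K * H⌋₊).card * Real.log y ^ A) *
            Real.exp (-c * k) := by ring
        _ ≤ _ := by gcongr)
  simpa only [mul_one] using h

/-- Pairs of base points whose progressions for the same prime are disjoint are the good ones. For
given `q` and `n₁` only `1 + |T|` values of `n₂` are bad. In the tail, the pairs with large `N(n₁ -
n₂)` have to be counted separately, by `card_large_diffPrimes_le`, because they are bad for all `q`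
at once. -/
theorem abs_sum_sieveWeight_mul_sub_le (hI : IsRegularSievingSystem I B ρ) (hK : 0 < K)
    (hg : GoodScale I B M K y z H) (hs : SparseShifts I K y H c A Q ν) (hν : 1 ≤ ν)
    (hb : SizeBounds M K D y H ν)
    (hm : MeanBound y H M c (16 * (B : ℝ) ^ 4 * K ^ 2) (A + 5) C) (Y : Finset ℤ)
    (hY : (y : ℝ) ≤ Y.card)
    (hYd : ∀ n₁ ∈ Y, ∀ n₂ ∈ Y, ((n₁ - n₂ : ℤ) : ℝ) ≤ (K + 2) * y) :
    |∑ x ∈ Q ×ˢ Y ×ˢ Y, residueExpectation (primeProd z) (fun b =>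
        sieveWeight I M K z b H x.1 x.2.1 * sieveWeight I M K z b H x.1 x.2.2) -
      Q.card * (Y.card : ℝ) ^ 2| ≤
      C * (Real.log H / H ^ (M - 2)) * (Q.card * (Y.card : ℝ) ^ 2) := by
  classical
  obtain ⟨a, ha⟩ := exists_isEnumeration I
  have hH0 : 0 < H := by linarith [hg.one_le]
  have hℓ := hb.six_le_log
  have hℓ0 : 0 < Real.log y := by linarith
  have hy0 : (0 : ℝ) < y := by
    by_contra! h
    have : (y : ℝ) = 0 := le_antisymm h (Nat.cast_nonneg _)
    rw [this, Real.log_zero] at hℓ0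
    exact lt_irrefl _ hℓ0
  have hQ : 0 < Q.card := by
    have : (0 : ℝ) < Q.card := lt_of_lt_of_le (by positivity) hs.le_card
    exact_mod_cast this
  set T := shiftIndices ν ⌊K * H⌋₊ with hT
  set p : ℕ × ℤ × ℤ → Prop := fun x =>
    Disjoint (groundSet I (K * H) x.1 x.2.1) (groundSet I (K * H) x.1 x.2.2) with hp
  have hScard : ((Q ×ˢ Y ×ˢ Y).card : ℝ) = Q.card * (Y.card : ℝ) ^ 2 := by
    rw [Finset.card_product, Finset.card_product]; push_cast; ring
  have hbadcard : (((Q ×ˢ Y ×ˢ Y).filter (fun x => ¬ p x)).card : ℝ) ≤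
      Q.card * (Y.card * (1 + T.card)) := by
    have hle : ∀ q ∈ Q, ((Y ×ˢ Y).filter (fun x => ¬ p (q, x))).card ≤
        Y.card * (1 + T.card) := by
      intro q hq
      rw [card_filter_product_eq_sum_left Y Y (fun n₁ n₂ => ¬ p (q, n₁, n₂))]
      refine (Finset.sum_le_card_nsmul _ _ (1 + T.card) fun n₁ _ => ?_).trans
        (le_of_eq (smul_eq_mul _ _))
      -- A common element of the two progressions determines `n₂` from `n₁` and an index triple.
      have hsub : Y.filter (fun n₂ => ¬ p (q, n₁, n₂)) ⊆
          insert n₁ (T.image (fun j => n₁ + shiftDiff a j.1 j.2.1 j.2.2 q)) := by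
        intro n₂ hn₂
        have hnd := (Finset.mem_filter.1 hn₂).2
        simp only [hp, Finset.not_disjoint_iff] at hnd
        obtain ⟨v, hv₁, hv₂⟩ := hnd
        rw [Finset.mem_insert, Finset.mem_image]
        rcases groundSet_sub_groundSet ha (hs.prime q hq) (hs.card_eq q hq) hv₁ hv₂ with
          h | ⟨j, hj, h⟩
        · exact Or.inl (by linarith)
        · exact Or.inr ⟨j, hj, by linarith⟩
      refine (Finset.card_le_card hsub).trans ((Finset.card_insert_le _ _).trans ?_)
      have := Finset.card_image_le (s := T)
        (f := fun j : ℕ × ℕ × ℤ => n₁ + shiftDiff a j.1 j.2.1 j.2.2 q)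
      omega
    rw [card_filter_product_eq_sum_left Q (Y ×ˢ Y) (fun q x => ¬ p (q, x))]
    push_cast
    calc _ ≤ ∑ q ∈ Q, ((Y.card : ℝ) * (1 + T.card)) :=
          Finset.sum_le_sum fun q hq => by exact_mod_cast hle q hq
      _ = _ := by simp
  have htail : ∀ k : ℕ, 1 ≤ k → ((((Q ×ˢ Y ×ˢ Y).filter p).filter (fun x => k ≤ maxDiffCount I
      (groundSet I (K * H) x.1 x.2.1 ∪ groundSet I (K * H) x.1 x.2.2))).card : ℝ) ≤
      Q.card * (Y.card : ℝ) ^ 2 * Real.log y ^ (A + 5) * Real.exp (-c * k) := by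
    intro k hk
    set E : ℝ := Real.log y ^ A * Real.exp (-c * k) with hE
    have hE0 : 0 ≤ E := by positivity
    set L : ℤ → Prop := fun w => w ≠ 0 ∧ k ≤ (diffPrimes I w).ncard with hL
    have hpair : ∀ n₁ ∈ Y, ∀ n₂ ∈ Y, ((Q.filter (fun q => k ≤ maxDiffCount I
        (groundSet I (K * H) q n₁ ∪ groundSet I (K * H) q n₂))).card : ℝ) ≤
        3 * T.card * (Q.card * E) + (if L (n₁ - n₂) then (Q.card : ℝ) else 0) := by
      intro n₁ hn₁ n₂ hn₂
      by_cases hw : L (n₁ - n₂)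
      · rw [if_pos hw]
        have : ((Q.filter (fun q => k ≤ maxDiffCount I
          (groundSet I (K * H) q n₁ ∪ groundSet I (K * H) q n₂))).card : ℝ) ≤ Q.card := by
            exact_mod_cast Finset.card_filter_le _ _
        have h0 : 0 ≤ 3 * (T.card : ℝ) * (Q.card * E) := by positivity
        linarith
      · rw [if_neg hw, add_zero]
        have hd : |((n₁ - n₂ : ℤ) : ℝ)| ≤ (K + 3) * y := by
          have h1 := hYd n₁ hn₁ n₂ hn₂
          have h2 := hYd n₂ hn₂ n₁ hn₁
          push_cast at h1 h2 ⊢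
          rw [abs_le]; constructor <;> nlinarith
        have hN : n₁ = n₂ ∨ (diffPrimes I (n₁ - n₂)).ncard < k := by
          by_contra! hcon
          exact hw ⟨sub_ne_zero.2 hcon.1, hcon.2⟩
        refine (hs.card_pair_le hK hH0 ha hd hk hN).trans (le_of_eq ?_)
        rw [hE]; ring
    have hW : ∀ n₂ ∈ Y, ((Y.filter (fun n₁ => L (n₁ - n₂))).card : ℝ) ≤
        y * Real.log y * E := by
      intro n₂ hn₂
      have h1 := hs.card_large_diffPrimes_le hK hg.one_le ha hν hQ hk
      have h2 : (Y.filter (fun n₁ => L (n₁ - n₂))).card ≤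
          ((Finset.Icc (-⌊(K + 2) * y⌋) ⌊(K + 2) * y⌋).filter
            (fun w => w ≠ 0 ∧ k ≤ (diffPrimes I w).ncard)).card := by
        refine Finset.card_le_card_of_injOn (fun n₁ => n₁ - n₂) ?_
          (fun _ _ _ _ h => by simpa using h)
        intro n₁ hn₁
        obtain ⟨hn₁, hLn⟩ := Finset.mem_filter.1 (Finset.mem_coe.1 hn₁)
        refine Finset.mem_coe.2 (Finset.mem_filter.2 ⟨Finset.mem_Icc.2 ⟨?_, ?_⟩, hLn⟩)
        · have := Int.le_floor.2 (hYd n₂ hn₂ n₁ hn₁)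
          linarith
        · exact Int.le_floor.2 (hYd n₁ hn₁ n₂ hn₂)
      have h3 : ((Y.filter (fun n₁ => L (n₁ - n₂))).card : ℝ) ≤
          (2 * ((K + 3) * y) + 1) * E := le_trans (by exact_mod_cast h2) h1
      refine h3.trans ?_
      have := hb.two_mul_add_le
      gcongr
    have hsum : (((Q ×ˢ Y ×ˢ Y).filter (fun x => k ≤ maxDiffCount I
        (groundSet I (K * H) x.1 x.2.1 ∪ groundSet I (K * H) x.1 x.2.2))).card : ℝ) ≤
        Q.card * (Y.card : ℝ) ^ 2 * (3 * T.card * E) +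
          Q.card * (Y.card * (y * Real.log y * E)) := by
      rw [card_filter_product_eq_sum Q (Y ×ˢ Y) (fun q x => k ≤ maxDiffCount I
        (groundSet I (K * H) q x.1 ∪ groundSet I (K * H) q x.2)), Nat.cast_sum,
        Finset.sum_product_right]
      calc _ ≤ ∑ n₂ ∈ Y, ∑ n₁ ∈ Y, (3 * T.card * (Q.card * E) +
            (if L (n₁ - n₂) then (Q.card : ℝ) else 0)) :=
            Finset.sum_le_sum fun n₂ hn₂ => Finset.sum_le_sum fun n₁ hn₁ => hpair n₁ hn₁ n₂ hn₂
        _ = Q.card * (Y.card : ℝ) ^ 2 * (3 * T.card * E) +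
            ∑ n₂ ∈ Y, Q.card * ((Y.filter (fun n₁ => L (n₁ - n₂))).card : ℝ) := by
            have he : ∀ n₂ ∈ Y, ∑ n₁ ∈ Y, (3 * T.card * (Q.card * E) +
                (if L (n₁ - n₂) then (Q.card : ℝ) else 0)) = Y.card * (3 * T.card * (Q.card * E)) +
                Q.card * ((Y.filter (fun n₁ => L (n₁ - n₂))).card : ℝ) := fun n₂ _ => by
              rw [Finset.sum_add_distrib, Finset.sum_const, nsmul_eq_mul, Finset.sum_ite,
                Finset.sum_const_zero, Finset.sum_const, nsmul_eq_mul, add_zero,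
                mul_comm (Q.card : ℝ) ((Y.filter _).card : ℝ)]
            rw [Finset.sum_congr rfl he, Finset.sum_add_distrib, Finset.sum_const, nsmul_eq_mul]
            congr 1
            ring
        _ ≤ Q.card * (Y.card : ℝ) ^ 2 * (3 * T.card * E) +
            ∑ n₂ ∈ Y, Q.card * (y * Real.log y * E) := by
            gcongr with n₂ hn₂
            exact hW n₂ hn₂
        _ = _ := by
            rw [Finset.sum_const, nsmul_eq_mul]; ring
    have hA := hb.mul_rpow_le (A := A) (s := 3 * T.card + Real.log y) (by
      have h1 : (T.card : ℝ) ≤ Real.log y ^ 2 := hb.card_le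
      have h2 : Real.log y ^ 2 ≤ Real.log y ^ 4 := pow_le_pow_right₀ (by linarith) (by norm_num)
      linarith)
    have hsub : (((Q ×ˢ Y ×ˢ Y).filter p).filter (fun x => k ≤ maxDiffCount I
      (groundSet I (K * H) x.1 x.2.1 ∪ groundSet I (K * H) x.1 x.2.2))).card ≤
      ((Q ×ˢ Y ×ˢ Y).filter (fun x => k ≤ maxDiffCount I
        (groundSet I (K * H) x.1 x.2.1 ∪ groundSet I (K * H) x.1 x.2.2))).card :=
      Finset.card_le_card (Finset.filter_subset_filter _ (Finset.filter_subset _ _))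
    calc _ ≤ _ := (Nat.cast_le.2 hsub).trans hsum
      _ ≤ Q.card * (Y.card : ℝ) ^ 2 * (3 * T.card * E) +
          Q.card * (Y.card * (Y.card * Real.log y * E)) := by gcongr
      _ = Q.card * (Y.card : ℝ) ^ 2 * ((3 * T.card + Real.log y) * Real.log y ^ A) *
          Real.exp (-c * k) := by rw [hE]; ring
      _ ≤ _ := by gcongr
  have h := hm (ℕ × ℤ × ℤ) (Q ×ˢ Y ×ˢ Y) ((Q ×ˢ Y ×ˢ Y).filter p)
    (fun x => residueExpectation (primeProd z) (fun b =>
        sieveWeight I M K z b H x.1 x.2.1 * sieveWeight I M K z b H x.1 x.2.2))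
    (fun x => maxDiffCount I (groundSet I (K * H) x.1 x.2.1 ∪ groundSet I (K * H) x.1 x.2.2)) 1
    (Finset.filter_subset _ _) zero_le_one
    (fun x hx => by
      obtain ⟨hx, hd⟩ := Finset.mem_filter.1 hx
      have hq := hs.prime _ (Finset.mem_product.1 hx).1
      exact hI.sieveWeight_mul_expectation hK hg hq hq hd)
    (fun x hx _ => by
      have hq := hs.prime _ (Finset.mem_product.1 hx).1
      have h1 := hI.sieveWeight_mul_expectation_trivial hg hq hq x.2.1 x.2.2 (R := fun _ => 1)
        (fun _ => zero_le_one) (fun _ => le_rfl)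
      simp only [one_mul] at h1
      have h2 := hg.inv_pow_le
      have h3 : (1 / sieveDensityBetween I (H ^ M) z) ^ (2 * (B * ⌊K * H⌋₊)) ≤
          Real.log y ^ 2 * (1 / sieveDensityBetween I (H ^ M) z) ^ (2 * (B * ⌊K * H⌋₊)) := by
        have : (1 : ℝ) ≤ Real.log y ^ 2 := one_le_pow₀ (by linarith)
        have h4 : 0 ≤ (1 / sieveDensityBetween I (H ^ M) z) ^ (2 * (B * ⌊K * H⌋₊)) :=
          h1.1.trans h1.2
        nlinarith
      rw [one_mul, abs_le]
      constructor <;> linarith [h1.1, h1.2])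
    (by
      have h1 := Finset.card_filter_add_card_filter_not (s := Q ×ˢ Y ×ˢ Y) p
      have h2 : ((Q ×ˢ Y ×ˢ Y).card : ℝ) - ((Q ×ˢ Y ×ˢ Y).filter p).card =
          ((Q ×ˢ Y ×ˢ Y).filter (fun x => ¬ p x)).card := by
        rw [← h1]; push_cast; ring
      rw [h2, hScard]
      refine hbadcard.trans ?_
      have h3 : (1 + T.card : ℝ) ≤ Y.card * (y : ℝ) ^ (-1 / 10 : ℝ) := by
        calc (1 + T.card : ℝ) ≤ 1 + Real.log y ^ 2 := by
              have := hb.card_le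
              linarith
          _ ≤ (y : ℝ) ^ (9 / 10 : ℝ) := hb.one_add_le
          _ = (y : ℝ) * (y : ℝ) ^ (-1 / 10 : ℝ) := by
              nth_rewrite 2 [← Real.rpow_one (y : ℝ)]
              rw [← Real.rpow_add hy0]; norm_num
          _ ≤ _ := by gcongr
      calc (Q.card : ℝ) * (Y.card * (1 + T.card)) ≤
          Q.card * (Y.card * (Y.card * (y : ℝ) ^ (-1 / 10 : ℝ))) := by gcongr
        _ = _ := by ring)
    (fun k hk => by rw [hScard]; exact htail k hk)
  rw [hScard, mul_one] at h
  exact h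

end

/-! ### Moments for (iii): sums over primes and steps through a given point. -/

section
variable {I : (p : ℕ) → Finset (ZMod p)} {B : ℕ} {ρ : ℕ → ℝ} {M K : ℝ} {y : ℕ} {z H c A C D : ℝ}
  {Q : Finset ℕ} {ν : ℕ} {a : ℕ → ℕ → ℤ}

theorem abs_sum_indicator_sieveWeight_sub_le (hI : IsRegularSievingSystem I B ρ) (hK : 0 < K)
    (hg : GoodScale I B M K y z H) (hs : SparseShifts I K y H c A Q ν)
    (hb : SizeBounds M K D y H ν)
    (hm : MeanBound y H M c (16 * (B : ℝ) ^ 4 * K ^ 2) (A + 5) C) (ha : IsEnumeration I a)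
    {i₀ : ℕ} (hi₀ : i₀ ∈ Finset.Icc 1 ν) (n : ℤ) :
    |∑ x ∈ Q ×ˢ Finset.Icc 1 ⌊K * H⌋₊, residueExpectation (primeProd z) (fun b =>
        {b : ℤ | n ∈ shiftedSet I 0 z b}.indicator 1 b *
          sieveWeight I M K z b H x.1 (n - a i₀ x.1 - (x.1 : ℤ) * x.2)) -
      Q.card * (⌊K * H⌋₊ : ℝ) * sieveDensity I (H ^ M)| ≤
      C * (Real.log H / H ^ (M - 2)) * (Q.card * (⌊K * H⌋₊ : ℝ) * sieveDensity I (H ^ M)) := by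
  classical
  have hH0 : 0 < H := by linarith [hg.one_le]
  have hScard : ((Q ×ˢ Finset.Icc 1 ⌊K * H⌋₊).card : ℝ) = Q.card * (⌊K * H⌋₊ : ℝ) := by
    rw [Finset.card_product, Nat.card_Icc, Nat.add_sub_cancel]; push_cast; ring
  have h := hm (ℕ × ℕ) (Q ×ˢ Finset.Icc 1 ⌊K * H⌋₊) (Q ×ˢ Finset.Icc 1 ⌊K * H⌋₊)
    (fun x => residueExpectation (primeProd z) (fun b =>
        {b : ℤ | n ∈ shiftedSet I 0 z b}.indicator 1 b *
          sieveWeight I M K z b H x.1 (n - a i₀ x.1 - (x.1 : ℤ) * x.2)))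
    (fun x => maxDiffCount I (groundSet I (K * H) x.1 (n - a i₀ x.1 - (x.1 : ℤ) * x.2)))
    (sieveDensity I (H ^ M)) (Finset.Subset.refl _) (sieveDensity_pos hI.card_le_pred _).le
    (fun x hx => by
      obtain ⟨hx₁, hx₂⟩ := Finset.mem_product.1 hx
      have hp := hs.prime _ hx₁
      exact hI.indicator_sieveWeight_expectation hK hg hp
        (self_mem_groundSet ha hp (hs.card_eq _ hx₁) hi₀ hx₂))
    (fun x hx hx' => absurd hx hx') (by rw [sub_self]; positivity) (fun k hk => by
      have hA := hb.mul_rpow_le (A := A) (s := (shiftIndices ν ⌊K * H⌋₊).card) (by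
        have := hb.card_le
        have hℓ := hb.six_le_log
        nlinarith [sq_nonneg (Real.log y ^ 2), sq_nonneg (Real.log y)])
      rw [hScard]
      have e := card_filter_product_eq_sum Q (Finset.Icc 1 ⌊K * H⌋₊) (fun q h =>
        k ≤ maxDiffCount I (groundSet I (K * H) q (n - a i₀ q - (q : ℤ) * h)))
      rw [e, Nat.cast_sum]
      calc _ ≤ ∑ h ∈ Finset.Icc 1 ⌊K * H⌋₊, ((shiftIndices ν ⌊K * H⌋₊).card *
            (Q.card * Real.log y ^ A * Real.exp (-c * k)) : ℝ) :=
            Finset.sum_le_sum fun h _ =>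
              hs.card_single_le hK hH0 ha (fun q => n - a i₀ q - (q : ℤ) * h) hk
        _ = Q.card * (⌊K * H⌋₊ : ℝ) * ((shiftIndices ν ⌊K * H⌋₊).card * Real.log y ^ A) *
            Real.exp (-c * k) := by
            rw [Finset.sum_const, Nat.card_Icc, Nat.add_sub_cancel, nsmul_eq_mul]; ring
        _ ≤ _ := by gcongr)
  rwa [hScard] at h

/-- The good quadruples are those whose progressions meet only in `n`. The others, including all
with equal primes and a second common point, are counted by `card_bad_le`, and the tail by
`card_pair_shift_le`. -/
theorem abs_sum_indicator_sieveWeight_mul_sub_le (hI : IsRegularSievingSystem I B ρ) (hK : 0 < K)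
    (hg : GoodScale I B M K y z H) (hs : SparseShifts I K y H c A Q ν)
    (hb : SizeBounds M K D y H ν)
    (hD : ∀ v : ℤ, v ≠ 0 → |(v : ℝ)| ≤ (K + 1) * y →
      (diffPrimes I v).Finite ∧ ((diffPrimes I v).ncard : ℝ) ≤ D)
    (hm : MeanBound y H M c (16 * (B : ℝ) ^ 4 * K ^ 2) (A + 5) C) (ha : IsEnumeration I a)
    {i₀ : ℕ} (hi₀ : i₀ ∈ Finset.Icc 1 ν) (n : ℤ) :
    |∑ x ∈ (Q ×ˢ Q) ×ˢ (Finset.Icc 1 ⌊K * H⌋₊ ×ˢ Finset.Icc 1 ⌊K * H⌋₊),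
        residueExpectation (primeProd z) (fun b => {b : ℤ | n ∈ shiftedSet I 0 z b}.indicator 1 b *
          (sieveWeight I M K z b H x.1.1 (n - a i₀ x.1.1 - (x.1.1 : ℤ) * x.2.1) *
            sieveWeight I M K z b H x.1.2 (n - a i₀ x.1.2 - (x.1.2 : ℤ) * x.2.2))) -
      (Q.card * (⌊K * H⌋₊ : ℝ)) ^ 2 *
        (sieveDensity I (H ^ M) * (1 / sieveDensityBetween I (H ^ M) z))| ≤
      C * (Real.log H / H ^ (M - 2)) * ((Q.card * (⌊K * H⌋₊ : ℝ)) ^ 2 *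
        (sieveDensity I (H ^ M) * (1 / sieveDensityBetween I (H ^ M) z))) := by
  classical
  have hℓ := hb.six_le_log
  have hℓ0 : 0 < Real.log y := by linarith
  have hy0 : (0 : ℝ) < y := by
    by_contra! h
    have : (y : ℝ) = 0 := le_antisymm h (Nat.cast_nonneg _)
    rw [this, Real.log_zero] at hℓ0
    exact lt_irrefl _ hℓ0
  have hy1 : (1 : ℝ) ≤ y := by exact_mod_cast (show 0 < y by exact_mod_cast hy0)
  have hD0 : 0 ≤ D := (Nat.cast_nonneg _).trans (hD 1 one_ne_zero (by push_cast; rw [abs_one]; nlinarith)).2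
  have hσ := sieveDensity_pos hI.card_le_pred (H ^ M)
  have hσ₂ := sieveDensityBetween_pos hI.card_le_pred (H ^ M) z
  have hσ₂' := sieveDensityBetween_le_one hI.card_le_pred (H ^ M) z
  set T := shiftIndices ν ⌊K * H⌋₊ with hT
  set R := Finset.Icc 1 ⌊K * H⌋₊ with hR
  have hRcard : (R.card : ℝ) = ⌊K * H⌋₊ := by
    rw [hR, Nat.card_Icc, Nat.add_sub_cancel]
  set S := (Q ×ˢ Q) ×ˢ (R ×ˢ R) with hS
  set g₁ : (ℕ × ℕ) × (ℕ × ℕ) → Finset ℤ := fun x =>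
    groundSet I (K * H) x.1.1 (n - a i₀ x.1.1 - (x.1.1 : ℤ) * x.2.1) with hg₁
  set g₂ : (ℕ × ℕ) × (ℕ × ℕ) → Finset ℤ := fun x =>
    groundSet I (K * H) x.1.2 (n - a i₀ x.1.2 - (x.1.2 : ℤ) * x.2.2) with hg₂
  set μ := sieveDensity I (H ^ M) * (1 / sieveDensityBetween I (H ^ M) z) with hμ
  have hμ0 : 0 < μ := by positivity
  have hScard : (S.card : ℝ) = (Q.card * (⌊K * H⌋₊ : ℝ)) ^ 2 := by
    rw [hS, Finset.card_product, Finset.card_product, Finset.card_product, ← hRcard]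
    push_cast; ring
  have hbadcard : ((S.filter (fun x => ¬ (g₁ x ∩ g₂ x = {n}))).card : ℝ) ≤
      S.card * (y : ℝ) ^ (-1 / 10 : ℝ) := by
    rw [card_filter_product_eq_sum (Q ×ˢ Q) (R ×ˢ R) (fun q h => ¬ (g₁ (q, h) ∩ g₂ (q, h) = {n})),
      Nat.cast_sum]
    calc _ ≤ ∑ h ∈ R ×ˢ R, (Q.card * (T.card * D) : ℝ) :=
          Finset.sum_le_sum fun h hh =>
            hs.card_bad_le hK hg.one_le ha hD hi₀ (Finset.mem_product.1 hh).1
              (Finset.mem_product.1 hh).2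
      _ = (⌊K * H⌋₊ : ℝ) ^ 2 * (Q.card * (T.card * D)) := by
          rw [Finset.sum_const, nsmul_eq_mul, Finset.card_product, Nat.cast_mul, hRcard]; ring
      _ ≤ (⌊K * H⌋₊ : ℝ) ^ 2 * (Q.card * (Q.card * (y : ℝ) ^ (-1 / 10 : ℝ))) := by
          have h1 : (T.card : ℝ) * D ≤ Q.card * (y : ℝ) ^ (-1 / 10 : ℝ) := by
            calc (T.card : ℝ) * D ≤ Real.log y ^ 2 * D := by
                  have : (T.card : ℝ) ≤ Real.log y ^ 2 := hb.card_le
                  gcongr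
              _ ≤ _ := hb.mul_le
              _ ≤ _ := by
                  have := hs.le_card
                  gcongr
          gcongr
      _ = _ := by rw [hScard]; ring
  have htail : ∀ k : ℕ, 1 ≤ k → (((S.filter (fun x => g₁ x ∩ g₂ x = {n})).filter
      (fun x => k ≤ maxDiffCount I (g₁ x ∪ g₂ x))).card : ℝ) ≤
      S.card * Real.log y ^ (A + 5) * Real.exp (-c * k) := by
    intro k hk
    have hsub : ((S.filter (fun x => g₁ x ∩ g₂ x = {n})).filter
        (fun x => k ≤ maxDiffCount I (g₁ x ∪ g₂ x))).card ≤
        (S.filter (fun x => k ≤ maxDiffCount I (g₁ x ∪ g₂ x))).card :=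
      Finset.card_le_card (Finset.filter_subset_filter _ (Finset.filter_subset _ _))
    have hA := hb.mul_rpow_le (A := A) (s := 3 * (T.card : ℝ) ^ 2) (by
      have h1 : (T.card : ℝ) ≤ Real.log y ^ 2 := hb.card_le
      have h2 : (T.card : ℝ) ^ 2 ≤ (Real.log y ^ 2) ^ 2 := by gcongr
      nlinarith)
    refine (Nat.cast_le.2 hsub).trans ?_
    rw [card_filter_product_eq_sum (Q ×ˢ Q) (R ×ˢ R)
      (fun q h => k ≤ maxDiffCount I (g₁ (q, h) ∪ g₂ (q, h))), Nat.cast_sum]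
    calc _ ≤ ∑ h ∈ R ×ˢ R, (3 * (T.card : ℝ) ^ 2 *
          (Q.card * (Q.card * Real.log y ^ A * Real.exp (-c * k)))) :=
          Finset.sum_le_sum fun h hh =>
            hs.card_pair_shift_le hK hg.one_le ha hi₀ (Finset.mem_product.1 hh).1
              (Finset.mem_product.1 hh).2 hk
      _ = (Q.card * (⌊K * H⌋₊ : ℝ)) ^ 2 * (3 * (T.card : ℝ) ^ 2 * Real.log y ^ A) *
          Real.exp (-c * k) := by
          rw [Finset.sum_const, nsmul_eq_mul, Finset.card_product, Nat.cast_mul, hRcard]; ring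
      _ ≤ _ := by rw [hScard]; gcongr
  have h := hm ((ℕ × ℕ) × (ℕ × ℕ)) S (S.filter (fun x => g₁ x ∩ g₂ x = {n}))
    (fun x => residueExpectation (primeProd z) (fun b =>
      {b : ℤ | n ∈ shiftedSet I 0 z b}.indicator 1 b *
        (sieveWeight I M K z b H x.1.1 (n - a i₀ x.1.1 - (x.1.1 : ℤ) * x.2.1) *
          sieveWeight I M K z b H x.1.2 (n - a i₀ x.1.2 - (x.1.2 : ℤ) * x.2.2))))
    (fun x => maxDiffCount I (g₁ x ∪ g₂ x)) μ (Finset.filter_subset _ _) hμ0.le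
    (fun x hx => by
      obtain ⟨hx, hd⟩ := Finset.mem_filter.1 hx
      have hq := Finset.mem_product.1 (Finset.mem_product.1 hx).1
      exact hI.indicator_sieveWeight_mul_expectation hK hg (hs.prime _ hq.1) (hs.prime _ hq.2) hd)
    (fun x hx _ => by
      have hq := Finset.mem_product.1 (Finset.mem_product.1 hx).1
      have h1 := hI.sieveWeight_mul_expectation_trivial hg (hs.prime _ hq.1) (hs.prime _ hq.2)
        (n - a i₀ x.1.1 - (x.1.1 : ℤ) * x.2.1) (n - a i₀ x.1.2 - (x.1.2 : ℤ) * x.2.2)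
        (R := {b : ℤ | n ∈ shiftedSet I 0 z b}.indicator 1)
        (fun b => indicator_one_nonneg _ b)
        (fun b => Set.indicator_le_self' (fun _ _ => zero_le_one) b)
      have h2 := hg.inv_pow_le
      -- The mean `μ` may be small, while the exceptional terms must be bounded relative to it. This
      -- is why `inv_pow_le` contains `log y ^ 2`; its additional 1 accounts for `μ` itself in the
      -- deviation.
      have h3 : 1 ≤ Real.log y ^ 2 * μ := by
        have h4 : 1 / Real.log y ^ 2 ≤ μ := by
          refine hg.le_sieveDensity.trans ?_
          rw [sieveDensity_eq_mul I hg.rpow_le, hμ]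
          refine mul_le_mul_of_nonneg_left (hσ₂'.trans ?_) hσ.le
          rwa [le_div_iff₀ hσ₂, one_mul]
        rwa [div_le_iff₀ (by positivity), mul_comm] at h4
      set P := (1 / sieveDensityBetween I (H ^ M) z) ^ (2 * (B * ⌊K * H⌋₊)) with hP
      have hP0 : 0 ≤ P := h1.1.trans h1.2
      have h5 : μ * (Real.log y ^ 2 * P + 1) ≤ μ * (y : ℝ) ^ (1 / 20 : ℝ) :=
        mul_le_mul_of_nonneg_left h2 hμ0.le
      have h6 : P ≤ Real.log y ^ 2 * μ * P := le_mul_of_one_le_left hP0 h3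
      rw [abs_le]
      constructor <;> nlinarith [h1.1, h1.2])
    (by
      have h1 := Finset.card_filter_add_card_filter_not (s := S) (fun x => g₁ x ∩ g₂ x = {n})
      have h2 : (S.card : ℝ) - (S.filter (fun x => g₁ x ∩ g₂ x = {n})).card =
          (S.filter (fun x => ¬ (g₁ x ∩ g₂ x = {n}))).card := by
        rw [← h1]; push_cast; ring
      rwa [h2])
    htail
  rwa [hScard] at h

end

/-! ### Assembly of the three parts. -/

theorem abs_sum_sub_card_mul_le {ι : Type*} (N : Finset ι) (F : ι → ℝ) {m e : ℝ}
    (h : ∀ n ∈ N, |F n - m| ≤ e * m) : |∑ n ∈ N, F n - N.card * m| ≤ e * (N.card * m) := by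
  calc _ = |∑ n ∈ N, (F n - m)| := by rw [Finset.sum_sub_distrib, Finset.sum_const, nsmul_eq_mul]
    _ ≤ ∑ n ∈ N, (e * m) := (Finset.abs_sum_le_sum_abs _ _).trans (Finset.sum_le_sum h)
    _ = _ := by rw [Finset.sum_const, nsmul_eq_mul]; ring

theorem gapExponent_le_half (r : ℝ) : gapExponent r ≤ 1 / 2 :=
  Real.sSup_le (fun _ h => h.2.1.le) (by norm_num)

theorem sum_sievedInterval (I : (p : ℕ) → Finset (ZMod p)) (z : ℝ) (y : ℕ) (b : ℤ) (F : ℤ → ℝ) :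
    ∑ n ∈ sievedInterval I z y b, F n =
      ∑ n ∈ Finset.Icc (1 : ℤ) y, {b : ℤ | n ∈ shiftedSet I 0 z b}.indicator 1 b * F n := by
  classical
  rw [sievedInterval, Finset.sum_filter]
  exact Finset.sum_congr rfl fun n _ => by simp [Set.indicator_apply]

section
variable {I : (p : ℕ) → Finset (ZMod p)} {B : ℕ} {ρ : ℕ → ℝ} {M K : ℝ} {y : ℕ} {z H c A C D : ℝ}
  {Q : Finset ℕ} {ν : ℕ} {a : ℕ → ℕ → ℤ}

/-- The power is expanded, so the estimates for individual base points or pairs apply. The interval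
contains `(K + 2) * y` integers up to an error of 1, negligible because `log H / H ^ (M - 2)` is at
least `1 / y`. -/
theorem abs_expectation_sum_primes_sub_le (hI : IsRegularSievingSystem I B ρ) (hK : 0 < K)
    (hg : GoodScale I B M K y z H) (hs : SparseShifts I K y H c A Q ν) (hν : 1 ≤ ν)
    (hb : SizeBounds M K D y H ν) (hC : 0 ≤ C)
    (hm : MeanBound y H M c (16 * (B : ℝ) ^ 4 * K ^ 2) (A + 5) C) {j : ℕ}
    (hj : j ∈ ({0, 1, 2} : Set ℕ)) :
    |residueExpectation (primeProd z) (fun b => ∑ q ∈ Q,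
        (∑ n ∈ Finset.Ioc ⌊-((K + 1) * y)⌋ (y : ℤ), sieveWeight I M K z b H q n) ^ j)
        - ((K + 2) * y) ^ j * Q.card| ≤
      (4 * C + 3) * (Real.log H / H ^ (M - 2)) * (((K + 2) * y) ^ j * Q.card) := by
  have hη0 : 0 ≤ Real.log H / H ^ (M - 2) :=
    div_nonneg (Real.log_nonneg hg.one_le) (Real.rpow_nonneg (by linarith [hg.one_le]) _)
  set η := Real.log H / H ^ (M - 2) with hη
  have hη1 : 1 ≤ η * y := hb.one_le_mul
  have hy0 : (0 : ℝ) ≤ y := Nat.cast_nonneg _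
  have hy1 : (1 : ℝ) ≤ y := by
    have : (y : ℝ) ≠ 0 := fun h => by rw [h, mul_zero] at hη1; linarith
    exact_mod_cast Nat.one_le_iff_ne_zero.2 (by exact_mod_cast this)
  set Y := Finset.Ioc ⌊-((K + 1) * y)⌋ (y : ℤ) with hYd
  set Z := (K + 2) * y with hZ
  have hZy : (y : ℝ) ≤ Z := by nlinarith
  have hZ1 : 1 ≤ Z := hy1.trans hZy
  have hηZ : 1 ≤ η * Z := hη1.trans (by gcongr)
  have hf1 := Int.floor_le (-((K + 1) * y))
  have hf2 := Int.lt_floor_add_one (-((K + 1) * y))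
  have hYcard : (Y.card : ℝ) = y - ⌊-((K + 1) * y)⌋ := by
    rw [hYd, Int.card_Ioc]
    have : ⌊-((K + 1) * y)⌋ ≤ (y : ℤ) := by
      have : (⌊-((K + 1) * y)⌋ : ℝ) ≤ (y : ℤ) := by push_cast; nlinarith
      exact_mod_cast this
    have e : (((y : ℤ) - ⌊-((K + 1) * y)⌋).toNat : ℤ) = y - ⌊-((K + 1) * y)⌋ :=
      Int.toNat_of_nonneg (by linarith)
    exact_mod_cast e
  have hY1 : Z ≤ Y.card := by rw [hYcard, hZ]; linarith
  -- Together with `1 ≤ Z` this gives at most `2 * Z` integers; squaring is the origin of the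
  -- constant `4 * C`, and the rounding error gives the 3.
  have hY2 : (Y.card : ℝ) ≤ Z + 1 := by rw [hYcard, hZ]; linarith
  have hQ0 : (0 : ℝ) ≤ Q.card := Nat.cast_nonneg _
  rcases hj with rfl | rfl | rfl
  · simp only [pow_zero, one_mul]
    rw [Finset.sum_const, nsmul_eq_mul, mul_one,
      residueExpectation_const (primeProd_pos z), sub_self, abs_zero]
    positivity
  · simp only [pow_one]
    have h := abs_sum_sub_card_mul_le Y (fun n => ∑ q ∈ Q, residueExpectation (primeProd z)
      (fun b => sieveWeight I M K z b H q n)) (fun n _ =>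
        abs_sum_sieveWeight_sub_le hI hK hg hs hb hm n)
    have e : residueExpectation (primeProd z) (fun b => ∑ q ∈ Q, ∑ n ∈ Y,
        sieveWeight I M K z b H q n) = ∑ n ∈ Y, ∑ q ∈ Q, residueExpectation (primeProd z)
          (fun b => sieveWeight I M K z b H q n) := by
      simp_rw [residueExpectation_sum]
      rw [Finset.sum_comm]
    rw [e]
    have h2 : |(Y.card : ℝ) * Q.card - Z * Q.card| ≤ 1 * Q.card := by
      rw [← sub_mul, abs_mul, Nat.abs_cast]
      gcongr
      rw [abs_le]; constructor <;> linarith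
    calc _ ≤ _ := abs_sub_le _ ((Y.card : ℝ) * Q.card) _
      _ ≤ C * η * (Y.card * Q.card) + 1 * Q.card := add_le_add h h2
      _ ≤ C * η * ((Z + Z) * Q.card) + (η * Z) * Q.card := by
          gcongr
          linarith
      _ ≤ _ := by
          have : 0 ≤ η * (Z * Q.card) := by positivity
          nlinarith
  · have hYd' : ∀ n₁ ∈ Y, ∀ n₂ ∈ Y, ((n₁ - n₂ : ℤ) : ℝ) ≤ (K + 2) * y := by
      intro n₁ hn₁ n₂ hn₂
      have h1 : (n₁ : ℝ) ≤ y := by exact_mod_cast (Finset.mem_Ioc.1 hn₁).2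
      have h2 := Int.floor_lt.1 (Finset.mem_Ioc.1 hn₂).1
      push_cast
      linarith
    have h := abs_sum_sieveWeight_mul_sub_le hI hK hg hs hν hb hm Y (hZy.trans hY1) hYd'
    have e : residueExpectation (primeProd z) (fun b => ∑ q ∈ Q, (∑ n ∈ Y,
        sieveWeight I M K z b H q n) ^ 2) = ∑ x ∈ Q ×ˢ Y ×ˢ Y, residueExpectation (primeProd z)
          (fun b => sieveWeight I M K z b H x.1 x.2.1 * sieveWeight I M K z b H x.1 x.2.2) := by
      rw [← residueExpectation_sum]
      congr 1
      funext b
      rw [Finset.sum_product]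
      refine Finset.sum_congr rfl fun q _ => ?_
      rw [sq, Finset.sum_mul_sum, Finset.sum_product]
    rw [e]
    have h2 : |(Q.card : ℝ) * (Y.card : ℝ) ^ 2 - Z ^ 2 * Q.card| ≤ (3 * Z) * Q.card := by
      rw [mul_comm, ← sub_mul, abs_mul, Nat.abs_cast]
      gcongr
      rw [abs_le]; constructor <;> nlinarith
    have h3 : (Y.card : ℝ) ^ 2 ≤ (Z + Z) ^ 2 := by gcongr; linarith
    calc _ ≤ _ := abs_sub_le _ ((Q.card : ℝ) * (Y.card : ℝ) ^ 2) _
      _ ≤ C * η * (Q.card * (Y.card : ℝ) ^ 2) + (3 * Z) * Q.card := add_le_add h h2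
      _ ≤ C * η * (Q.card * (Z + Z) ^ 2) + (3 * Z * (η * Z)) * Q.card := by
          refine add_le_add (by gcongr) (mul_le_mul_of_nonneg_right ?_ hQ0)
          exact le_mul_of_one_le_right (by positivity) hηZ
      _ = _ := by ring

/-- Membership of `n` in the random set is written as an indicator, which turns the sum into one
over all `n ≤ y` of the expectations estimated pointwise; the main terms agree because `σ` is the
product of the densities below and above `H ^ M`. -/
theorem abs_expectation_sum_sievedInterval_sub_le (hI : IsRegularSievingSystem I B ρ) (hK : 0 < K)
    (hg : GoodScale I B M K y z H) (hs : SparseShifts I K y H c A Q ν)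
    (hb : SizeBounds M K D y H ν)
    (hD : ∀ v : ℤ, v ≠ 0 → |(v : ℝ)| ≤ (K + 1) * y →
      (diffPrimes I v).Finite ∧ ((diffPrimes I v).ncard : ℝ) ≤ D) (hC : 0 ≤ C)
    (hm : MeanBound y H M c (16 * (B : ℝ) ^ 4 * K ^ 2) (A + 5) C) (ha : IsEnumeration I a)
    {i₀ : ℕ} (hi₀ : i₀ ∈ Finset.Icc 1 ν) {j : ℕ} (hj : j ∈ ({0, 1, 2} : Set ℕ)) :
    |residueExpectation (primeProd z) (fun b => ∑ n ∈ sievedInterval I z y b,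
        (∑ q ∈ Q, ∑ h ∈ Finset.Icc 1 ⌊K * H⌋₊,
          sieveWeight I M K z b H q (n - a i₀ q - (q : ℤ) * h)) ^ j)
        - ((Q.card : ℝ) * ⌊K * H⌋₊ / sieveDensity₂ I M z H) ^ j * (sieveDensity I z * y)| ≤
      C * (Real.log H / H ^ (M - 2)) *
        (((Q.card : ℝ) * ⌊K * H⌋₊ / sieveDensity₂ I M z H) ^ j * (sieveDensity I z * y)) := by
  have hη0 : 0 ≤ Real.log H / H ^ (M - 2) :=
    div_nonneg (Real.log_nonneg hg.one_le) (Real.rpow_nonneg (by linarith [hg.one_le]) _)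
  have hσ := sieveDensity_pos hI.card_le_pred (H ^ M)
  have hσ₂ := sieveDensityBetween_pos hI.card_le_pred (H ^ M) z
  have hN : ((Finset.Icc (1 : ℤ) y).card : ℝ) = y := by simp
  rw [sieveDensity₂_eq hI.card_le_pred hg.rpow_le]
  rcases hj with rfl | rfl | rfl
  · simp only [pow_zero, Finset.sum_const, nsmul_eq_mul, mul_one, one_mul]
    rw [residueExpectation_card_sievedInterval, sub_self, abs_zero]
    have := sieveDensity_pos hI.card_le_pred z
    positivity
  · have h := abs_sum_sub_card_mul_le (Finset.Icc (1 : ℤ) y) _ (fun n _ =>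
      abs_sum_indicator_sieveWeight_sub_le hI hK hg hs hb hm ha hi₀ n)
    rw [hN] at h
    simp only [pow_one]
    have e : residueExpectation (primeProd z) (fun b => ∑ n ∈ sievedInterval I z y b,
        ∑ q ∈ Q, ∑ h ∈ Finset.Icc 1 ⌊K * H⌋₊,
          sieveWeight I M K z b H q (n - a i₀ q - (q : ℤ) * h)) =
        ∑ n ∈ Finset.Icc (1 : ℤ) y, ∑ x ∈ Q ×ˢ Finset.Icc 1 ⌊K * H⌋₊,
          residueExpectation (primeProd z) (fun b =>
            {b : ℤ | n ∈ shiftedSet I 0 z b}.indicator 1 b *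
              sieveWeight I M K z b H x.1 (n - a i₀ x.1 - (x.1 : ℤ) * x.2)) := by
      simp_rw [← residueExpectation_sum, sum_sievedInterval, Finset.sum_product, Finset.mul_sum]
    have em : (Q.card : ℝ) * ⌊K * H⌋₊ / sieveDensityBetween I (H ^ M) z * (sieveDensity I z * y) =
        y * (Q.card * (⌊K * H⌋₊ : ℝ) * sieveDensity I (H ^ M)) := by
      rw [sieveDensity_eq_mul I hg.rpow_le]
      field_simp
    rw [e, em]
    exact h
  · have h := abs_sum_sub_card_mul_le (Finset.Icc (1 : ℤ) y) _ (fun n _ =>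
      abs_sum_indicator_sieveWeight_mul_sub_le hI hK hg hs hb hD hm ha hi₀ n)
    rw [hN] at h
    have e : residueExpectation (primeProd z) (fun b => ∑ n ∈ sievedInterval I z y b,
        (∑ q ∈ Q, ∑ h ∈ Finset.Icc 1 ⌊K * H⌋₊,
          sieveWeight I M K z b H q (n - a i₀ q - (q : ℤ) * h)) ^ 2) =
        ∑ n ∈ Finset.Icc (1 : ℤ) y,
          ∑ x ∈ (Q ×ˢ Q) ×ˢ (Finset.Icc 1 ⌊K * H⌋₊ ×ˢ Finset.Icc 1 ⌊K * H⌋₊),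
          residueExpectation (primeProd z) (fun b =>
            {b : ℤ | n ∈ shiftedSet I 0 z b}.indicator 1 b *
            (sieveWeight I M K z b H x.1.1 (n - a i₀ x.1.1 - (x.1.1 : ℤ) * x.2.1) *
              sieveWeight I M K z b H x.1.2 (n - a i₀ x.1.2 - (x.1.2 : ℤ) * x.2.2))) := by
      simp_rw [← residueExpectation_sum, sum_sievedInterval, ← Finset.mul_sum, Finset.sum_product,
        sq, Finset.sum_mul_sum]
    have em : ((Q.card : ℝ) * ⌊K * H⌋₊ / sieveDensityBetween I (H ^ M) z) ^ 2 *
        (sieveDensity I z * y) = y * ((Q.card * (⌊K * H⌋₊ : ℝ)) ^ 2 *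
        (sieveDensity I (H ^ M) * (1 / sieveDensityBetween I (H ^ M) z))) := by
      rw [sieveDensity_eq_mul I hg.rpow_le]
      field_simp
    rw [e, em]
    exact h

end

theorem theorem4 (I : (p : ℕ) → Finset (ZMod p)) (B : ℕ) (ρ : ℕ → ℝ)
    (hI : IsRegularSievingSystem I B ρ)
    (δ : ℝ) (hδ : 1 / 10 ^ 3 < δ) (hδC : δ < gapExponent 1)
    (M K ξ : ℝ) (hM : 2 < M) (hK : 0 < K) (hξ : 1 < ξ) :
    ∃ C x₀ : ℝ, ∀ x : ℝ, x₀ ≤ x → ∀ (y : ℕ) (z σ : ℝ) (P : ℕ),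
      y = yParam δ x → z = zParam δ x → σ = sieveDensity I z → P = primeProd z →
      (residueExpectation P (fun b => ((sievedInterval I z y b).card : ℝ)) = σ * y ∧
        |residueExpectation P (fun b => ((sievedInterval I z y b).card : ℝ) ^ 2)
            - (σ * y) ^ 2| ≤ C / Real.log y * (σ * y) ^ 2) ∧
      (∀ H ∈ scales ξ δ x, ∀ ν ∈ frequentSizes B ρ, ∀ j ∈ ({0, 1, 2} : Set ℕ),
        |residueExpectation P (fun b => ∑ q ∈ scalePrimes I ξ δ x H ν,
              (∑ n ∈ Finset.Ioc ⌊-((K + 1) * y)⌋ (y : ℤ), sieveWeight I M K z b H q n) ^ j)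
            - ((K + 2) * y) ^ j * (scalePrimes I ξ δ x H ν).card|
          ≤ C * (Real.log H / H ^ (M - 2)) *
              (((K + 2) * y) ^ j * (scalePrimes I ξ δ x H ν).card)) ∧
      (∀ a : ℕ → ℕ → ℤ, IsEnumeration I a →
        ∀ H ∈ scales ξ δ x, ∀ ν ∈ frequentSizes B ρ, ∀ i ∈ Finset.Icc 1 ν,
        ∀ j ∈ ({0, 1, 2} : Set ℕ),
        |residueExpectation P (fun b => ∑ n ∈ sievedInterval I z y b,
              (∑ q ∈ scalePrimes I ξ δ x H ν, ∑ h ∈ Finset.Icc 1 ⌊K * H⌋₊,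
                sieveWeight I M K z b H q (n - a i q - (q : ℤ) * h)) ^ j)
            - (((scalePrimes I ξ δ x H ν).card : ℝ) * ⌊K * H⌋₊ /
                sieveDensity₂ I M z H) ^ j * (σ * y)|
          ≤ C * (Real.log H / H ^ (M - 2)) *
              ((((scalePrimes I ξ δ x H ν).card : ℝ) * ⌊K * H⌋₊ /
                sieveDensity₂ I M z H) ^ j * (σ * y))) := by
  have hδ0 : 0 < δ := lt_trans (by norm_num) hδ
  have hδ' : δ < 1 / 2 := hδC.trans_le (gapExponent_le_half 1)
  obtain ⟨C₁, hC₁, h₁⟩ := eventually_abs_second_moment_sub_le hI hδ0 hδ'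
  obtain ⟨c, A, hc, hA, h₂⟩ := eventually_sparseShifts hI hδ0 hδ' hξ hK
  obtain ⟨C₂, hC₂, h₃⟩ := eventually_abs_sum_sub_le (D := 16 * (B : ℝ) ^ 4 * K ^ 2) (A := A + 5)
    hδ0 hδ' hξ hM hc (by positivity) (by linarith)
  obtain ⟨C₃, hC₃⟩ := hI.exists_ncard_le
  obtain ⟨x₀, hx₀⟩ := eventually_atTop.1 (h₁.and (h₂.and (h₃.and
    ((eventually_goodScale hI hδ0 hδ' hξ hM hK).and
      (eventually_sizeBounds hδ0 hδ' hξ hM hK B C₃)))))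
  refine ⟨max C₁ (4 * C₂ + 3), x₀, ?_⟩
  rintro x hx y z σ P rfl rfl rfl rfl
  obtain ⟨hx₁, hx₂, hx₃, hx₄, hx₅⟩ := hx₀ x hx
  have hη : ∀ H ∈ scales ξ δ x, 0 ≤ Real.log H / H ^ (M - 2) := fun H hH =>
    div_nonneg (Real.log_nonneg (hx₄ H hH).one_le)
      (Real.rpow_nonneg (by linarith [(hx₄ H hH).one_le]) _)
  refine ⟨⟨residueExpectation_card_sievedInterval _ _, hx₁.trans ?_⟩, ?_, ?_⟩
  · have := Real.log_natCast_nonneg (yParam δ x)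
    gcongr
    exact le_max_left _ _
  · intro H hH ν hν j hj
    refine (abs_expectation_sum_primes_sub_le hI hK (hx₄ H hH) (hx₂ H hH ν hν) hν.1
      (hx₅ H hH ν hν.2.1) hC₂ (hx₃ H hH) hj).trans ?_
    have := hη H hH
    gcongr
    exact le_max_right _ _
  · intro a ha H hH ν hν i hi j hj
    refine (abs_expectation_sum_sievedInterval_sub_le hI hK (hx₄ H hH) (hx₂ H hH ν hν)
      (hx₅ H hH ν hν.2.1) (fun v hv hu => hC₃ v _ hv hu) hC₂ (hx₃ H hH) ha hi hj).trans ?_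
    have := hη H hH
    have h1 := sieveDensity_pos hI.card_le_pred (zParam δ x)
    have h2 : 0 ≤ sieveDensity₂ I M (zParam δ x) H :=
      div_nonneg h1.le (sieveDensity_pos hI.card_le_pred _).le
    gcongr
    exact le_trans (by linarith) (le_max_right _ _)
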